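/- Let $\Bbbk$ be a field and let $H$ be a finite-dimensional semisimple weak Hopf algebra over $\Bbbk$, with target map $\epsilon_t(h)=\epsilon(1_{(1)}h)1_{(2)}$ and target algebra $H^t=\epsilon_t(H)$. Let $\operatorname{coRep}(H)$ be the category of finite-dimensional left $H$-comodules $x\mapsto x_{(-1)}\otimes x_{(0)}$, each with the $H^t$-bimodule structure $zx=\epsilon(zx_{(-1)})x_{(0)}$, $xz=\epsilon(x_{(-1)}z)x_{(0)}$; it is monoidal under $\otimes_{H^t}$ with the coaction $x\otimes y\mapsto x_{(-1)}y_{(-1)}\otimes(x_{(0)}\otimes y_{(0)})$ and unit object $H^t$. Let $F_H:\operatorname{coRep}(H)\to\operatorname{Vec}$ be the weak fiber functor, that is, the lax monoidal functor obtained by composing the monoidal functor $\operatorname{coRep}(H)\to\operatorname{Bim}(H^t)$ with the forgetful functor to vector spaces. A based action of $\operatorname{coRep}(H)$ on an algebra $A$ consists of a monoidal functor $F:\operatorname{coRep}(H)\to\operatorname{Bim}(A)$ and finite-dimensional subspaces $V_X\subseteq F(X)$ which are preserved by the maps $F(f)$, and by the tensor structure ($V_X\otimes V_Y\to F(X)\otimes_AF(Y)\cong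 F(X\otimes Y)$ has image in $V_{X\otimes Y}$), and with $1_A\in V_{\mathbf 1}$ under $A\cong F(\mathbf 1)$. Then $X\mapsto V_X$ is a lax monoidal functor. A based action over $F_H$ is a based action with a monoidal natural isomorphism $\varphi:F_H\cong V_{(-)}$. Two based actions on the same algebra $A$ are equivalent if there is a monoidal natural isomorphism between the two functors to $\operatorname{Bim}(A)$ which maps base spaces onto base spaces. $\operatorname{BasedAlg}(\operatorname{coRep}(H),F_H)$ is the category whose objects are the algebras with a based action over $F_H$. A morphism from $(A,F,V,\varphi)$ to $(B,G,U,\chi)$ is a based $B$-$A$-bimodule $M$ whose left $B$-module is $B$ itself, with base space spanned by $1_B$, for which there is a half-braiding, i.e. a natural family of bimodule isomorphisms $G(X)\otimes_BM\cong M\otimes_AF(X)$ compatible with the tensor product, which is the identity on base spaces: $\chi(x)\otimes1_B\mapsto1_B\otimes\varphi(x)$ for all $x\in F_H(X)$. Composition is the tensor product of bimodules. $\operatorname{ModAlg}(H)$ is the category whose objects are the left $H$-module algebras $A$ for which $H^t\to A$, $z\mapsto z\cdot1_A$, is injective, and whose morphisms are the $H$-equivariant algebra homomorphisms. Two objects $A,B$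 of $\operatorname{ModAlg}(H)$ are $J$-twisted isomorphic along an algebra isomorphism $\theta:A\to B$ if there is a monoidal natural automorphism $\alpha$ of $F_H$ such that $\theta(z\cdot1_A)=\alpha_{\mathbf 1}(z)\cdot1_B$ for all $z\in H^t$ and $$\theta(h_{(1)}\cdot a)\otimes\alpha_H(h_{(2)})=\alpha_H(h)_{(1)}\cdot\theta(a)\otimes\alpha_H(h)_{(2)}\quad\text{in } B\otimes_{H^t}H$$ for all $h\in H$, $a\in A$, where $H$ is a comodule by $\Delta$ and $B$ is a right $H^t$-module by $b\,z=b(z\cdot1_B)$. Then: (1) There is an equivalence of categories $E:\operatorname{BasedAlg}(\operatorname{coRep}(H),F_H)\to\operatorname{ModAlg}(H)$, compatible, up to a natural isomorphism $\psi$, with the forgetful functors to algebras (a bimodule $M:A\to B$ as above being sent to the algebra homomorphism $a\mapsto1_B\cdot a$). It can be chosen such that two based actions $V$, $W$ over $F_H$ on the same algebra $A$ are equivalent if and only if $E(A,V)$ and $E(A,W)$ are $J$-twisted isomorphic along the algebra isomorphism $\psi_W^{-1}\psi_V$. So $E$ also matches based actions up to equivalence with module algebras up to $J$-twisted isomorphism.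 (2) If the unit object $H^t$ of $\operatorname{Rep}(H)$ (with $h\cdot z=\epsilon_t(hz)$) is simple, as it is when $\operatorname{Rep}(H)$ is a fusion category, then $z\mapsto z\cdot1_A$ is injective for a left $H$-module algebra $A$ if and only if $A\neq0$; so in that case the objects of $\operatorname{ModAlg}(H)$ are all the nonzero left $H$-module algebras. -/

import Mathlib

universe u

set_option linter.unusedSectionVars false
set_option linter.unusedVariables false

open CategoryTheory
open scoped TensorProduct

namespace BasedAct

/-! ### Algebras and bimodules -/

/-- A (not necessarily commutative) unital associative algebra over `k`. -/
structure Alg (k : Type u) [Field k] where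
  carrier : Type u
  [ring : Ring carrier]
  [algebra : Algebra k carrier]

attribute [instance] Alg.ring Alg.algebra

/-- An `A`-`B`-bimodule over `k`; `lact a m` is `a m` and `ract b m` is `m b`. -/
structure Bimod {k : Type u} [Field k] (A B : Alg k) where
  carrier : Type u
  [addCommGroup : AddCommGroup carrier]
  [module : Module k carrier]
  lact : A.carrier →ₗ[k] carrier →ₗ[k] carrier
  ract : B.carrier →ₗ[k] carrier →ₗ[k] carrier
  one_lact : ∀ m, lact 1 m = m
  mul_lact : ∀ a a' m, lact (a * a') m = lact a (lact a' m)
  one_ract : ∀ m, ract 1 m = m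
  mul_ract : ∀ b b' m, ract (b * b') m = ract b' (ract b m)
  lact_ract : ∀ a b m, lact a (ract b m) = ract b (lact a m)

attribute [instance] Bimod.addCommGroup Bimod.module

/-- Homomorphisms of bimodules. -/
@[ext]
structure Bimod.Hom {k : Type u} [Field k] {A B : Alg k} (M N : Bimod A B) where
  toLin : M.carrier →ₗ[k] N.carrier
  map_lact : ∀ a m, toLin (M.lact a m) = N.lact a (toLin m)
  map_ract : ∀ b m, toLin (M.ract b m) = N.ract b (toLin m)

instance {k : Type u} [Field k] (A B : Alg k) : Category.{u} (Bimod A B) where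
  Hom M N := Bimod.Hom M N
  id M := ⟨LinearMap.id, fun _ _ => rfl, fun _ _ => rfl⟩
  comp f g := ⟨g.toLin ∘ₗ f.toLin, fun a m => by simp [f.map_lact, g.map_lact],
    fun b m => by simp [f.map_ract, g.map_ract]⟩

namespace Bimod

variable {k : Type u} [Field k]

@[simp] theorem id_toLin {A B : Alg k} (M : Bimod A B) :
    Hom.toLin (𝟙 M) = LinearMap.id := rfl

@[simp] theorem comp_toLin {A B : Alg k} {M N P : Bimod A B} (f : M ⟶ N) (g : N ⟶ P) :
    Hom.toLin (f ≫ g) = Hom.toLin g ∘ₗ Hom.toLin f := rfl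

theorem hom_ext {A B : Alg k} {M N : Bimod A B} {f g : M ⟶ N}
    (h : Hom.toLin f = Hom.toLin g) : f = g := Hom.ext h

/-- A bijective bimodule map is an isomorphism of bimodules. -/
def isoMk {A B : Alg k} {M N : Bimod A B} (f : M ⟶ N) (g : N.carrier →ₗ[k] M.carrier)
    (hfg : ∀ m, g (Hom.toLin f m) = m) (hgf : ∀ n, Hom.toLin f (g n) = n) : M ≅ N where
  hom := f
  inv := ⟨g, fun a n => by rw [← hfg (M.lact a (g n)), f.map_lact, hgf],
    fun b n => by rw [← hfg (M.ract b (g n)), f.map_ract, hgf]⟩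
  hom_inv_id := hom_ext (LinearMap.ext hfg)
  inv_hom_id := hom_ext (LinearMap.ext hgf)

/-- The relations `m b ⊗ n = m ⊗ b n` defining the tensor product over `B`. -/
def rel {A B C : Alg k} (M : Bimod A B) (N : Bimod B C) :
    Submodule k (M.carrier ⊗[k] N.carrier) :=
  Submodule.span k {t | ∃ m b n, t = M.ract b m ⊗ₜ[k] n - m ⊗ₜ[k] N.lact b n}

/-- The vector space `M ⊗_B N`. -/
def Tens {A B C : Alg k} (M : Bimod A B) (N : Bimod B C) : Type u :=
  (M.carrier ⊗[k] N.carrier) ⧸ rel M N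

namespace Tens

variable {A B C : Alg k} {M : Bimod A B} {N : Bimod B C}

instance : AddCommGroup (Tens M N) :=
  inferInstanceAs (AddCommGroup ((M.carrier ⊗[k] N.carrier) ⧸ rel M N))

instance : Module k (Tens M N) :=
  inferInstanceAs (Module k ((M.carrier ⊗[k] N.carrier) ⧸ rel M N))

variable (M N) in
/-- The canonical map `M × N → M ⊗_B N`. -/
def mk : M.carrier →ₗ[k] N.carrier →ₗ[k] Tens M N :=
  (TensorProduct.mk k M.carrier N.carrier).compr₂ (rel M N).mkQ

theorem balanced (m : M.carrier) (b : B.carrier) (n : N.carrier) :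
    mk M N (M.ract b m) n = mk M N m (N.lact b n) := by
  refine sub_eq_zero.1 ?_
  refine (map_sub (rel M N).mkQ _ _).symm.trans ?_
  exact (Submodule.Quotient.mk_eq_zero _).2 (Submodule.subset_span ⟨m, b, n, rfl⟩)

/-- A balanced bilinear map induces a linear map on `M ⊗_B N`. -/
def lift {P : Type u} [AddCommGroup P] [Module k P]
    (f : M.carrier →ₗ[k] N.carrier →ₗ[k] P)
    (hf : ∀ m b n, f (M.ract b m) n = f m (N.lact b n)) : Tens M N →ₗ[k] P :=
  (rel M N).liftQ (TensorProduct.lift f) (Submodule.span_le.2 (by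
    rintro _ ⟨m, b, n, rfl⟩
    simp [hf]))

theorem ext {P : Type*} [AddCommGroup P] [Module k P] {f g : Tens M N →ₗ[k] P}
    (h : ∀ m n, f (mk M N m n) = g (mk M N m n)) : f = g :=
  Submodule.linearMap_qext (rel M N) (TensorProduct.ext' h)

end Tens

/-- The tensor product `M ⊗_B N` as an `A`-`C`-bimodule. -/
def tensor {A B C : Alg k} (M : Bimod A B) (N : Bimod B C) : Bimod A C where
  carrier := Tens M N
  lact := LinearMap.mk₂ k
    (fun a => Tens.lift ((Tens.mk M N) ∘ₗ M.lact a) (fun m b n => by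
      simp only [LinearMap.comp_apply, M.lact_ract, Tens.balanced]))
    (fun a a' => LinearMap.congr_fun (Tens.ext (g := _ + _) fun m n => by
      change Tens.mk M N (M.lact (a + a') m) n
        = Tens.mk M N (M.lact a m) n + Tens.mk M N (M.lact a' m) n
      simp))
    (fun c a => LinearMap.congr_fun (Tens.ext (g := c • _) fun m n => by
      change Tens.mk M N (M.lact (c • a) m) n = c • Tens.mk M N (M.lact a m) n
      simp))
    (fun _ => map_add _) (fun c _ => map_smul _ c)
  ract := LinearMap.mk₂ k
    (fun c => Tens.lift ((Tens.mk M N).compl₂ (N.ract c)) (fun m b n => by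
      simp only [LinearMap.compl₂_apply, N.lact_ract, Tens.balanced]))
    (fun a a' => LinearMap.congr_fun (Tens.ext (g := _ + _) fun m n => by
      change Tens.mk M N m (N.ract (a + a') n)
        = Tens.mk M N m (N.ract a n) + Tens.mk M N m (N.ract a' n)
      simp))
    (fun c a => LinearMap.congr_fun (Tens.ext (g := c • _) fun m n => by
      change Tens.mk M N m (N.ract (c • a) n) = c • Tens.mk M N m (N.ract a n)
      simp))
    (fun _ => map_add _) (fun c _ => map_smul _ c)
  one_lact := LinearMap.congr_fun (g := LinearMap.id) (Tens.ext fun m n => by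
    change Tens.mk M N (M.lact 1 m) n = _
    rw [M.one_lact]; rfl)
  mul_lact a a' := LinearMap.congr_fun (g := _ ∘ₗ _) (Tens.ext fun m n => by
    change Tens.mk M N (M.lact (a * a') m) n = Tens.mk M N (M.lact a (M.lact a' m)) n
    rw [M.mul_lact])
  one_ract := LinearMap.congr_fun (g := LinearMap.id) (Tens.ext fun m n => by
    change Tens.mk M N m (N.ract 1 n) = _
    rw [N.one_ract]; rfl)
  mul_ract a a' := LinearMap.congr_fun (g := _ ∘ₗ _) (Tens.ext fun m n => by
    change Tens.mk M N m (N.ract (a * a') n) = Tens.mk M N m (N.ract a' (N.ract a n))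
    rw [N.mul_ract])
  lact_ract a c := LinearMap.congr_fun (f := _ ∘ₗ _) (g := _ ∘ₗ _)
    (Tens.ext fun m n => rfl)

/-- The canonical map `M × N → M ⊗_B N`. -/
def tmul {A B C : Alg k} (M : Bimod A B) (N : Bimod B C) :
    M.carrier →ₗ[k] N.carrier →ₗ[k] (tensor M N).carrier := Tens.mk M N

section tens

variable {A B C : Alg k} {M : Bimod A B} {N : Bimod B C}

theorem ract_tmul (m : M.carrier) (b : B.carrier) (n : N.carrier) :
    tmul M N (M.ract b m) n = tmul M N m (N.lact b n) := Tens.balanced m b n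

@[simp] theorem tensor_lact (a : A.carrier) (m : M.carrier) (n : N.carrier) :
    (tensor M N).lact a (tmul M N m n) = tmul M N (M.lact a m) n := rfl

@[simp] theorem tensor_ract (c : C.carrier) (m : M.carrier) (n : N.carrier) :
    (tensor M N).ract c (tmul M N m n) = tmul M N m (N.ract c n) := rfl

/-- A balanced bilinear map induces a linear map on `M ⊗_B N`. -/
def lift {P : Type u} [AddCommGroup P] [Module k P]
    (f : M.carrier →ₗ[k] N.carrier →ₗ[k] P)
    (hf : ∀ m b n, f (M.ract b m) n = f m (N.lact b n)) : (tensor M N).carrier →ₗ[k] P :=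
  Tens.lift f hf

@[simp] theorem lift_tmul {P : Type u} [AddCommGroup P] [Module k P]
    (f : M.carrier →ₗ[k] N.carrier →ₗ[k] P)
    (hf : ∀ m b n, f (M.ract b m) n = f m (N.lact b n)) (m : M.carrier)
    (n : N.carrier) : lift f hf (tmul M N m n) = f m n := rfl

theorem tensor_ext {P : Type*} [AddCommGroup P] [Module k P]
    {f g : (tensor M N).carrier →ₗ[k] P}
    (h : ∀ m n, f (tmul M N m n) = g (tmul M N m n)) : f = g := Tens.ext h

theorem tensor_ext₃ {D : Alg k} {N' : Bimod C D} {P : Type*} [AddCommGroup P] [Module k P]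
    {f g : (tensor (tensor M N) N').carrier →ₗ[k] P}
    (h : ∀ m n p, f (tmul _ N' (tmul M N m n) p) = g (tmul _ N' (tmul M N m n) p)) :
    f = g :=
  tensor_ext fun t p => LinearMap.congr_fun
    (f := f ∘ₗ (tmul (tensor M N) N').flip p) (g := g ∘ₗ (tmul (tensor M N) N').flip p)
    (tensor_ext fun m n => h m n p) t

theorem tensor_ext₃' {D : Alg k} {N' : Bimod C D} {P : Type*} [AddCommGroup P] [Module k P]
    {f g : (tensor M (tensor N N')).carrier →ₗ[k] P}
    (h : ∀ m n p, f (tmul M _ m (tmul N N' n p)) = g (tmul M _ m (tmul N N' n p))) :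
    f = g :=
  tensor_ext fun m t => LinearMap.congr_fun
    (f := f ∘ₗ tmul M (tensor N N') m) (g := g ∘ₗ tmul M (tensor N N') m)
    (tensor_ext fun n p => h m n p) t

theorem tensor_ext₄ {D E : Alg k} {N' : Bimod C D} {Q : Bimod D E} {P : Type*}
    [AddCommGroup P] [Module k P]
    {f g : (tensor (tensor (tensor M N) N') Q).carrier →ₗ[k] P}
    (h : ∀ m n p q, f (tmul _ Q (tmul _ N' (tmul M N m n) p) q)
      = g (tmul _ Q (tmul _ N' (tmul M N m n) p) q)) : f = g :=
  tensor_ext fun t p => LinearMap.congr_fun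
    (f := f ∘ₗ (tmul (tensor (tensor M N) N') Q).flip p)
    (g := g ∘ₗ (tmul (tensor (tensor M N) N') Q).flip p)
    (tensor_ext₃ fun m n q => h m n q p) t

end tens

/-- The regular bimodule `A`. -/
@[reducible] def regular (A : Alg k) : Bimod A A where
  carrier := A.carrier
  lact := LinearMap.mul k A.carrier
  ract := (LinearMap.mul k A.carrier).flip
  one_lact m := by simp
  mul_lact a a' m := by simp [mul_assoc]
  one_ract m := by simp
  mul_ract a a' m := by simp [mul_assoc]
  lact_ract a b m := by simp [mul_assoc]

/-- The linear map underlying `f ⊗ g`. -/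
def tensorMapLin {A B C : Alg k} {M M' : Bimod A B} {N N' : Bimod B C} (f : M ⟶ M')
    (g : N ⟶ N') : (tensor M N).carrier →ₗ[k] (tensor M' N').carrier :=
  lift ((tmul M' N').compl₁₂ (Hom.toLin f) (Hom.toLin g)) (fun m b n => by
    simp only [LinearMap.compl₁₂_apply, f.map_ract, g.map_lact, ract_tmul])

/-- The homomorphism `f ⊗ g` of bimodules. -/
def tensorMap {A B C : Alg k} {M M' : Bimod A B} {N N' : Bimod B C} (f : M ⟶ M')
    (g : N ⟶ N') : tensor M N ⟶ tensor M' N' where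
  toLin := tensorMapLin f g
  map_lact a := LinearMap.congr_fun (f := tensorMapLin f g ∘ₗ (tensor M N).lact a)
    (g := (tensor M' N').lact a ∘ₗ tensorMapLin f g) (tensor_ext fun m n => by
      simp [f.map_lact, tensorMapLin])
  map_ract a := LinearMap.congr_fun (f := tensorMapLin f g ∘ₗ (tensor M N).ract a)
    (g := (tensor M' N').ract a ∘ₗ tensorMapLin f g) (tensor_ext fun m n => by
      simp [g.map_ract, tensorMapLin])

@[simp] theorem tensorMap_tmul {A B C : Alg k} {M M' : Bimod A B} {N N' : Bimod B C}
    (f : M ⟶ M') (g : N ⟶ N') (m : M.carrier) (n : N.carrier) :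
    Hom.toLin (tensorMap f g) (tmul M N m n) = tmul M' N' (Hom.toLin f m) (Hom.toLin g n) :=
  rfl

/-- An auxiliary map for the associator. -/
def assocAux {A B C D : Alg k} (M : Bimod A B) (N : Bimod B C) (P : Bimod C D) :
    (tensor M N).carrier →ₗ[k] P.carrier →ₗ[k] (tensor M (tensor N P)).carrier :=
  lift (LinearMap.mk₂ k (fun m n => tmul M (tensor N P) m ∘ₗ tmul N P n)
      (fun _ _ _ => by ext; simp) (fun _ _ _ => by ext; simp)
      (fun _ _ _ => by ext; simp) (fun _ _ _ => by ext; simp))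
    (fun m b n => by ext p; simp [ract_tmul])

/-- The linear map `(M ⊗ N) ⊗ P → M ⊗ (N ⊗ P)`. -/
def assocLin {A B C D : Alg k} (M : Bimod A B) (N : Bimod B C) (P : Bimod C D) :
    (tensor (tensor M N) P).carrier →ₗ[k] (tensor M (tensor N P)).carrier :=
  lift (assocAux M N P) (fun t c p => LinearMap.congr_fun
    (f := (assocAux M N P).flip p ∘ₗ (tensor M N).ract c)
    (g := (assocAux M N P).flip (P.lact c p))
    (tensor_ext fun m n => by simp [assocAux, ract_tmul]) t)

/-- The bimodule map `(M ⊗ N) ⊗ P → M ⊗ (N ⊗ P)`. -/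
def assocHom {A B C D : Alg k} (M : Bimod A B) (N : Bimod B C) (P : Bimod C D) :
    tensor (tensor M N) P ⟶ tensor M (tensor N P) where
  toLin := assocLin M N P
  map_lact a := LinearMap.congr_fun
    (f := assocLin M N P ∘ₗ (tensor (tensor M N) P).lact a)
    (g := (tensor M (tensor N P)).lact a ∘ₗ assocLin M N P)
    (tensor_ext₃ fun _ _ _ => rfl)
  map_ract a := LinearMap.congr_fun
    (f := assocLin M N P ∘ₗ (tensor (tensor M N) P).ract a)
    (g := (tensor M (tensor N P)).ract a ∘ₗ assocLin M N P)
    (tensor_ext₃ fun _ _ _ => rfl)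

/-- The map `M ⊗ (N ⊗ P) → (M ⊗ N) ⊗ P`. -/
def assocInv {A B C D : Alg k} (M : Bimod A B) (N : Bimod B C) (P : Bimod C D) :
    (tensor M (tensor N P)).carrier →ₗ[k] (tensor (tensor M N) P).carrier :=
  lift (LinearMap.mk₂ k (fun m => lift ((tmul (tensor M N) P) ∘ₗ tmul M N m)
        (fun n c p => by simp [← ract_tmul]))
      (fun m m' => LinearMap.congr_fun (g := _ + _) (tensor_ext fun n p => by simp))
      (fun c m => LinearMap.congr_fun (g := c • _) (tensor_ext fun n p => by simp))
      (fun _ => map_add _) (fun c _ => map_smul _ c))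
    (fun m b => LinearMap.congr_fun (g := _ ∘ₗ _)
      (tensor_ext fun n p => by simp [ract_tmul]))

/-- The associativity isomorphism of bimodules. -/
def assoc {A B C D : Alg k} (M : Bimod A B) (N : Bimod B C) (P : Bimod C D) :
    tensor (tensor M N) P ≅ tensor M (tensor N P) :=
  isoMk (assocHom M N P) (assocInv M N P)
    (LinearMap.congr_fun (f := assocInv M N P ∘ₗ assocLin M N P) (g := LinearMap.id)
      (tensor_ext₃ fun _ _ _ => rfl))
    (LinearMap.congr_fun (f := assocLin M N P ∘ₗ assocInv M N P) (g := LinearMap.id)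
      (tensor_ext₃' fun _ _ _ => rfl))

/-- The linear map `A ⊗_A M → M`, `a ⊗ m ↦ a m`. -/
def leftUnitLin {A B : Alg k} (M : Bimod A B) :
    (tensor (regular A) M).carrier →ₗ[k] M.carrier :=
  lift (M := regular A) M.lact (fun a b m => M.mul_lact a b m)

/-- The isomorphism `A ⊗_A M ≅ M`, `a ⊗ m ↦ a m`. -/
def leftUnit {A B : Alg k} (M : Bimod A B) : tensor (regular A) M ≅ M :=
  isoMk ⟨leftUnitLin M,
      fun a => LinearMap.congr_fun (f := leftUnitLin M ∘ₗ (tensor (regular A) M).lact a)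
        (g := M.lact a ∘ₗ leftUnitLin M) (tensor_ext fun b m => M.mul_lact a b m),
      fun c => LinearMap.congr_fun (f := leftUnitLin M ∘ₗ (tensor (regular A) M).ract c)
        (g := M.ract c ∘ₗ leftUnitLin M) (tensor_ext fun b m => M.lact_ract b c m)⟩
    (tmul (regular A) M (1 : A.carrier))
    (LinearMap.congr_fun (f := tmul (regular A) M (1 : A.carrier) ∘ₗ leftUnitLin M)
      (g := LinearMap.id) (tensor_ext fun a m =>
        (ract_tmul (M := regular A) (1 : A.carrier) a m).symm.trans
          (congrArg (fun x => tmul (regular A) M x m) (one_mul (M := A.carrier) a))))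
    (fun m => M.one_lact m)

/-- The linear map `M ⊗_B B → M`, `m ⊗ b ↦ m b`. -/
def rightUnitLin {A B : Alg k} (M : Bimod A B) :
    (tensor M (regular B)).carrier →ₗ[k] M.carrier :=
  lift (N := regular B) M.ract.flip (fun m b b' => (M.mul_ract b b' m).symm)

/-- The isomorphism `M ⊗_B B ≅ M`, `m ⊗ b ↦ m b`. -/
def rightUnit {A B : Alg k} (M : Bimod A B) : tensor M (regular B) ≅ M :=
  isoMk ⟨rightUnitLin M,
      fun a => LinearMap.congr_fun (f := rightUnitLin M ∘ₗ (tensor M (regular B)).lact a)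
        (g := M.lact a ∘ₗ rightUnitLin M)
        (tensor_ext fun m b => (M.lact_ract a b m).symm),
      fun c => LinearMap.congr_fun (f := rightUnitLin M ∘ₗ (tensor M (regular B)).ract c)
        (g := M.ract c ∘ₗ rightUnitLin M) (tensor_ext fun m b => M.mul_ract b c m)⟩
    ((tmul M (regular B)).flip (1 : B.carrier))
    (LinearMap.congr_fun (f := (tmul M (regular B)).flip (1 : B.carrier) ∘ₗ rightUnitLin M)
      (g := LinearMap.id) (tensor_ext fun m b =>
        (ract_tmul (N := regular B) m b (1 : B.carrier)).trans
          (congrArg (fun x => tmul M (regular B) m x) (mul_one (M := B.carrier) b))))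
    (fun m => M.one_ract m)

end Bimod

/-- The bicategory of algebras, bimodules and bimodule homomorphisms. The composite of
`M : A ⟶ B` and `N : B ⟶ C` is `M ⊗_B N`. -/
instance (k : Type u) [Field k] : Bicategory.{u, u + 1} (Alg.{u} k) where
  Hom A B := Bimod A B
  id A := Bimod.regular A
  comp M N := Bimod.tensor M N
  homCategory A B := inferInstanceAs (Category (Bimod A B))
  whiskerLeft M _ _ f := Bimod.tensorMap (𝟙 M) f
  whiskerRight f N := Bimod.tensorMap f (𝟙 N)
  associator M N P := Bimod.assoc M N P
  leftUnitor M := Bimod.leftUnit M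
  rightUnitor M := Bimod.rightUnit M
  whiskerLeft_id M N := Bimod.hom_ext (Bimod.tensor_ext fun _ _ => rfl)
  whiskerLeft_comp M _ _ _ f g := Bimod.hom_ext (Bimod.tensor_ext fun _ _ => rfl)
  id_whiskerLeft {A B M N} f := by
    rw [← Category.assoc, Iso.eq_comp_inv]
    exact Bimod.hom_ext (Bimod.tensor_ext fun a m => (f.map_lact a m).symm)
  comp_whiskerLeft M N _ _ f := by
    rw [← Category.assoc, Iso.eq_comp_inv]
    exact Bimod.hom_ext (Bimod.tensor_ext₃ fun _ _ _ => rfl)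
  id_whiskerRight M N := Bimod.hom_ext (Bimod.tensor_ext fun _ _ => rfl)
  comp_whiskerRight f g N := Bimod.hom_ext (Bimod.tensor_ext fun _ _ => rfl)
  whiskerRight_id {A B M N} f := by
    rw [← Category.assoc, Iso.eq_comp_inv]
    exact Bimod.hom_ext (Bimod.tensor_ext fun m b => (f.map_ract b m).symm)
  whiskerRight_comp {A B C D M M'} f N P := by
    rw [Iso.eq_inv_comp]
    exact Bimod.hom_ext (Bimod.tensor_ext₃ fun _ _ _ => rfl)
  whisker_assoc M _ _ f P := by
    rw [← Category.assoc, Iso.eq_comp_inv]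
    exact Bimod.hom_ext (Bimod.tensor_ext₃ fun _ _ _ => rfl)
  whisker_exchange f g := Bimod.hom_ext (Bimod.tensor_ext fun _ _ => rfl)
  pentagon M N P Q := Bimod.hom_ext (Bimod.tensor_ext₄ fun _ _ _ _ => rfl)
  triangle M N := Bimod.hom_ext (Bimod.tensor_ext₃ fun m b n => (Bimod.ract_tmul m b n).symm)


/-! ### Weak Hopf algebras -/

/-- Weak Hopf algebras over a field. -/
class WeakHopfAlgebra (k H : Type u) [Field k] [Ring H] [Algebra k H] extends
    Coalgebra k H where
  /-- `Δ(g h) = Δ(g) Δ(h)` -/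
  comul_mul : ∀ g h : H, comul (g * h) = comul g * comul h
  /-- `(Δ ⊗ id) Δ(1) = (Δ(1) ⊗ 1) (1 ⊗ Δ(1))` -/
  comul_one_left : comul.rTensor H (comul 1)
    = (comul 1 ⊗ₜ[k] (1 : H)) * (TensorProduct.assoc k H H H).symm (1 ⊗ₜ comul 1)
  /-- `(Δ ⊗ id) Δ(1) = (1 ⊗ Δ(1)) (Δ(1) ⊗ 1)` -/
  comul_one_right : comul.rTensor H (comul 1)
    = (TensorProduct.assoc k H H H).symm (1 ⊗ₜ comul 1) * (comul 1 ⊗ₜ[k] (1 : H))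
  /-- `ε(f g h) = ε(f g₁) ε(g₂ h)` -/
  counit_mul : ∀ f g h : H, counit (f * g * h) = LinearMap.mul' k k
    (TensorProduct.map (counit ∘ₗ LinearMap.mulLeft k f) (counit ∘ₗ LinearMap.mulRight k h)
      (comul g))
  /-- `ε(f g h) = ε(f g₂) ε(g₁ h)` -/
  counit_mul' : ∀ f g h : H, counit (f * g * h) = LinearMap.mul' k k
    (TensorProduct.map (counit ∘ₗ LinearMap.mulRight k h) (counit ∘ₗ LinearMap.mulLeft k f)
      (comul g))
  /-- The antipode `S`. -/
  antipode : H →ₗ[k] H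
  /-- `h₁ S(h₂) = (ε ⊗ id) (Δ(1) (h ⊗ 1))` -/
  mul_antipode : ∀ h : H, LinearMap.mul' k H (antipode.lTensor H (comul h))
    = TensorProduct.lid k H (counit.rTensor H (comul 1 * (h ⊗ₜ[k] (1 : H))))
  /-- `S(h₁) h₂ = (id ⊗ ε) ((1 ⊗ h) Δ(1))` -/
  antipode_mul : ∀ h : H, LinearMap.mul' k H (antipode.rTensor H (comul h))
    = TensorProduct.rid k H (counit.lTensor H (((1 : H) ⊗ₜ[k] h) * comul 1))
  /-- `S(h₁) h₂ S(h₃) = S(h)` -/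
  antipode_mul_antipode : ∀ h : H, LinearMap.mul' k H (TensorProduct.map
    (LinearMap.mul' k H ∘ₗ antipode.rTensor H) antipode (comul.rTensor H (comul h)))
      = antipode h

section wha

variable {k H : Type u} [Field k] [Ring H] [Algebra k H] [WeakHopfAlgebra k H]

open WeakHopfAlgebra Coalgebra

variable (k H) in
/-- The target map `ε_t(h) = (ε ⊗ id) (Δ(1) (h ⊗ 1)) = ε(1₁ h) 1₂`. -/
def targetMap : H →ₗ[k] H :=
  (TensorProduct.lid k H).toLinearMap ∘ₗ (counit : H →ₗ[k] k).rTensor H ∘ₗ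
    LinearMap.mulLeft k (comul (R := k) (1 : H)) ∘ₗ (TensorProduct.mk k H H).flip 1

theorem targetMap_apply (h : H) : targetMap k H h
    = TensorProduct.lid k H ((counit : H →ₗ[k] k).rTensor H (comul 1 * (h ⊗ₜ[k] 1))) := rfl

theorem comul_one_mul (h : H) : comul (R := k) (1 : H) * comul h = comul h := by
  rw [← comul_mul, one_mul]

theorem mul_comul_one (h : H) : comul (R := k) h * comul (1 : H) = comul h := by
  rw [← comul_mul, mul_one]

/-- `Δ((φ ⊗ id) t) = (φ ⊗ id ⊗ id) (id ⊗ Δ) t` -/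
theorem comul_lid (φ : H →ₗ[k] k) (t : H ⊗[k] H) :
    comul (R := k) (TensorProduct.lid k H (φ.rTensor H t))
      = TensorProduct.lid k _ (φ.rTensor _ ((comul (R := k) (A := H)).lTensor H t)) := by
  induction t using TensorProduct.induction_on with
  | zero => simp
  | tmul g h => simp
  | add s t hs ht => simp only [map_add, hs, ht]

theorem coassoc_one : (comul (R := k) (A := H)).lTensor H (comul 1)
    = TensorProduct.assoc k H H H ((comul (R := k) (A := H)).rTensor H (comul 1)) :=
  (Coalgebra.coassoc_apply (R := k) (1 : H)).symm

theorem targetMap_eq (h : H) : targetMap k H h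
    = TensorProduct.lid k H
        (((counit : H →ₗ[k] k) ∘ₗ LinearMap.mulRight k h).rTensor H (comul 1)) := by
  rw [targetMap_apply]
  generalize comul (R := k) (1 : H) = t
  induction t using TensorProduct.induction_on with
  | zero => simp
  | tmul g h => simp
  | add s t hs ht => simp only [map_add, add_mul, hs, ht]


theorem lid_aux (φ : H →ₗ[k] k) (s t : H ⊗[k] H) :
    TensorProduct.lid k _ (φ.rTensor _ (TensorProduct.assoc k H H H
      ((TensorProduct.assoc k H H H).symm (1 ⊗ₜ s) * (t ⊗ₜ[k] (1 : H)))))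
      = s * (TensorProduct.lid k H (φ.rTensor H t) ⊗ₜ[k] 1) := by
  induction s using TensorProduct.induction_on with
  | zero => simp
  | add s s' hs hs' =>
    simp only [TensorProduct.tmul_add, map_add, add_mul, hs, hs']
  | tmul a b =>
    induction t using TensorProduct.induction_on with
    | zero => simp
    | add t t' ht ht' => simp only [TensorProduct.add_tmul, map_add, mul_add, ht, ht']
    | tmul c d => simp [TensorProduct.smul_tmul']


theorem lid_aux' (φ : H →ₗ[k] k) (s t : H ⊗[k] H) :
    TensorProduct.lid k _ (φ.rTensor _ (TensorProduct.assoc k H H H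
      ((t ⊗ₜ[k] (1 : H)) * (TensorProduct.assoc k H H H).symm (1 ⊗ₜ s))))
      = (TensorProduct.lid k H (φ.rTensor H t) ⊗ₜ[k] 1) * s := by
  induction s using TensorProduct.induction_on with
  | zero => simp
  | add s s' hs hs' =>
    simp only [TensorProduct.tmul_add, map_add, mul_add, hs, hs']
  | tmul a b =>
    induction t using TensorProduct.induction_on with
    | zero => simp
    | add t t' ht ht' => simp only [TensorProduct.add_tmul, map_add, add_mul, ht, ht']
    | tmul c d => simp [TensorProduct.smul_tmul']

theorem comul_targetMap (h : H) : comul (R := k) (targetMap k H h)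
    = comul (1 : H) * (targetMap k H h ⊗ₜ[k] 1) := by
  rw [targetMap_eq, comul_lid, coassoc_one, comul_one_right, lid_aux]

theorem comul_targetMap' (h : H) : comul (R := k) (targetMap k H h)
    = (targetMap k H h ⊗ₜ[k] 1) * comul (1 : H) := by
  rw [targetMap_eq, comul_lid, coassoc_one, comul_one_left, lid_aux']

theorem targetMap_of_comul {z : H}
    (hz : comul (R := k) z = comul (1 : H) * (z ⊗ₜ[k] 1)) : targetMap k H z = z := by
  rw [targetMap_apply, ← hz, Coalgebra.rTensor_counit_comul]; simp

theorem targetMap_one : targetMap k H 1 = 1 := targetMap_of_comul (by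
  rw [← Algebra.TensorProduct.one_def, mul_one])

variable (k H) in
/-- The target algebra `H^t`, the image of the target map. -/
def targetSubalgebra : Subalgebra k H where
  carrier := Set.range (targetMap k H)
  mul_mem' := by
    rintro _ _ ⟨g, rfl⟩ ⟨h, rfl⟩
    refine ⟨targetMap k H g * targetMap k H h, targetMap_of_comul ?_⟩
    rw [comul_mul, comul_targetMap' g, comul_targetMap h, mul_assoc, ← mul_assoc (comul 1),
      comul_one_mul, ← mul_assoc, ← comul_targetMap', comul_targetMap, mul_assoc,
      Algebra.TensorProduct.tmul_mul_tmul, mul_one]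
  add_mem' := by
    rintro _ _ ⟨g, rfl⟩ ⟨h, rfl⟩
    exact ⟨g + h, map_add _ _ _⟩
  algebraMap_mem' c := ⟨c • 1, by rw [map_smul, targetMap_one, Algebra.algebraMap_eq_smul_one]⟩

variable (k H) in
/-- The target algebra `H^t` as a `k`-algebra. -/
abbrev targetAlg : Alg k := ⟨targetSubalgebra k H⟩

theorem targetMap_coe (z : targetSubalgebra k H) : targetMap k H z = z := by
  obtain ⟨z, h, rfl⟩ := z
  exact targetMap_of_comul (comul_targetMap h)

theorem comul_coe_mul (z : targetSubalgebra k H) (h : H) :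
    comul (R := k) ((z : H) * h) = ((z : H) ⊗ₜ[k] 1) * comul h := by
  obtain ⟨z, g, rfl⟩ := z
  rw [comul_mul]
  show comul (targetMap k H g) * _ = _
  rw [comul_targetMap', mul_assoc, comul_one_mul]

theorem comul_mul_coe (z : targetSubalgebra k H) (h : H) :
    comul (R := k) (h * (z : H)) = comul h * ((z : H) ⊗ₜ[k] 1) := by
  obtain ⟨z, g, rfl⟩ := z
  rw [comul_mul]
  show _ * comul (targetMap k H g) = _
  rw [comul_targetMap, ← mul_assoc, mul_comul_one]

variable (k H) in
/-- The functionals `h ↦ ε(z h)` for `z ∈ H^t`. -/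
def counitL : targetSubalgebra k H →ₗ[k] H →ₗ[k] k :=
  (LinearMap.mul k H).compr₂ counit ∘ₗ (targetSubalgebra k H).val.toLinearMap

variable (k H) in
/-- The functionals `h ↦ ε(h z)` for `z ∈ H^t`. -/
def counitR : targetSubalgebra k H →ₗ[k] H →ₗ[k] k :=
  (LinearMap.mul k H).flip.compr₂ counit ∘ₗ (targetSubalgebra k H).val.toLinearMap

@[simp] theorem counitL_apply (z : targetSubalgebra k H) (h : H) :
    counitL k H z h = counit (R := k) ((z : H) * h) := rfl

@[simp] theorem counitR_apply (z : targetSubalgebra k H) (h : H) :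
    counitR k H z h = counit (R := k) (h * (z : H)) := rfl

/-- `ε(z h₁) h₂ = z h` for `z ∈ H^t` -/
theorem counit_coe_mul (z : targetSubalgebra k H) (h : H) :
    TensorProduct.lid k H ((counitL k H z).rTensor H (comul h))
      = LinearMap.mulLeft k (z : H) h := by
  rw [LinearMap.mulLeft_apply, ← (TensorProduct.lid k H).apply_symm_apply ((z : H) * h),
    TensorProduct.lid_symm_apply, ← Coalgebra.rTensor_counit_comul, comul_coe_mul]
  generalize comul (R := k) h = t
  induction t using TensorProduct.induction_on with
  | zero => simp
  | tmul g h => simp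
  | add s t hs ht => simp only [map_add, mul_add, hs, ht]

/-- `ε(h₁ z) h₂ = h z` for `z ∈ H^t` -/
theorem counit_mul_coe (z : targetSubalgebra k H) (h : H) :
    TensorProduct.lid k H ((counitR k H z).rTensor H (comul h))
      = LinearMap.mulRight k (z : H) h := by
  rw [LinearMap.mulRight_apply, ← (TensorProduct.lid k H).apply_symm_apply (h * (z : H)),
    TensorProduct.lid_symm_apply, ← Coalgebra.rTensor_counit_comul, comul_mul_coe]
  generalize comul (R := k) h = t
  induction t using TensorProduct.induction_on with
  | zero => simp
  | tmul g h => simp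
  | add s t hs ht => simp only [map_add, add_mul, hs, ht]

end wha

/-! ### Corepresentations -/

open Coalgebra

section hit

variable {k H : Type u} [Field k] [Ring H] [Algebra k H] [WeakHopfAlgebra k H]
  {X : Type u} [AddCommGroup X] [Module k X]

/-- For a map `δ(x) = x₋₁ ⊗ x₀` and a functional `φ` on `H`, the operator
`x ↦ φ(x₋₁) x₀`. -/
def hit (δ : X →ₗ[k] H ⊗[k] X) : (H →ₗ[k] k) →ₗ[k] X →ₗ[k] X where
  toFun φ := (TensorProduct.lid k X).toLinearMap ∘ₗ φ.rTensor X ∘ₗ δ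
  map_add' φ ψ := by ext x; simp [LinearMap.rTensor_add]
  map_smul' c φ := by ext x; simp [LinearMap.rTensor_smul]

theorem hit_apply (δ : X →ₗ[k] H ⊗[k] X) (φ : H →ₗ[k] k) (x : X) :
    hit δ φ x = TensorProduct.lid k X (φ.rTensor X (δ x)) := rfl

/-- `ρ(φ(x₋₁) x₀) = f(x₋₁) ⊗ x₀` if `f(h) = φ(h₁) h₂` -/
theorem coact_hit {δ : X →ₗ[k] H ⊗[k] X}
    (coassoc : ∀ x, TensorProduct.assoc k H H X
      ((comul (R := k) (A := H)).rTensor X (δ x)) = δ.lTensor H (δ x))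
    {φ : H →ₗ[k] k} {f : H →ₗ[k] H}
    (hf : ∀ h, TensorProduct.lid k H (φ.rTensor H (comul h)) = f h) (x : X) :
    δ (hit δ φ x) = f.rTensor X (δ x) := by
  have h1 : ∀ t : H ⊗[k] X, δ (TensorProduct.lid k X (φ.rTensor X t))
      = TensorProduct.lid k _ (φ.rTensor _ (δ.lTensor H t)) := fun t => by
    induction t using TensorProduct.induction_on with
    | zero => simp
    | tmul g h => simp
    | add s t hs ht => simp only [map_add, hs, ht]
  have h2 : ∀ (s : H ⊗[k] H) (y : X), TensorProduct.lid k _ (φ.rTensor _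
      (TensorProduct.assoc k H H X (s ⊗ₜ y)))
      = TensorProduct.lid k H (φ.rTensor H s) ⊗ₜ y := fun s y => by
    induction s using TensorProduct.induction_on with
    | zero => simp
    | tmul g h => simp [TensorProduct.smul_tmul']
    | add s t hs ht => simp only [map_add, TensorProduct.add_tmul, hs, ht]
  change δ (TensorProduct.lid k X (φ.rTensor X (δ x))) = _
  rw [h1, ← coassoc]
  generalize δ x = t
  induction t using TensorProduct.induction_on with
  | zero => simp
  | tmul g y => simp [h2, hf]
  | add s t hs ht => simp only [map_add, hs, ht]

theorem hit_hit {δ : X →ₗ[k] H ⊗[k] X}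
    (coassoc : ∀ x, TensorProduct.assoc k H H X
      ((comul (R := k) (A := H)).rTensor X (δ x)) = δ.lTensor H (δ x))
    (ψ : H →ₗ[k] k) {φ : H →ₗ[k] k} {f : H →ₗ[k] H}
    (hf : ∀ h, TensorProduct.lid k H (φ.rTensor H (comul h)) = f h) (x : X) :
    hit δ ψ (hit δ φ x) = hit δ (ψ ∘ₗ f) x := by
  change TensorProduct.lid k X (ψ.rTensor X (δ (hit δ φ x))) = _
  rw [coact_hit coassoc hf]
  simp [hit_apply, LinearMap.rTensor_comp]

end hit

/-- Finite-dimensional left `H`-comodules `x ↦ x₋₁ ⊗ x₀`, together with their canonical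
`H^t`-bimodule structure `z x = ε(z x₋₁) x₀`, `x z = ε(x₋₁ z) x₀`. Every finite-dimensional
comodule occurs, with a unique such bimodule structure: see `CoRep.ofComodule`. -/
structure CoRep (k H : Type u) [Field k] [Ring H] [Algebra k H] [WeakHopfAlgebra k H] where
  bimod : Bimod (targetAlg k H) (targetAlg k H)
  [finiteDimensional : FiniteDimensional k bimod.carrier]
  coact : bimod.carrier →ₗ[k] H ⊗[k] bimod.carrier
  coassoc : ∀ x, TensorProduct.assoc k H H bimod.carrier
    ((comul (R := k) (A := H)).rTensor bimod.carrier (coact x)) = coact.lTensor H (coact x)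
  counit_coact : ∀ x, hit coact counit x = x
  lact_eq : ∀ (z : targetSubalgebra k H) x, bimod.lact z x = hit coact (counitL k H z) x
  ract_eq : ∀ (z : targetSubalgebra k H) x, bimod.ract z x = hit coact (counitR k H z) x

attribute [instance] CoRep.finiteDimensional

namespace CoRep

variable {k H : Type u} [Field k] [Ring H] [Algebra k H] [WeakHopfAlgebra k H]

/-- A finite-dimensional left comodule as an object of `CoRep k H`. -/
def ofComodule (X : Type u) [AddCommGroup X] [Module k X] [FiniteDimensional k X]
    (δ : X →ₗ[k] H ⊗[k] X)
    (coassoc : ∀ x, TensorProduct.assoc k H H X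
      ((comul (R := k) (A := H)).rTensor X (δ x)) = δ.lTensor H (δ x))
    (counit_coact : ∀ x, hit δ counit x = x) : CoRep k H where
  bimod :=
    { carrier := X
      lact := hit δ ∘ₗ counitL k H
      ract := hit δ ∘ₗ counitR k H
      one_lact := fun x => by
        rw [← counit_coact x]
        change hit δ (counitL k H 1) _ = _
        rw [show counitL k H 1 = counit from LinearMap.ext fun h => by simp, counit_coact]
      one_ract := fun x => by
        rw [← counit_coact x]
        change hit δ (counitR k H 1) _ = _
        rw [show counitR k H 1 = counit from LinearMap.ext fun h => by simp, counit_coact]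
      mul_lact := fun z z' x => by
        refine Eq.trans ?_ (hit_hit coassoc (counitL k H z) (counit_coe_mul z') x).symm
        change hit δ (counitL k H (z * z')) x = _
        congr 2; ext h; simp [mul_assoc]
      mul_ract := fun z z' x => by
        refine Eq.trans ?_ (hit_hit coassoc (counitR k H z') (counit_mul_coe z) x).symm
        change hit δ (counitR k H (z * z')) x = _
        congr 2; ext h; simp [mul_assoc]
      lact_ract := fun z z' x => by
        refine (hit_hit coassoc (counitL k H z) (counit_mul_coe z') x).trans
          (Eq.trans ?_ (hit_hit coassoc (counitR k H z') (counit_coe_mul z) x).symm)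
        congr 2; ext h; simp [mul_assoc] }
  finiteDimensional := by assumption
  coact := δ
  coassoc := coassoc
  counit_coact := counit_coact
  lact_eq _ _ := rfl
  ract_eq _ _ := rfl

/-- The comodule `H`, with coaction `Δ`. -/
def regular (k H : Type u) [Field k] [Ring H] [Algebra k H] [WeakHopfAlgebra k H]
    [FiniteDimensional k H] : CoRep k H :=
  ofComodule H comul Coalgebra.coassoc_apply (fun h => by simp [hit_apply])

variable (X Y Z : CoRep k H)

theorem coact_lact (z : targetSubalgebra k H) (x : X.bimod.carrier) :
    X.coact (X.bimod.lact z x) = (LinearMap.mulLeft k (z : H)).rTensor _ (X.coact x) := by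
  rw [X.lact_eq, coact_hit X.coassoc (counit_coe_mul z)]

theorem coact_ract (z : targetSubalgebra k H) (x : X.bimod.carrier) :
    X.coact (X.bimod.ract z x) = (LinearMap.mulRight k (z : H)).rTensor _ (X.coact x) := by
  rw [X.ract_eq, coact_hit X.coassoc (counit_mul_coe z)]

/-- Homomorphisms of comodules. -/
@[ext]
structure Hom (X Y : CoRep k H) where
  toLin : X.bimod.carrier →ₗ[k] Y.bimod.carrier
  map_coact : ∀ x, Y.coact (toLin x) = toLin.lTensor H (X.coact x)

instance : Category.{u} (CoRep k H) where
  Hom X Y := Hom X Y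
  id X := ⟨LinearMap.id, fun x => by simp⟩
  comp f g := ⟨g.toLin ∘ₗ f.toLin, fun x => by
    simp [f.map_coact, g.map_coact, LinearMap.lTensor_comp]⟩

@[simp] theorem id_toLin : Hom.toLin (𝟙 X) = LinearMap.id := rfl

@[simp] theorem comp_toLin {X Y Z : CoRep k H} (f : X ⟶ Y) (g : Y ⟶ Z) :
    Hom.toLin (f ≫ g) = Hom.toLin g ∘ₗ Hom.toLin f := rfl

theorem hom_ext {X Y : CoRep k H} {f g : X ⟶ Y} (h : Hom.toLin f = Hom.toLin g) : f = g :=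
  Hom.ext h

theorem map_hit {X Y : CoRep k H} (f : X ⟶ Y) (φ : H →ₗ[k] k) (x : X.bimod.carrier) :
    Hom.toLin f (hit X.coact φ x) = hit Y.coact φ (Hom.toLin f x) := by
  simp only [hit_apply, f.map_coact]
  generalize X.coact x = t
  induction t using TensorProduct.induction_on with
  | zero => simp
  | tmul g y => simp
  | add s t hs ht => simp only [map_add, hs, ht]

/-- A homomorphism of comodules is a homomorphism of `H^t`-bimodules. -/
def bimodMap {X Y : CoRep k H} (f : X ⟶ Y) : X.bimod ⟶ Y.bimod where
  toLin := Hom.toLin f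
  map_lact z x := by exact (congrArg _ (X.lact_eq z x)).trans ((map_hit f _ x).trans (Y.lact_eq z _).symm)
  map_ract z x := by exact (congrArg _ (X.ract_eq z x)).trans ((map_hit f _ x).trans (Y.ract_eq z _).symm)

/-- A linear isomorphism of bimodules compatible with the coactions is an isomorphism. -/
def isoMk {X Y : CoRep k H} (e : X.bimod ≅ Y.bimod)
    (h : ∀ x, Y.coact (Bimod.Hom.toLin e.hom x) = (Bimod.Hom.toLin e.hom).lTensor H (X.coact x)) :
    X ≅ Y where
  hom := ⟨Bimod.Hom.toLin e.hom, h⟩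
  inv := ⟨Bimod.Hom.toLin e.inv, fun y => by
    have h1 : ∀ x, Bimod.Hom.toLin e.inv (Bimod.Hom.toLin e.hom x) = x := fun x =>
      LinearMap.congr_fun (congrArg Bimod.Hom.toLin e.hom_inv_id) x
    have h2 : ∀ x, Bimod.Hom.toLin e.hom (Bimod.Hom.toLin e.inv x) = x := fun x =>
      LinearMap.congr_fun (congrArg Bimod.Hom.toLin e.inv_hom_id) x
    conv_rhs => rw [← h2 y, h, ← LinearMap.comp_apply, ← LinearMap.lTensor_comp]
    rw [show Bimod.Hom.toLin e.inv ∘ₗ Bimod.Hom.toLin e.hom = LinearMap.id from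
      LinearMap.ext h1, LinearMap.lTensor_id, LinearMap.id_apply]⟩
  hom_inv_id := hom_ext (congrArg Bimod.Hom.toLin e.hom_inv_id)
  inv_hom_id := hom_ext (congrArg Bimod.Hom.toLin e.inv_hom_id)

end CoRep

open Coalgebra WeakHopfAlgebra
namespace CoRep

variable {k H : Type u} [Field k] [Ring H] [Algebra k H] [WeakHopfAlgebra k H]

section tensor

variable (X Y : CoRep k H)

/-- The map `(g ⊗ x, h ⊗ y) ↦ g h ⊗ (x ⊗ y)`. -/
def codiag {A B C : Alg k} (M : Bimod A B) (N : Bimod B C) : H ⊗[k] M.carrier →ₗ[k]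
    H ⊗[k] N.carrier →ₗ[k] H ⊗[k] (Bimod.tensor M N).carrier :=
  TensorProduct.map₂ (LinearMap.mul k H) (Bimod.tmul M N)

@[simp] theorem codiag_tmul {A B C : Alg k} (M : Bimod A B) (N : Bimod B C) (g h : H)
    (x : M.carrier) (y : N.carrier) :
    codiag M N (g ⊗ₜ x) (h ⊗ₜ y) = (g * h) ⊗ₜ Bimod.tmul M N x y := rfl

theorem codiag_balanced (z : H) (p : H ⊗[k] X.bimod.carrier) (q : H ⊗[k] Y.bimod.carrier) :
    codiag X.bimod Y.bimod ((LinearMap.mulRight k z).rTensor _ p) q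
      = codiag X.bimod Y.bimod p ((LinearMap.mulLeft k z).rTensor _ q) := by
  induction p using TensorProduct.induction_on with
  | zero => simp
  | add s t hs ht => simp only [map_add, LinearMap.add_apply, hs, ht]
  | tmul g x =>
    induction q using TensorProduct.induction_on with
    | zero => simp
    | add s t hs ht => simp only [map_add, hs, ht]
    | tmul h y => simp [mul_assoc]

/-- The diagonal coaction `x ⊗ y ↦ x₋₁ y₋₁ ⊗ (x₀ ⊗ y₀)` on `X ⊗_{H^t} Y`. -/
def tensorCoact : (Bimod.tensor X.bimod Y.bimod).carrier →ₗ[k]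
    H ⊗[k] (Bimod.tensor X.bimod Y.bimod).carrier :=
  Bimod.lift ((codiag X.bimod Y.bimod).compl₁₂ X.coact Y.coact) (fun x z y => by
    simp only [LinearMap.compl₁₂_apply]
    rw [coact_ract X z, coact_lact Y z, codiag_balanced])

@[simp] theorem tensorCoact_tmul (x : X.bimod.carrier) (y : Y.bimod.carrier) :
    tensorCoact X Y (Bimod.tmul _ _ x y) = codiag X.bimod Y.bimod (X.coact x) (Y.coact y) := rfl

theorem tensorCoact_coassoc (t : (Bimod.tensor X.bimod Y.bimod).carrier) :
    TensorProduct.assoc k H H _ ((comul (R := k) (A := H)).rTensor _ (tensorCoact X Y t))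
      = (tensorCoact X Y).lTensor H (tensorCoact X Y t) := by
  let Ψ : H ⊗[k] (H ⊗[k] X.bimod.carrier) →ₗ[k] H ⊗[k] (H ⊗[k] Y.bimod.carrier) →ₗ[k]
      H ⊗[k] (H ⊗[k] (Bimod.tensor X.bimod Y.bimod).carrier) :=
    TensorProduct.map₂ (LinearMap.mul k H) (codiag X.bimod Y.bimod)
  have h1 : ∀ p q, (tensorCoact X Y).lTensor H (codiag X.bimod Y.bimod p q)
      = Ψ (X.coact.lTensor H p) (Y.coact.lTensor H q) := fun p q => by
    induction p using TensorProduct.induction_on with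
    | zero => simp
    | add s t hs ht => simp only [map_add, LinearMap.add_apply, hs, ht]
    | tmul g x =>
      induction q using TensorProduct.induction_on with
      | zero => simp
      | add s t hs ht => simp only [map_add, hs, ht]
      | tmul h y => simp [Ψ]
  have h3 : ∀ (s t : H ⊗[k] H) x y, TensorProduct.assoc k H H _
      ((s * t) ⊗ₜ Bimod.tmul X.bimod Y.bimod x y)
      = Ψ (TensorProduct.assoc k H H _ (s ⊗ₜ x)) (TensorProduct.assoc k H H _ (t ⊗ₜ y)) :=
    fun s t x y => by
    induction s using TensorProduct.induction_on with
    | zero => simp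
    | add s s' hs hs' =>
      simp only [map_add, LinearMap.add_apply, add_mul, TensorProduct.add_tmul, hs, hs']
    | tmul g x =>
      induction t using TensorProduct.induction_on with
      | zero => simp
      | add s s' hs hs' => simp only [map_add, mul_add, TensorProduct.add_tmul, hs, hs']
      | tmul h y => simp [Ψ]
  have h2 : ∀ p q, TensorProduct.assoc k H H _
      ((comul (R := k) (A := H)).rTensor _ (codiag X.bimod Y.bimod p q))
      = Ψ (TensorProduct.assoc k H H _ ((comul (R := k) (A := H)).rTensor _ p))
        (TensorProduct.assoc k H H _ ((comul (R := k) (A := H)).rTensor _ q)) := fun p q => by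
    induction p using TensorProduct.induction_on with
    | zero => simp
    | add s t hs ht => simp only [map_add, LinearMap.add_apply, hs, ht]
    | tmul g x =>
      induction q using TensorProduct.induction_on with
      | zero => simp
      | add s t hs ht => simp only [map_add, hs, ht]
      | tmul h y => simp [comul_mul, h3]
  refine LinearMap.congr_fun (f := (TensorProduct.assoc k H H _).toLinearMap ∘ₗ
    (comul (R := k) (A := H)).rTensor _ ∘ₗ tensorCoact X Y)
    (g := (tensorCoact X Y).lTensor H ∘ₗ tensorCoact X Y) (Bimod.tensor_ext fun x y => ?_) t
  simp only [LinearMap.comp_apply, LinearEquiv.coe_coe, tensorCoact_tmul, h1, h2, X.coassoc,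
    Y.coassoc]

/-- `(id ⊗ ε_t) Δ(1) = Δ(1)` -/
theorem lTensor_targetMap_comul_one :
    (targetMap k H).lTensor H (comul (R := k) (1 : H)) = comul (1 : H) := by
  let E : (H ⊗[k] H) ⊗[k] H →ₗ[k] H ⊗[k] H :=
    ((TensorProduct.rid k H).toLinearMap ∘ₗ (counit (R := k) (A := H)).lTensor H).rTensor H
  have h1 : ∀ t : H ⊗[k] H, E ((comul (R := k) (A := H)).rTensor H t) = t := fun t => by
    induction t using TensorProduct.induction_on with
    | zero => simp
    | add s t hs ht => simp only [map_add, hs, ht]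
    | tmul g h => simp [E]
  have h2 : ∀ s t : H ⊗[k] H,
      E ((TensorProduct.assoc k H H H).symm (1 ⊗ₜ s) * (t ⊗ₜ[k] (1 : H)))
      = ((TensorProduct.lid k H).toLinearMap ∘ₗ (counit (R := k) (A := H)).rTensor H ∘ₗ
        LinearMap.mulLeft k s ∘ₗ (TensorProduct.mk k H H).flip 1).lTensor H t := fun s t => by
    induction t using TensorProduct.induction_on with
    | zero => simp
    | add t t' ht ht' => simp only [TensorProduct.add_tmul, map_add, mul_add, ht, ht']
    | tmul c d =>
      induction s using TensorProduct.induction_on with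
      | zero => simp
      | add s s' hs hs' =>
        simp only [TensorProduct.tmul_add, map_add, add_mul, hs, hs']
        simp [add_mul, TensorProduct.tmul_add]
      | tmul a b => simp [E, TensorProduct.smul_tmul']
  have h := h1 (comul (R := k) (1 : H))
  rw [comul_one_right, h2] at h
  exact h

/-- `ε(g h) = ε(g ε_t(h))` -/
theorem counit_mul_targetMap (g h : H) :
    counit (R := k) (g * targetMap k H h) = counit (R := k) (g * h) := by
  conv_rhs => rw [← mul_one g, counit_mul' (k := k)]
  rw [targetMap_eq]
  generalize comul (R := k) (1 : H) = t
  induction t using TensorProduct.induction_on with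
  | zero => simp
  | add s t hs ht => simp only [map_add, mul_add, hs, ht]
  | tmul a b => simp

/-- `ε_t(1₁) ε_t(1₂) = 1` -/
theorem mul_target_comul_one : LinearMap.mul' k H
    (TensorProduct.map (targetMap k H) (targetMap k H) (comul (R := k) (1 : H))) = 1 := by
  have h1 : ∀ s t : H ⊗[k] H, LinearMap.mul' k H
      (((TensorProduct.lid k H).toLinearMap ∘ₗ (counit (R := k) (A := H)).rTensor H ∘ₗ
        LinearMap.mulLeft k s ∘ₗ (TensorProduct.mk k H H).flip 1).rTensor H t)
      = TensorProduct.lid k H ((counit (R := k) (A := H)).rTensor H (s * t)) := fun s t => by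
    induction t using TensorProduct.induction_on with
    | zero => simp
    | add t t' ht ht' => simp only [map_add, mul_add, ht, ht']
    | tmul c d =>
      induction s using TensorProduct.induction_on with
      | zero => simp
      | add s s' hs hs' =>
        simp only [add_mul, map_add, ← hs, ← hs']
        simp [add_mul]
      | tmul a b => simp
  rw [← LinearMap.rTensor_comp_lTensor, LinearMap.comp_apply, lTensor_targetMap_comul_one]
  refine (h1 _ _).trans ?_
  rw [comul_one_mul, Coalgebra.rTensor_counit_comul]
  simp

variable (k H) in
/-- The target map as a map to `H^t`. -/
def toTarget : H →ₗ[k] targetSubalgebra k H :=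
  (targetMap k H).codRestrict (Subalgebra.toSubmodule (targetSubalgebra k H)) fun h => ⟨h, rfl⟩

@[simp] theorem coe_toTarget (h : H) : (toTarget k H h : H) = targetMap k H h := rfl

theorem mul_toTarget_comul_one : LinearMap.mul' k (targetSubalgebra k H)
    (TensorProduct.map (toTarget k H) (toTarget k H) (comul (R := k) (1 : H))) = 1 := by
  apply Subtype.ext
  refine Eq.trans ?_ (mul_target_comul_one (k := k))
  generalize comul (R := k) (1 : H) = t
  induction t using TensorProduct.induction_on with
  | zero => simp
  | add s t hs ht => simp only [map_add, ← hs, ← ht, Subalgebra.coe_add]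
  | tmul a b => simp

/-- `ε(g h) = ε(g ε_t(1₁)) ε(ε_t(1₂) h)` -/
theorem counit_mul_target (g h : H) : counit (R := k) (g * h) = LinearMap.mul' k k
    (TensorProduct.map ((counitR k H).flip g ∘ₗ toTarget k H)
      ((counitL k H).flip h ∘ₗ toTarget k H) (comul (1 : H))) := by
  conv_lhs => rw [← mul_one g, counit_mul (k := k), ← lTensor_targetMap_comul_one]
  generalize comul (R := k) (1 : H) = t
  induction t using TensorProduct.induction_on with
  | zero => simp
  | add s t hs ht => simp only [map_add, hs, ht]
  | tmul a b => simp [counit_mul_targetMap]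

/-- The element `Σ ε(p₁ ε_t(a)) p₂ ⊗ ε(ε_t(b) q₁) q₂` for `t = Σ a ⊗ b`. -/
def codiagAux (p : H ⊗[k] X.bimod.carrier) (q : H ⊗[k] Y.bimod.carrier) :
    H ⊗[k] H →ₗ[k] (Bimod.tensor X.bimod Y.bimod).carrier :=
  TensorProduct.lift ((Bimod.tmul X.bimod Y.bimod).compl₁₂
    (((TensorProduct.lid k _).toLinearMap ∘ₗ
      (LinearMap.rTensorHom X.bimod.carrier).flip p) ∘ₗ counitR k H ∘ₗ toTarget k H)
    (((TensorProduct.lid k _).toLinearMap ∘ₗ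
      (LinearMap.rTensorHom Y.bimod.carrier).flip q) ∘ₗ counitL k H ∘ₗ toTarget k H))

theorem codiag_counit (p : H ⊗[k] X.bimod.carrier) (q : H ⊗[k] Y.bimod.carrier) :
    TensorProduct.lid k _ ((counit (R := k) (A := H)).rTensor _ (codiag X.bimod Y.bimod p q))
      = codiagAux X Y p q (comul (1 : H)) := by
  induction p using TensorProduct.induction_on with
  | zero =>
    rw [show codiagAux X Y 0 q = 0 from TensorProduct.ext' fun a b => by simp [codiagAux]]
    simp
  | add s t hs ht =>
    rw [show codiagAux X Y (s + t) q = codiagAux X Y s q + codiagAux X Y t q from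
      TensorProduct.ext' fun a b => by simp [codiagAux]]
    simp only [map_add, LinearMap.add_apply, hs, ht]
  | tmul g x =>
    induction q using TensorProduct.induction_on with
    | zero =>
      rw [show codiagAux X Y (g ⊗ₜ x) 0 = 0 from TensorProduct.ext' fun a b => by
        simp [codiagAux]]
      simp
    | add s t hs ht =>
      rw [show codiagAux X Y (g ⊗ₜ x) (s + t)
          = codiagAux X Y (g ⊗ₜ x) s + codiagAux X Y (g ⊗ₜ x) t from
        TensorProduct.ext' fun a b => by simp [codiagAux]]
      simp only [map_add, LinearMap.add_apply, hs, ht]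
    | tmul h y =>
      rw [codiag_tmul, LinearMap.rTensor_tmul, counit_mul_target, TensorProduct.lid_tmul]
      generalize comul (R := k) (1 : H) = t
      induction t using TensorProduct.induction_on with
      | zero => simp
      | add s t hs ht => simp only [map_add, add_smul, hs, ht]
      | tmul a b => simpa [codiagAux, mul_smul] using smul_comm _ _ _

theorem tensorCoact_counit (t : (Bimod.tensor X.bimod Y.bimod).carrier) :
    hit (tensorCoact X Y) counit t = t := by
  refine LinearMap.congr_fun (f := hit (tensorCoact X Y) counit) (g := LinearMap.id)
    (Bimod.tensor_ext fun x y => ?_) t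
  have h1 : Bimod.tmul X.bimod Y.bimod x y = Bimod.tmul X.bimod Y.bimod x
      (Y.bimod.lact (LinearMap.mul' k (targetSubalgebra k H)
        (TensorProduct.map (toTarget k H) (toTarget k H) (comul (R := k) (1 : H)))) y) := by
    rw [mul_toTarget_comul_one]; exact congrArg _ (Y.bimod.one_lact y).symm
  rw [hit_apply, tensorCoact_tmul, codiag_counit, LinearMap.id_apply]
  refine Eq.trans ?_ h1.symm
  generalize comul (R := k) (1 : H) = t
  induction t using TensorProduct.induction_on with
  | zero => simp
  | add s t hs ht => simp only [map_add, LinearMap.add_apply, hs, ht]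
  | tmul a b =>
    have e1 := X.ract_eq (toTarget k H a) x
    have e2 := Y.lact_eq (toTarget k H b) y
    refine Eq.trans (b := Bimod.tmul X.bimod Y.bimod (X.bimod.ract (toTarget k H a) x)
      (Y.bimod.lact (toTarget k H b) y)) ?_ ?_
    · rw [e1, e2]; rfl
    · rw [Bimod.ract_tmul, ← Y.bimod.mul_lact]; rfl

theorem codiag_mulLeft (z : H) (p : H ⊗[k] X.bimod.carrier) (q : H ⊗[k] Y.bimod.carrier) :
    codiag X.bimod Y.bimod ((LinearMap.mulLeft k z).rTensor _ p) q
      = (LinearMap.mulLeft k z).rTensor _ (codiag X.bimod Y.bimod p q) := by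
  induction p using TensorProduct.induction_on with
  | zero => simp
  | add s t hs ht => simp only [map_add, LinearMap.add_apply, hs, ht]
  | tmul g x =>
    induction q using TensorProduct.induction_on with
    | zero => simp
    | add s t hs ht => simp only [map_add, hs, ht]
    | tmul h y => simp [mul_assoc]

theorem codiag_mulRight (z : H) (p : H ⊗[k] X.bimod.carrier) (q : H ⊗[k] Y.bimod.carrier) :
    codiag X.bimod Y.bimod p ((LinearMap.mulRight k z).rTensor _ q)
      = (LinearMap.mulRight k z).rTensor _ (codiag X.bimod Y.bimod p q) := by
  induction p using TensorProduct.induction_on with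
  | zero => simp
  | add s t hs ht => simp only [map_add, LinearMap.add_apply, hs, ht]
  | tmul g x =>
    induction q using TensorProduct.induction_on with
    | zero => simp
    | add s t hs ht => simp only [map_add, hs, ht]
    | tmul h y => simp [mul_assoc]

/-- The tensor product `X ⊗_{H^t} Y` of comodules. -/
def tensor : CoRep k H where
  bimod := Bimod.tensor X.bimod Y.bimod
  finiteDimensional := by
    have := Module.Finite.tensorProduct k X.bimod.carrier Y.bimod.carrier
    exact Module.Finite.of_surjective (Bimod.rel X.bimod Y.bimod).mkQ
      (Submodule.mkQ_surjective _)
  coact := tensorCoact X Y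
  coassoc := tensorCoact_coassoc X Y
  counit_coact := tensorCoact_counit X Y
  lact_eq z := LinearMap.congr_fun (f := (Bimod.tensor X.bimod Y.bimod).lact z)
    (g := hit (tensorCoact X Y) (counitL k H z)) (Bimod.tensor_ext fun x y => by
      rw [Bimod.tensor_lact, ← tensorCoact_counit X Y (Bimod.tmul _ _ _ y), hit_apply,
        tensorCoact_tmul, coact_lact X z, codiag_mulLeft, ← LinearMap.comp_apply,
        ← LinearMap.rTensor_comp]
      rfl)
  ract_eq z := LinearMap.congr_fun (f := (Bimod.tensor X.bimod Y.bimod).ract z)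
    (g := hit (tensorCoact X Y) (counitR k H z)) (Bimod.tensor_ext fun x y => by
      rw [Bimod.tensor_ract, ← tensorCoact_counit X Y (Bimod.tmul _ _ x _), hit_apply,
        tensorCoact_tmul, coact_ract Y z, codiag_mulRight, ← LinearMap.comp_apply,
        ← LinearMap.rTensor_comp]
      rfl)

/-- The tensor product of homomorphisms of comodules. -/
def tensorHom {X X' Y Y' : CoRep k H} (f : X ⟶ X') (g : Y ⟶ Y') :
    tensor X Y ⟶ tensor X' Y' where
  toLin := Bimod.Hom.toLin (Bimod.tensorMap (bimodMap f) (bimodMap g))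
  map_coact := LinearMap.congr_fun
    (f := tensorCoact X' Y' ∘ₗ Bimod.tensorMapLin (bimodMap f) (bimodMap g))
    (g := (Bimod.tensorMapLin (bimodMap f) (bimodMap g)).lTensor H ∘ₗ tensorCoact X Y)
    (Bimod.tensor_ext fun x y => by
      have h1 : ∀ p q, codiag X'.bimod Y'.bimod ((Hom.toLin f).lTensor H p) ((Hom.toLin g).lTensor H q)
          = (Bimod.tensorMapLin (bimodMap f) (bimodMap g)).lTensor H (codiag X.bimod Y.bimod p q) :=
        fun p q => by
        induction p using TensorProduct.induction_on with
        | zero => simp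
        | add s t hs ht => simp only [map_add, LinearMap.add_apply, hs, ht]
        | tmul g x =>
          induction q using TensorProduct.induction_on with
          | zero => simp
          | add s t hs ht => simp only [map_add, hs, ht]
          | tmul h y => rfl
      change codiag X'.bimod Y'.bimod (X'.coact (Hom.toLin f x)) (Y'.coact (Hom.toLin g y)) = _
      rw [f.map_coact, g.map_coact, h1]
      rfl)

/-- The associator of `CoRep k H`. -/
def assoc (X Y Z : CoRep k H) : tensor (tensor X Y) Z ≅ tensor X (tensor Y Z) :=
  isoMk (Bimod.assoc X.bimod Y.bimod Z.bimod) (LinearMap.congr_fun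
    (f := tensorCoact X (tensor Y Z) ∘ₗ Bimod.assocLin X.bimod Y.bimod Z.bimod)
    (g := (Bimod.assocLin X.bimod Y.bimod Z.bimod).lTensor H ∘ₗ tensorCoact (tensor X Y) Z)
    (Bimod.tensor_ext₃ fun x y z => by
      have h1 : ∀ p q r, codiag X.bimod (Bimod.tensor Y.bimod Z.bimod) p (codiag Y.bimod Z.bimod q r)
          = (Bimod.assocLin X.bimod Y.bimod Z.bimod).lTensor H
            (codiag (Bimod.tensor X.bimod Y.bimod) Z.bimod (codiag X.bimod Y.bimod p q) r) := fun p q r => by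
        induction p using TensorProduct.induction_on with
        | zero => simp
        | add s t hs ht => simp only [map_add, LinearMap.add_apply, hs, ht]
        | tmul g x =>
          induction q using TensorProduct.induction_on with
          | zero => simp
          | add s t hs ht => simp only [map_add, LinearMap.add_apply, hs, ht]
          | tmul h y =>
            induction r using TensorProduct.induction_on with
            | zero => simp
            | add s t hs ht => simp only [map_add, hs, ht]
            | tmul l z =>
              change (g * (h * l)) ⊗ₜ[k] _ = (g * h * l) ⊗ₜ[k] _
              rw [mul_assoc]; rfl
      exact h1 (X.coact x) (Y.coact y) (Z.coact z)))

end tensor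

section unit

variable (k H) in
/-- The coaction `z ↦ z₁ ⊗ ε_t(z₂) = z₁ ⊗ z₂` on `H^t`. -/
def unitCoact : targetSubalgebra k H →ₗ[k] H ⊗[k] targetSubalgebra k H :=
  (toTarget k H).lTensor H ∘ₗ comul ∘ₗ (targetSubalgebra k H).val.toLinearMap

theorem lTensor_val_unitCoact (z : targetSubalgebra k H) :
    (targetSubalgebra k H).val.toLinearMap.lTensor H (unitCoact k H z) = comul (z : H) := by
  have h1 : ∀ t : H ⊗[k] H, (targetSubalgebra k H).val.toLinearMap.lTensor H
      ((toTarget k H).lTensor H t) = (targetMap k H).lTensor H t := fun t => by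
    rw [← LinearMap.comp_apply, ← LinearMap.lTensor_comp]; rfl
  have h2 : ∀ t : H ⊗[k] H, (targetMap k H).lTensor H (t * ((z : H) ⊗ₜ[k] 1))
      = (targetMap k H).lTensor H t * ((z : H) ⊗ₜ[k] 1) := fun t => by
    induction t using TensorProduct.induction_on with
    | zero => simp
    | add s t hs ht => simp only [map_add, add_mul, hs, ht]
    | tmul a b => simp
  have h3 : comul (R := k) (z : H) = comul (1 : H) * ((z : H) ⊗ₜ[k] 1) := by
    simpa using comul_mul_coe z (1 : H)
  refine (h1 _).trans ?_
  change (targetMap k H).lTensor H (comul (z : H)) = _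
  rw [h3, h2, lTensor_targetMap_comul_one]

theorem val_hit (φ : H →ₗ[k] k) (z : targetSubalgebra k H) :
    ((hit (unitCoact k H) φ z : targetSubalgebra k H) : H)
      = TensorProduct.lid k H (φ.rTensor H (comul (z : H))) := by
  rw [← lTensor_val_unitCoact, hit_apply]
  generalize unitCoact k H z = t
  induction t using TensorProduct.induction_on with
  | zero => simp
  | add s t hs ht => simp only [map_add, ← hs, ← ht, Subalgebra.coe_add]
  | tmul a b => simp

theorem unitCoact_coassoc (z : targetSubalgebra k H) :
    TensorProduct.assoc k H H _ ((comul (R := k) (A := H)).rTensor _ (unitCoact k H z))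
      = (unitCoact k H).lTensor H (unitCoact k H z) := by
  let v := (targetSubalgebra k H).val.toLinearMap
  have hv : Function.Injective v := Subtype.val_injective
  apply Module.Flat.lTensor_preserves_injective_linearMap (M := H) (v.lTensor H)
    (Module.Flat.lTensor_preserves_injective_linearMap (M := H) v hv)
  have h1 : ∀ t, (v.lTensor H).lTensor H (TensorProduct.assoc k H H _
      ((comul (R := k) (A := H)).rTensor _ t))
      = TensorProduct.assoc k H H _ ((comul (R := k) (A := H)).rTensor _ (v.lTensor H t)) :=
    fun t => by
    induction t using TensorProduct.induction_on with
    | zero => simp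
    | add s t hs ht => simp only [map_add, hs, ht]
    | tmul a b =>
      simp only [LinearMap.rTensor_tmul, LinearMap.lTensor_tmul]
      generalize comul (R := k) a = s
      induction s using TensorProduct.induction_on with
      | zero => simp
      | add s t hs ht => simp only [map_add, TensorProduct.add_tmul, hs, ht]
      | tmul a b => simp
  rw [h1, lTensor_val_unitCoact, ← LinearMap.comp_apply (f := (v.lTensor H).lTensor H),
    ← LinearMap.lTensor_comp, show v.lTensor H ∘ₗ unitCoact k H = comul ∘ₗ v from
      LinearMap.ext lTensor_val_unitCoact, LinearMap.lTensor_comp, LinearMap.comp_apply,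
    lTensor_val_unitCoact, Coalgebra.coassoc_apply]

/-- The unit object `H^t` of `CoRep k H`. -/
def unit [FiniteDimensional k H] : CoRep k H where
  bimod := Bimod.regular (targetAlg k H)
  finiteDimensional := inferInstanceAs
    (FiniteDimensional k (Subalgebra.toSubmodule (targetSubalgebra k H)))
  coact := unitCoact k H
  coassoc := unitCoact_coassoc
  counit_coact z := Subtype.ext ((val_hit _ z).trans (by simp))
  lact_eq z (w : targetSubalgebra k H) :=
    Subtype.ext ((val_hit _ w).trans (counit_coe_mul z (w : H))).symm
  ract_eq z (w : targetSubalgebra k H) :=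
    Subtype.ext ((val_hit _ w).trans (counit_mul_coe z (w : H))).symm

theorem lTensor_hit (X : CoRep k H) (φ : H →ₗ[k] k) (x : X.bimod.carrier) :
    (hit X.coact φ).lTensor H (X.coact x) = ((TensorProduct.rid k H).toLinearMap ∘ₗ
      φ.lTensor H ∘ₗ comul).rTensor _ (X.coact x) := by
  have h1 : ∀ t, ((TensorProduct.lid k _).toLinearMap ∘ₗ φ.rTensor X.bimod.carrier).lTensor H
      (TensorProduct.assoc k H H _ ((comul (R := k) (A := H)).rTensor _ t))
      = ((TensorProduct.rid k H).toLinearMap ∘ₗ φ.lTensor H ∘ₗ comul).rTensor _ t :=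
    fun t => by
    induction t using TensorProduct.induction_on with
    | zero => simp
    | add s t hs ht => simp only [map_add, hs, ht]
    | tmul a b =>
      simp only [LinearMap.rTensor_tmul, LinearMap.comp_apply]
      generalize comul (R := k) a = s
      induction s using TensorProduct.induction_on with
      | zero => simp
      | add s t hs ht => simp only [map_add, TensorProduct.add_tmul, hs, ht]
      | tmul a b => simp [TensorProduct.smul_tmul]
  rw [← h1, X.coassoc, ← LinearMap.comp_apply (g := X.coact.lTensor H),
    ← LinearMap.lTensor_comp]
  rfl

/-- The isomorphism `H^t ⊗ X ≅ X`. -/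
def leftUnit [FiniteDimensional k H] (X : CoRep k H) : tensor unit X ≅ X :=
  isoMk (Bimod.leftUnit X.bimod) (LinearMap.congr_fun
    (f := X.coact ∘ₗ Bimod.leftUnitLin X.bimod)
    (g := (Bimod.leftUnitLin X.bimod).lTensor H ∘ₗ tensorCoact unit X)
    (Bimod.tensor_ext fun (z : targetSubalgebra k H) x => by
      let G : H ⊗[k] targetSubalgebra k H →ₗ[k] H →ₗ[k] H := LinearMap.mk₂ k
        (fun p h => TensorProduct.rid k H ((counit (R := k) (A := H)).lTensor H
          ((targetSubalgebra k H).val.toLinearMap.lTensor H p * comul h)))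
        (fun p q h => by simp [add_mul]) (fun c p h => by simp)
        (fun p g h => by simp [mul_add]) (fun c p h => by simp)
      have h1 : ∀ p, (Bimod.leftUnitLin X.bimod).lTensor H
          (codiag (Bimod.regular (targetAlg k H)) X.bimod p (X.coact x)) = (G p).rTensor _ (X.coact x) := fun p => by
        induction p using TensorProduct.induction_on with
        | zero => simp
        | add s t hs ht =>
          simp only [map_add, LinearMap.add_apply, LinearMap.rTensor_add, hs, ht]
        | tmul g w =>
          rw [show ∀ q, (Bimod.leftUnitLin X.bimod).lTensor H
              (codiag (Bimod.regular (targetAlg k H)) X.bimod (g ⊗ₜ w) q)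
              = (LinearMap.mulLeft k g).rTensor _ ((X.bimod.lact w).lTensor H q) from
            fun q => by
              induction q using TensorProduct.induction_on with
              | zero => simp
              | add s t hs ht => simp only [map_add, hs, ht]
              | tmul h y => rfl,
            show X.bimod.lact w = hit X.coact (counitL k H w) from
              LinearMap.ext (X.lact_eq w), lTensor_hit, ← LinearMap.comp_apply,
            ← LinearMap.rTensor_comp]
          congr 2
          ext h
          simp only [LinearMap.comp_apply, G, LinearMap.mk₂_apply]
          generalize comul (R := k) h = t
          induction t using TensorProduct.induction_on with
          | zero => simp
          | add s t hs ht => simp only [map_add, mul_add, hs, ht]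
          | tmul a b => simp
      change X.coact (X.bimod.lact z x) = (Bimod.leftUnitLin X.bimod).lTensor H
          (codiag (Bimod.regular (targetAlg k H)) X.bimod (unitCoact k H z) (X.coact x))
      rw [h1, coact_lact X z]
      congr 2
      ext h
      simp [G, lTensor_val_unitCoact, ← comul_mul]))

/-- The isomorphism `X ⊗ H^t ≅ X`. -/
def rightUnit [FiniteDimensional k H] (X : CoRep k H) : tensor X unit ≅ X :=
  isoMk (Bimod.rightUnit X.bimod) (LinearMap.congr_fun
    (f := X.coact ∘ₗ Bimod.rightUnitLin X.bimod)
    (g := (Bimod.rightUnitLin X.bimod).lTensor H ∘ₗ tensorCoact X unit)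
    (Bimod.tensor_ext fun x (z : targetSubalgebra k H) => by
      let G : H ⊗[k] targetSubalgebra k H →ₗ[k] H →ₗ[k] H := LinearMap.mk₂ k
        (fun p h => TensorProduct.rid k H ((counit (R := k) (A := H)).lTensor H
          (comul h * (targetSubalgebra k H).val.toLinearMap.lTensor H p)))
        (fun p q h => by simp [mul_add]) (fun c p h => by simp)
        (fun p g h => by simp [add_mul]) (fun c p h => by simp)
      have h1 : ∀ p, (Bimod.rightUnitLin X.bimod).lTensor H
          (codiag X.bimod (Bimod.regular (targetAlg k H)) (X.coact x) p)
          = (G p).rTensor _ (X.coact x) := fun p => by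
        induction p using TensorProduct.induction_on with
        | zero => simp
        | add s t hs ht =>
          simp only [map_add, LinearMap.add_apply, LinearMap.rTensor_add, hs, ht]
        | tmul g w =>
          rw [show ∀ q, (Bimod.rightUnitLin X.bimod).lTensor H
              (codiag X.bimod (Bimod.regular (targetAlg k H)) q (g ⊗ₜ w))
              = (LinearMap.mulRight k g).rTensor _ ((X.bimod.ract w).lTensor H q) from
            fun q => by
              induction q using TensorProduct.induction_on with
              | zero => simp
              | add s t hs ht => simp only [map_add, LinearMap.add_apply, hs, ht]
              | tmul h y => rfl,
            show X.bimod.ract w = hit X.coact (counitR k H w) from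
              LinearMap.ext (X.ract_eq w), lTensor_hit, ← LinearMap.comp_apply,
            ← LinearMap.rTensor_comp]
          congr 2
          ext h
          simp only [LinearMap.comp_apply, G, LinearMap.mk₂_apply]
          generalize comul (R := k) h = t
          induction t using TensorProduct.induction_on with
          | zero => simp
          | add s t hs ht => simp only [map_add, add_mul, hs, ht]
          | tmul a b => simp
      change X.coact (X.bimod.ract z x) = (Bimod.rightUnitLin X.bimod).lTensor H
          (codiag X.bimod (Bimod.regular (targetAlg k H)) (X.coact x) (unitCoact k H z))
      rw [h1, coact_ract X z]
      congr 2
      ext h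
      simp [G, lTensor_val_unitCoact, ← comul_mul]))

end unit

instance [FiniteDimensional k H] : MonoidalCategory (CoRep k H) where
  tensorObj X Y := tensor X Y
  tensorHom f g := tensorHom f g
  whiskerLeft X _ _ f := tensorHom (𝟙 X) f
  whiskerRight f Y := tensorHom f (𝟙 Y)
  tensorUnit := unit
  associator X Y Z := assoc X Y Z
  leftUnitor X := leftUnit X
  rightUnitor X := rightUnit X
  tensorHom_def f g := hom_ext (Bimod.tensor_ext fun _ _ => rfl)
  id_tensorHom_id X Y := hom_ext (Bimod.tensor_ext fun _ _ => rfl)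
  tensorHom_comp_tensorHom _ _ _ _ := hom_ext (Bimod.tensor_ext fun _ _ => rfl)
  whiskerLeft_id X Y := hom_ext (Bimod.tensor_ext fun _ _ => rfl)
  id_whiskerRight X Y := hom_ext (Bimod.tensor_ext fun _ _ => rfl)
  associator_naturality f g h := hom_ext (Bimod.tensor_ext₃ fun _ _ _ => rfl)
  leftUnitor_naturality f := hom_ext (Bimod.tensor_ext fun a m =>
    ((bimodMap f).map_lact a m).symm)
  rightUnitor_naturality f := hom_ext (Bimod.tensor_ext fun m a =>
    ((bimodMap f).map_ract a m).symm)
  pentagon W X Y Z := hom_ext (Bimod.tensor_ext₄ fun _ _ _ _ => rfl)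
  triangle X Y := hom_ext (Bimod.tensor_ext₃ fun m b n => (Bimod.ract_tmul m b n).symm)

end CoRep

/-! ### Half-braidings -/

section halfBraiding

open Bicategory MonoidalCategoryStruct

universe w v u₁ v₂ u₂

variable {𝓑 : Type u₁} [Bicategory.{w, v} 𝓑] {C : Type u₂} [Category.{v₂} C]
  [MonoidalCategory C] {a b c : 𝓑}

/-- The structure maps of a monoidal functor to the endomorphisms of an object. -/
def structMap (F : C ⥤ (a ⟶ a)) [F.LaxMonoidal] (X Y : C) :
    F.obj X ≫ F.obj Y ⟶ F.obj (tensorObj X Y) := Functor.LaxMonoidal.μ F X Y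

/-- For actions `F` on `a` and `G` on `b` of a monoidal category `C` and a 1-cell `M : b ⟶ a`,
a half-braiding is a natural family of isomorphisms `G(X) ⊗ M ≅ M ⊗ F(X)` which is compatible
with the tensor product of `C`. -/
structure HalfBraiding (G : C ⥤ (b ⟶ b)) (F : C ⥤ (a ⟶ a)) [G.LaxMonoidal] [F.LaxMonoidal]
    (M : b ⟶ a) where
  iso : ∀ X : C, G.obj X ≫ M ≅ M ≫ F.obj X
  naturality : ∀ {X Y : C} (f : X ⟶ Y),
    G.map f ▷ M ≫ (iso Y).hom = (iso X).hom ≫ M ◁ F.map f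
  tensor : ∀ X Y : C, structMap G X Y ▷ M ≫ (iso (tensorObj X Y)).hom
    = (α_ _ _ _).hom ≫ G.obj X ◁ (iso Y).hom ≫ (α_ _ _ _).inv ≫ (iso X).hom ▷ F.obj Y
      ≫ (α_ _ _ _).hom ≫ M ◁ structMap F X Y

namespace HalfBraiding

variable {G : C ⥤ (b ⟶ b)} {F : C ⥤ (a ⟶ a)} {K : C ⥤ (c ⟶ c)} [G.LaxMonoidal]
  [F.LaxMonoidal] [K.LaxMonoidal]

variable (F) in
/-- The half-braiding on the identity. -/
def id : HalfBraiding F F (𝟙 a) where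
  iso X := ρ_ (F.obj X) ≪≫ (λ_ (F.obj X)).symm
  naturality f := by simp
  tensor X Y := by simp

/-- The half-braiding on a composite. -/
def comp {N : c ⟶ b} {M : b ⟶ a} (τ : HalfBraiding K G N) (σ : HalfBraiding G F M) :
    HalfBraiding K F (N ≫ M) where
  iso X := (α_ _ _ _).symm ≪≫ whiskerRightIso (τ.iso X) M ≪≫ α_ _ _ _ ≪≫
    whiskerLeftIso N (σ.iso X) ≪≫ (α_ _ _ _).symm
  naturality {X Y} f := by
    have h1 := congrArg (fun t => t ▷ M) (τ.naturality f)
    have h2 := congrArg (fun t => N ◁ t) (σ.naturality f)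
    simp only [Bicategory.comp_whiskerRight, Bicategory.whiskerLeft_comp] at h1 h2
    simp only [Iso.trans_hom, Iso.symm_hom, whiskerRightIso_hom, whiskerLeftIso_hom]
    calc _ = (α_ _ _ _).inv ≫ (K.map f ▷ N ▷ M ≫ (τ.iso Y).hom ▷ M) ≫ (α_ _ _ _).hom ≫
          N ◁ (σ.iso Y).hom ≫ (α_ _ _ _).inv := by simp
      _ = (α_ _ _ _).inv ≫ (τ.iso X).hom ▷ M ≫ (α_ _ _ _).hom ≫
          (N ◁ G.map f ▷ M ≫ N ◁ (σ.iso Y).hom) ≫ (α_ _ _ _).inv := by rw [h1]; simp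
      _ = _ := by rw [h2]; simp
  tensor X Y := by
    have h1 := congrArg (fun t => t ▷ M) (τ.tensor X Y)
    have h2 := congrArg (fun t => N ◁ t) (σ.tensor X Y)
    simp only [Bicategory.comp_whiskerRight, Bicategory.whiskerLeft_comp] at h1 h2
    simp only [Iso.trans_hom, Iso.symm_hom, whiskerRightIso_hom, whiskerLeftIso_hom]
    calc _ = (α_ _ _ _).inv ≫ (structMap K X Y ▷ N ▷ M ≫ (τ.iso (tensorObj X Y)).hom ▷ M) ≫
          (α_ _ _ _).hom ≫ N ◁ (σ.iso (tensorObj X Y)).hom ≫ (α_ _ _ _).inv := by simp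
      _ = _ := by
        rw [h1]
        simp only [Category.assoc, Bicategory.whisker_assoc]
        rw [Iso.inv_hom_id_assoc, reassoc_of% h2]
        calc _ = 𝟙 _ ⊗≫ K.obj X ◁ (τ.iso Y).hom ▷ M ⊗≫
              ((τ.iso X).hom ▷ (G.obj Y ≫ M) ≫ (N ≫ G.obj X) ◁ (σ.iso Y).hom) ⊗≫
              N ◁ (σ.iso X).hom ▷ F.obj Y ⊗≫ (N ≫ M) ◁ structMap F X Y := by bicategory
          _ = 𝟙 _ ⊗≫ K.obj X ◁ (τ.iso Y).hom ▷ M ⊗≫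
              ((K.obj X ≫ N) ◁ (σ.iso Y).hom ≫ (τ.iso X).hom ▷ (M ≫ F.obj Y)) ⊗≫
              N ◁ (σ.iso X).hom ▷ F.obj Y ⊗≫ (N ≫ M) ◁ structMap F X Y := by
            rw [Bicategory.whisker_exchange]
          _ = _ := by bicategory

/-- The half-braiding transported along an isomorphism. -/
def ofIso {M M' : b ⟶ a} (e : M ≅ M') (σ : HalfBraiding G F M) : HalfBraiding G F M' where
  iso X := whiskerLeftIso _ e.symm ≪≫ σ.iso X ≪≫ whiskerRightIso e _
  naturality {X Y} f := by
    have h := σ.naturality f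
    simp only [Iso.trans_hom, Iso.symm_hom, whiskerRightIso_hom, whiskerLeftIso_hom,
      Category.assoc]
    rw [← Bicategory.whisker_exchange, ← Bicategory.whisker_exchange_assoc, reassoc_of% h]
  tensor X Y := by
    have h := σ.tensor X Y
    simp only [Iso.trans_hom, Iso.symm_hom, whiskerRightIso_hom, whiskerLeftIso_hom]
    rw [← Bicategory.whisker_exchange_assoc, reassoc_of% h]
    calc _ = (G.obj X ≫ G.obj Y) ◁ e.inv ⊗≫ G.obj X ◁ (σ.iso Y).hom ⊗≫
          (σ.iso X).hom ▷ F.obj Y ⊗≫ (M ◁ structMap F X Y ≫ e.hom ▷ _) := by bicategory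
      _ = (G.obj X ≫ G.obj Y) ◁ e.inv ⊗≫ G.obj X ◁ (σ.iso Y).hom ⊗≫
          G.obj X ◁ ((e.hom ≫ e.inv) ▷ F.obj Y) ⊗≫
          (σ.iso X).hom ▷ F.obj Y ⊗≫ (e.hom ▷ _ ≫ M' ◁ structMap F X Y) := by
        rw [Bicategory.whisker_exchange, e.hom_inv_id]; bicategory
      _ = _ := by bicategory

end HalfBraiding

end halfBraiding


/-! ### The weak fibre functor -/

section bim

open Functor.LaxMonoidal MonoidalCategoryStruct

variable {k : Type u} [Field k]

/-- The vector space underlying a bimodule. -/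
abbrev Bimod.Space {A B : Alg k} (M : A ⟶ B) : Type u := Bimod.carrier M

/-- The linear map underlying a homomorphism of bimodules. -/
abbrev Bimod.lin {A B : Alg k} {M N : A ⟶ B} (f : M ⟶ N) :
    Bimod.Space M →ₗ[k] Bimod.Space N := Bimod.Hom.toLin f

/-- The canonical map `M × N → M ⊗_B N`. -/
abbrev Bimod.pure {A B C : Alg k} (M : A ⟶ B) (N : B ⟶ C) :
    Bimod.Space M →ₗ[k] Bimod.Space N →ₗ[k] Bimod.Space (M ≫ N) := Bimod.tmul M N

theorem Bimod.smul_one_lact {A B : Alg k} (M : Bimod A B) (c : k) (m : M.carrier) :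
    M.lact (c • 1) m = c • m := by
  rw [map_smul, LinearMap.smul_apply, M.one_lact]

theorem Bimod.smul_one_ract {A B : Alg k} (M : Bimod A B) (c : k) (m : M.carrier) :
    M.ract (c • 1) m = c • m := by
  rw [map_smul, LinearMap.smul_apply, M.one_ract]

/-- The forgetful functor from `A`-bimodules to vector spaces. -/
def Bimod.forget (A : Alg k) : (A ⟶ A) ⥤ ModuleCat.{u} k where
  obj M := ModuleCat.of k (Bimod.Space M)
  map f := ModuleCat.ofHom (Bimod.lin f)

/-- The lax monoidal structure of the forgetful functor is given by `1 ∈ A` and the maps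
`M ⊗ N → M ⊗_A N`. -/
instance (A : Alg k) : (Bimod.forget A).LaxMonoidal where
  ε := ModuleCat.ofHom (LinearMap.toSpanSingleton k A.carrier 1)
  μ M N := ModuleCat.ofHom (TensorProduct.lift (Bimod.pure M N))
  μ_natural_left f N := ModuleCat.hom_ext (TensorProduct.ext' fun _ _ => rfl)
  μ_natural_right M f := ModuleCat.hom_ext (TensorProduct.ext' fun _ _ => rfl)
  associativity M N P := ModuleCat.hom_ext (TensorProduct.ext_threefold fun _ _ _ => rfl)
  left_unitality M := ModuleCat.hom_ext (TensorProduct.ext' fun c m =>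
    (Bimod.smul_one_lact M c m).symm)
  right_unitality M := ModuleCat.hom_ext (TensorProduct.ext' fun m c =>
    (Bimod.smul_one_ract M c m).symm)

end bim

section fiber

variable (k H : Type u) [Field k] [Ring H] [Algebra k H] [WeakHopfAlgebra k H]
  [FiniteDimensional k H]

/-- The functor from corepresentations of `H` to `H^t`-bimodules. -/
def toBim : CoRep k H ⥤ (targetAlg k H ⟶ targetAlg k H) where
  obj X := X.bimod
  map f := CoRep.bimodMap f

/-- The monoidal structure of `toBim k H`: the tensor product of corepresentations is that of
`H^t`-bimodules. -/
instance : (toBim k H).Monoidal :=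
  Functor.CoreMonoidal.toMonoidal
    { εIso := Iso.refl _
      μIso := fun _ _ => Iso.refl _
      μIso_hom_natural_left := fun _ _ => Bimod.hom_ext (Bimod.tensor_ext fun _ _ => rfl)
      μIso_hom_natural_right := fun _ _ => Bimod.hom_ext (Bimod.tensor_ext fun _ _ => rfl)
      associativity := fun _ _ _ => Bimod.hom_ext (Bimod.tensor_ext₃ fun _ _ _ => rfl)
      left_unitality := fun _ => Bimod.hom_ext (Bimod.tensor_ext fun _ _ => rfl)
      right_unitality := fun _ => Bimod.hom_ext (Bimod.tensor_ext fun _ _ => rfl) }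

/-- The weak fibre functor `F_H`, a lax monoidal functor. -/
abbrev fiber : CoRep k H ⥤ ModuleCat.{u} k := toBim k H ⋙ Bimod.forget (targetAlg k H)

end fiber

/-! ### Based actions -/

section based

open Functor.LaxMonoidal MonoidalCategoryStruct

/-- A based action of the category of corepresentations of `H` on `A`: a monoidal functor `F`
to the category of `A`-bimodules, together with finite-dimensional base spaces
`V_X ⊆ F(X)` which are preserved by morphisms and by the tensor product, such that
`1_A ∈ V_1`. -/
structure BasedAction (k H : Type u) [Field k] [Ring H] [Algebra k H] [WeakHopfAlgebra k H]
    [FiniteDimensional k H] (A : Alg.{u} k) where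
  functor : CoRep k H ⥤ (A ⟶ A)
  [monoidal : functor.Monoidal]
  base : ∀ X : CoRep k H, Submodule k (Bimod.Space (functor.obj X))
  [finiteDimensional : ∀ X, FiniteDimensional k (base X)]
  map_mem : ∀ {X Y : CoRep k H} (f : X ⟶ Y), ∀ v ∈ base X,
    Bimod.lin (functor.map f) v ∈ base Y
  one_mem : Bimod.lin (ε functor) (1 : A.carrier) ∈ base (tensorUnit (CoRep k H))
  mul_mem : ∀ (X Y : CoRep k H), ∀ v ∈ base X, ∀ w ∈ base Y,
    Bimod.lin (μ functor X Y) (Bimod.pure _ _ v w) ∈ base (tensorObj X Y)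

attribute [instance] BasedAction.monoidal BasedAction.finiteDimensional

namespace BasedAction

variable {k H : Type u} [Field k] [Ring H] [Algebra k H] [WeakHopfAlgebra k H]
    [FiniteDimensional k H] {A : Alg.{u} k} (V : BasedAction k H A)

/-- The functor `X ↦ V_X`. -/
def induced : CoRep k H ⥤ ModuleCat.{u} k where
  obj X := ModuleCat.of k (V.base X)
  map f := ModuleCat.ofHom ((Bimod.lin (V.functor.map f)).restrict (V.map_mem f))
  map_id X := ModuleCat.hom_ext (LinearMap.ext fun v => Subtype.ext (by
    change Bimod.lin (V.functor.map (𝟙 X)) v.1 = v.1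
    rw [V.functor.map_id]; rfl))
  map_comp f g := ModuleCat.hom_ext (LinearMap.ext fun v => Subtype.ext (by
    change Bimod.lin (V.functor.map (f ≫ g)) v.1 = _
    rw [V.functor.map_comp]; rfl))

/-- The map `V_X × V_Y → V_{X ⊗ Y}`. -/
def mulBase (X Y : CoRep k H) : V.base X →ₗ[k] V.base Y →ₗ[k] V.base (tensorObj X Y) :=
  LinearMap.mk₂ k (fun v w => ⟨_, V.mul_mem X Y v v.2 w w.2⟩)
    (fun _ _ _ => Subtype.ext (by simp)) (fun _ _ _ => Subtype.ext (by simp))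
    (fun _ _ _ => Subtype.ext (by simp)) (fun _ _ _ => Subtype.ext (by simp))

/-- The lax monoidal structure of `X ↦ V_X`. -/
instance : V.induced.LaxMonoidal where
  ε := ModuleCat.ofHom (LinearMap.toSpanSingleton k (V.base (tensorUnit (CoRep k H)))
    ⟨Bimod.lin (ε V.functor) (1 : A.carrier), V.one_mem⟩)
  μ X Y := ModuleCat.ofHom (TensorProduct.lift (V.mulBase X Y))
  μ_natural_left f Z := ModuleCat.hom_ext (TensorProduct.ext' fun v w => Subtype.ext
    (LinearMap.congr_fun (congrArg Bimod.lin (μ_natural_left V.functor f Z))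
      (Bimod.pure _ _ v.1 w.1)))
  μ_natural_right Z f := ModuleCat.hom_ext (TensorProduct.ext' fun v w => Subtype.ext
    (LinearMap.congr_fun (congrArg Bimod.lin (μ_natural_right V.functor Z f))
      (Bimod.pure _ _ v.1 w.1)))
  associativity X Y Z := ModuleCat.hom_ext (TensorProduct.ext_threefold fun u v w => Subtype.ext
    (LinearMap.congr_fun (congrArg Bimod.lin (associativity V.functor X Y Z))
      (Bimod.pure _ _ (Bimod.pure _ _ u.1 v.1) w.1)))
  left_unitality X := ModuleCat.hom_ext (TensorProduct.ext' fun c v => by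
    have h := LinearMap.congr_fun (congrArg Bimod.lin (left_unitality V.functor X))
      (Bimod.pure (𝟙 A) _ (c • 1 : A.carrier) v.1)
    refine Subtype.ext ((Bimod.smul_one_lact _ c v.1).symm.trans (h.trans ?_))
    have h1 : Bimod.lin (ε V.functor) (c • 1 : A.carrier)
      = c • Bimod.lin (ε V.functor) (1 : A.carrier) := map_smul _ _ _
    exact congrArg (fun t => Bimod.lin (V.functor.map (leftUnitor X).hom)
      (Bimod.lin (μ V.functor _ X) (Bimod.pure _ _ t v.1))) h1)
  right_unitality X := ModuleCat.hom_ext (TensorProduct.ext' fun v c => by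
    have h := LinearMap.congr_fun (congrArg Bimod.lin (right_unitality V.functor X))
      (Bimod.pure _ (𝟙 A) v.1 (c • 1 : A.carrier))
    refine Subtype.ext ((Bimod.smul_one_ract _ c v.1).symm.trans (h.trans ?_))
    have h1 : Bimod.lin (ε V.functor) (c • 1 : A.carrier)
      = c • Bimod.lin (ε V.functor) (1 : A.carrier) := map_smul _ _ _
    exact congrArg (fun t => Bimod.lin (V.functor.map (rightUnitor X).hom)
      (Bimod.lin (μ V.functor X _) (Bimod.pure _ _ v.1 t))) h1)

/-- Equivalence of based actions on the same algebra: a monoidal natural isomorphism which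
identifies the base spaces. -/
def Equivalent (V W : BasedAction k H A) : Prop :=
  ∃ η : V.functor ≅ W.functor, NatTrans.IsMonoidal η.hom ∧
    ∀ X, (V.base X).map (Bimod.lin (η.hom.app X)) = W.base X

end BasedAction
end based


open Bicategory

variable (k H : Type u) [Field k] [Ring H] [Algebra k H] [WeakHopfAlgebra k H]
    [FiniteDimensional k H]

/-- Based actions over the weak fibre functor `F_H`: the induced lax monoidal functor is
identified with `F_H` by a monoidal natural isomorphism. -/
structure FiberedAction (A : Alg.{u} k) extends BasedAction k H A where
  identification : fiber k H ≅ toBasedAction.induced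
  [isMonoidal : NatTrans.IsMonoidal identification.hom]

variable {k H}

/-- The bijection `F_H(X) → V_X`, as a map to `F(X)`. -/
def FiberedAction.baseMap {A : Alg.{u} k} (V : FiberedAction k H A) (X : CoRep k H) :
    X.bimod.carrier →ₗ[k] Bimod.Space (V.functor.obj X) :=
  (V.base X).subtype ∘ₗ (V.identification.hom.app X).hom

/-- A based `B`-`A`-bimodule whose underlying left `B`-module is `B` itself, with base space
spanned by `1_B`. It is given by its right action `act a b = b a`. -/
@[ext]
structure BasedBimod (B A : Alg.{u} k) where
  act : A.carrier →ₗ[k] B.carrier →ₗ[k] B.carrier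
  one_act : ∀ b, act 1 b = b
  mul_act : ∀ a a' b, act (a * a') b = act a' (act a b)
  mul_act_right : ∀ a b b', b * act a b' = act a (b * b')

namespace BasedBimod

/-- The underlying bimodule. -/
def bimod {B A : Alg.{u} k} (M : BasedBimod B A) : B ⟶ A where
  carrier := B.carrier
  lact := LinearMap.mul k B.carrier
  ract := M.act
  one_lact := one_mul
  mul_lact := mul_assoc
  one_ract := M.one_act
  mul_ract := M.mul_act
  lact_ract b a b' := M.mul_act_right a b b'

/-- The regular bimodule. -/
def id (A : Alg.{u} k) : BasedBimod A A where
  act := (LinearMap.mul k A.carrier).flip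
  one_act := mul_one
  mul_act a a' b := (mul_assoc b a a').symm
  mul_act_right a b b' := (mul_assoc b b' a).symm

variable {A B C : Alg.{u} k}

theorem act_eq (M : BasedBimod B A) (a : A.carrier) (b : B.carrier) :
    M.act a b = b * M.act a 1 := by
  rw [M.mul_act_right, mul_one]

/-- The tensor product `C ⊗_B B ≅ C` of based bimodules; see `compIso`. -/
def comp (N : BasedBimod C B) (M : BasedBimod B A) : BasedBimod C A where
  act := N.act ∘ₗ M.act.flip 1
  one_act c := by simp [M.one_act, N.one_act]
  mul_act a a' c := by simp [M.mul_act, M.act_eq a' (M.act a 1), N.mul_act]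
  mul_act_right a c c' := N.mul_act_right _ _ _

/-- The isomorphism `C ⊗_B B ≅ C` of based bimodules, `c ⊗ b ↦ c b`. -/
def compIso (N : BasedBimod C B) (M : BasedBimod B A) :
    N.bimod ≫ M.bimod ≅ (comp N M).bimod :=
  Bimod.isoMk
    ⟨Bimod.lift (M := N.bimod) (N := M.bimod) N.act.flip
        (fun c b b' => (N.mul_act b b' c).symm),
      fun c => LinearMap.congr_fun
        (f := Bimod.lift (M := N.bimod) (N := M.bimod) N.act.flip
          (fun c b b' => (N.mul_act b b' c).symm) ∘ₗ (Bimod.tensor N.bimod M.bimod).lact c)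
        (g := LinearMap.mulLeft k c ∘ₗ Bimod.lift (M := N.bimod) (N := M.bimod) N.act.flip
          (fun c b b' => (N.mul_act b b' c).symm))
        (Bimod.tensor_ext fun c' b => (N.mul_act_right b c c').symm),
      fun a => LinearMap.congr_fun
        (f := Bimod.lift (M := N.bimod) (N := M.bimod) N.act.flip
          (fun c b b' => (N.mul_act b b' c).symm) ∘ₗ (Bimod.tensor N.bimod M.bimod).ract a)
        (g := (comp N M).act a ∘ₗ Bimod.lift (M := N.bimod) (N := M.bimod) N.act.flip
          (fun c b b' => (N.mul_act b b' c).symm))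
        (Bimod.tensor_ext fun (c : C.carrier) (b : B.carrier) => by
          change N.act (M.act a b) c = N.act (M.act a 1) (N.act b c)
          exact (congrArg (fun x => N.act x c) (M.act_eq a b)).trans (N.mul_act _ _ _))⟩
    ((Bimod.tmul N.bimod M.bimod).flip (1 : B.carrier))
    (LinearMap.congr_fun
      (f := (Bimod.tmul N.bimod M.bimod).flip (1 : B.carrier) ∘ₗ
        Bimod.lift (M := N.bimod) (N := M.bimod) N.act.flip
          (fun c b b' => (N.mul_act b b' c).symm))
      (g := LinearMap.id) (Bimod.tensor_ext fun c b =>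
        (Bimod.ract_tmul (M := N.bimod) (N := M.bimod) c b (1 : B.carrier)).trans
          (congrArg (fun x => Bimod.tmul N.bimod M.bimod c x) (mul_one (M := B.carrier) b))))
    (fun c => N.one_act c)

end BasedBimod

/-- A half-braiding for a based bimodule which restricts to the identity on base spaces. -/
def IsBasedHalfBraiding {A B : Alg.{u} k} (V : FiberedAction k H A) (W : FiberedAction k H B)
    (M : BasedBimod B A) (σ : HalfBraiding W.functor V.functor M.bimod) : Prop :=
  ∀ (Z : CoRep k H) (z : Z.bimod.carrier),
    Bimod.lin (σ.iso Z).hom (Bimod.pure (W.functor.obj Z) M.bimod (W.baseMap Z z) (1 : B.carrier))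
      = Bimod.pure M.bimod (V.functor.obj Z) (1 : B.carrier) (V.baseMap Z z)

theorem IsBasedHalfBraiding.id {A : Alg.{u} k} (V : FiberedAction k H A) :
    IsBasedHalfBraiding V V (BasedBimod.id A) (HalfBraiding.id V.functor) := fun Z z =>
  congrArg (Bimod.pure (𝟙 A) (V.functor.obj Z) (1 : A.carrier))
    (Bimod.one_ract (V.functor.obj Z) (V.baseMap Z z))

theorem IsBasedHalfBraiding.comp {A B C : Alg.{u} k} {V : FiberedAction k H A}
    {W : FiberedAction k H B} {U : FiberedAction k H C} {N : BasedBimod C B}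
    {M : BasedBimod B A} {τ : HalfBraiding U.functor W.functor N.bimod}
    {σ : HalfBraiding W.functor V.functor M.bimod} (hτ : IsBasedHalfBraiding W U N τ)
    (hσ : IsBasedHalfBraiding V W M σ) :
    IsBasedHalfBraiding V U (N.comp M) ((τ.comp σ).ofIso (N.compIso M)) := fun Z z => by
  have h1 := congrArg (fun t => Bimod.lin (N.bimod ◁ (σ.iso Z).hom)
    (Bimod.lin (α_ N.bimod (W.functor.obj Z) M.bimod).hom
      (Bimod.pure _ M.bimod t (1 : B.carrier)))) (hτ Z z)
  have h2 := congrArg (fun t => Bimod.pure N.bimod _ (1 : C.carrier) t) (hσ Z z)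
  have h3 := congrArg (fun t => Bimod.lin ((N.compIso M).hom ▷ (V.functor.obj Z))
    (Bimod.lin (α_ N.bimod M.bimod (V.functor.obj Z)).inv t)) (h1.trans h2)
  refine Eq.trans h3 ?_
  exact congrArg (fun c : C.carrier => Bimod.pure (N.comp M).bimod (V.functor.obj Z) c
    (V.baseMap Z z)) (N.one_act (1 : C.carrier))

variable (k H) in
/-- Objects of the category `BasedAlg`: algebras with a based action over `F_H`. -/
structure BasedAlg where
  alg : Alg.{u} k
  action : FiberedAction k H alg

namespace BasedAlg

/-- A morphism from a based action on `A` to a based action on `B` is a based `B`-`A`-bimodule,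
equal to `B` with base space spanned by `1_B`, which admits a half-braiding that restricts to the
identity on base spaces. -/
@[ext]
structure Hom (X Y : BasedAlg k H) extends BasedBimod Y.alg X.alg where
  braiding : ∃ σ, IsBasedHalfBraiding X.action Y.action toBasedBimod σ

instance : Category.{u} (BasedAlg k H) where
  Hom X Y := Hom X Y
  id X := ⟨BasedBimod.id X.alg, _, IsBasedHalfBraiding.id X.action⟩
  comp f g := ⟨g.toBasedBimod.comp f.toBasedBimod, by
    obtain ⟨σ, hσ⟩ := f.braiding
    obtain ⟨τ, hτ⟩ := g.braiding
    exact ⟨_, hτ.comp hσ⟩⟩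
  id_comp f := Hom.ext (LinearMap.ext fun a => by
    change f.act (1 * a) = f.act a
    rw [one_mul])
  comp_id f := Hom.ext (LinearMap.ext fun a => LinearMap.ext fun b =>
    (f.act_eq a b).symm)
  assoc f g h := Hom.ext rfl

/-- The algebra homomorphism `a ↦ 1 a` of a morphism. -/
def Hom.toAlgHom {X Y : BasedAlg k H} (f : Hom X Y) : X.alg.carrier →ₐ[k] Y.alg.carrier :=
  AlgHom.ofLinearMap (f.act.flip 1) (f.one_act 1) fun a a' =>
    (f.mul_act a a' 1).trans (f.act_eq a' (f.act a 1))

variable (k H) in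
/-- The forgetful functor to algebras. -/
def forget : BasedAlg k H ⥤ AlgCat.{u} k where
  obj X := AlgCat.of k X.alg.carrier
  map f := AlgCat.ofHom (Hom.toAlgHom f)
  map_id X := AlgCat.hom_ext _ (AlgHom.ext fun a => one_mul (M := X.alg.carrier) a)
  map_comp f g := rfl

end BasedAlg

/-! ### Module algebras -/

/-- The linear map `h ↦ h a`. -/
def orbit {A : Type u} [AddCommGroup A] [Module k A] [Module H A] [IsScalarTower k H A] (a : A) :
    H →ₗ[k] A := (LinearMap.toSpanSingleton H A a).restrictScalars k

variable (k H) in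
/-- `H`-module algebras. -/
structure ModAlg where
  alg : Alg.{u} k
  [module : Module H alg.carrier]
  [isScalarTower : IsScalarTower k H alg.carrier]
  /-- `h (a b) = (h₁ a) (h₂ b)` -/
  smul_mul : ∀ (h : H) (a b : alg.carrier), h • (a * b) = LinearMap.mul' k alg.carrier
    (TensorProduct.map (orbit a) (orbit b) (Coalgebra.comul (R := k) h))
  smul_one : ∀ h : H, h • (1 : alg.carrier) = targetMap k H h • (1 : alg.carrier)

attribute [instance] ModAlg.module ModAlg.isScalarTower

namespace ModAlg

/-- Homomorphisms of `H`-module algebras. -/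
@[ext]
structure Hom (M N : ModAlg k H) where
  toAlgHom : M.alg.carrier →ₐ[k] N.alg.carrier
  map_smul : ∀ (h : H) (a : M.alg.carrier), toAlgHom (h • a) = h • toAlgHom a

instance : Category.{u} (ModAlg k H) where
  Hom M N := Hom M N
  id M := ⟨AlgHom.id k _, fun _ _ => rfl⟩
  comp f g := ⟨g.toAlgHom.comp f.toAlgHom, fun h a => by simp [f.map_smul, g.map_smul]⟩

variable (k H) in
/-- The forgetful functor to algebras. -/
def forget : ModAlg k H ⥤ AlgCat.{u} k where
  obj M := AlgCat.of k M.alg.carrier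
  map f := AlgCat.ofHom (Hom.toAlgHom f)

variable (k H) in
/-- The property that the canonical map `H^t → A`, `z ↦ z 1_A`, is injective. -/
def faithful : ObjectProperty (ModAlg k H) := fun M =>
  Function.Injective fun z : targetSubalgebra k H => (z : H) • (1 : M.alg.carrier)

theorem smul_one_mul (M : ModAlg k H) (z : targetSubalgebra k H) (a : M.alg.carrier) :
    ((z : H) • (1 : M.alg.carrier)) * a = (z : H) • a := by
  have h1 := M.smul_mul 1 ((z : H) • (1 : M.alg.carrier)) a
  have h2 := M.smul_mul (z : H) 1 a
  rw [one_smul] at h1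
  rw [one_mul] at h2
  rw [h1, h2]
  have h3 := comul_mul_coe (k := k) z (1 : H)
  rw [one_mul] at h3
  rw [h3]
  generalize Coalgebra.comul (R := k) (1 : H) = t
  induction t using TensorProduct.induction_on with
  | zero => simp
  | add s t hs ht => simp only [map_add, add_mul, hs, ht]
  | tmul g h => simp [orbit, mul_smul]

/-- A module algebra `A` as an `A`-`H^t`-bimodule, with `a z = a (z 1_A)`. -/
def targetBimod (M : ModAlg k H) : M.alg ⟶ targetAlg k H where
  carrier := M.alg.carrier
  lact := LinearMap.mul k M.alg.carrier
  ract := (LinearMap.mul k M.alg.carrier).flip ∘ₗ orbit (H := H) 1 ∘ₗ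
    (targetSubalgebra k H).val.toLinearMap
  one_lact := one_mul
  mul_lact := mul_assoc
  one_ract m := by simp [orbit]
  mul_ract z z' m := by
    have h := M.smul_one_mul z ((z' : H) • (1 : M.alg.carrier))
    simp [orbit, mul_assoc, h, mul_smul]
  lact_ract a z m := (mul_assoc _ _ _).symm

variable (k H) in
/-- The component of an automorphism of `F_H` at the unit object `H^t`. -/
def unitComponent (α : fiber k H ≅ fiber k H) :
    targetSubalgebra k H →ₗ[k] targetSubalgebra k H :=
  (α.hom.app (MonoidalCategoryStruct.tensorUnit (CoRep k H))).hom

variable (k H) in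
/-- The component of an automorphism of `F_H` at the comodule `H`. -/
def regularComponent (α : fiber k H ≅ fiber k H) : H →ₗ[k] H :=
  (α.hom.app (CoRep.regular k H)).hom

/-- The canonical map `A × H → A ⊗_{H^t} H`. -/
def tmulRegular (M : ModAlg k H) : M.alg.carrier →ₗ[k] H →ₗ[k]
    Bimod.Space (M.targetBimod ≫ (CoRep.regular k H).bimod) :=
  Bimod.pure M.targetBimod (CoRep.regular k H).bimod

/-- Two module algebras are related, along an isomorphism `θ` of their underlying algebras, by a
`J`-twisted isomorphism of `H`: there is a monoidal natural automorphism `α` of the weak fibre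
functor `F_H` such that `θ(z 1) = α_1(z) 1` for all `z ∈ H^t` and
`θ(h₁ a) ⊗ α_H(h₂) = α_H(h)₁ θ(a) ⊗ α_H(h)₂` in `N ⊗_{H^t} H`, for all `h` and `a`. -/
def JTwisted (M N : ModAlg k H) (θ : M.alg.carrier ≃ₐ[k] N.alg.carrier) : Prop :=
  ∃ α : fiber k H ≅ fiber k H, NatTrans.IsMonoidal α.hom ∧
    (∀ z : targetSubalgebra k H, θ ((z : H) • (1 : M.alg.carrier))
      = (unitComponent k H α z : H) • (1 : N.alg.carrier)) ∧
    ∀ (h : H) (a : M.alg.carrier),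
      TensorProduct.lift (N.tmulRegular.compl₁₂ (θ.toLinearMap ∘ₗ orbit a)
        (regularComponent k H α)) (Coalgebra.comul (R := k) h)
      = TensorProduct.lift (N.tmulRegular.compl₁₂ (orbit (θ a)) LinearMap.id)
          (Coalgebra.comul (R := k) (regularComponent k H α h))

end ModAlg

variable (k H) in
/-- The unit object of the category of `H`-modules, `H^t` with `h z = ε_t(h z)`, is simple. -/
def UnitSimple : Prop := Nontrivial (targetSubalgebra k H) ∧
  ∀ I : Submodule k H, I ≤ Subalgebra.toSubmodule (targetSubalgebra k H) →
    (∀ h, ∀ z ∈ I, targetMap k H (h * z) ∈ I) →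
      I = ⊥ ∨ I = Subalgebra.toSubmodule (targetSubalgebra k H)

end BasedAct

/-! ### Identities in weak Hopf algebras -/

namespace BasedAct

section weakHopf

open Coalgebra WeakHopfAlgebra CoRep

variable {k H : Type u} [Field k] [Ring H] [Algebra k H] [WeakHopfAlgebra k H]

/-! A based action over `F_H` is rebuilt from its base spaces. Let F be the functor to A-bimodules.
The base space at the unit object embeds H^t in A (`iota`), and the base spaces give maps X → F(X).
The central fact is that A ⊗_{H^t} X → F(X), a ⊗ x ↦ a x, is bijective (`can_canInv`,
`canInv_lact_baseMap`). It comes from duality. The antipode gives a dual comodule X^*, with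
evaluation x ⊗ f ↦ ε_t(x₋₁) f(x₀) and coevaluation z ↦ z Σ f_i ⊗ x_i for dual bases. A monoidal
functor preserves the zigzag identity, so every v in F(X) equals Σ F(ev)(v f_i) x_i (`sum_pairF`).
The proof that X^* is a comodule and that these maps are colinear needs the calculus of weak Hopf
algebras, above all Δ(S(h)) = S(h₂) ⊗ S(h₁) and Δ(ε_t(h)) = h₁ S(h₃) ⊗ ε_t(h₂).

Hence F(X) is known as a left module, and only its right action carries information. For X = H,
project h a to A by the left linear map F(H) → A, b g ↦ b ε_t(g); the result is called h·a. The
coefficient maps X → H, x ↦ x₋₁ f(x₀), separate the elements of F(X), and this yields x a = (x₋₁·a)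
x₀ for every X (`ract_baseMap_eq`). Associativity of the right action then says h·(a b) =
(h₁·a)(h₂·b). Computing (g ⊗ h) a in F(H ⊗ H) in two ways gives (g h)·a = g·(h·a).

A based bimodule is the same as an algebra homomorphism θ. A half-braiding that is the identity on
base spaces is forced to send b x ⊗ 1 to b ⊗ x. Its existence makes θ equivariant (`toAlgHom_act`),
and conversely an equivariant θ makes this formula a half-braiding; so the functor to module
algebras is fully faithful. For essential surjectivity, a module algebra A acts through F(X) = A
⊗_{H^t} X with (a ⊗ x) b = a (x₋₁·b) ⊗ x₀ and base spaces 1 ⊗ X. The map x ↦ 1 ⊗ x is injective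
because H^t → A is: averaging with the separability idempotent e of H^t turns a linear retraction r
of H^t → A into the right H^t-linear one a ↦ r(a e₁) e₂ (`unitTmul_injective`).

An equivalence of two based actions restricts on base spaces to a monoidal automorphism α of `F_H`,
and is recovered from it as a x ↦ a α(x). This formula always gives left linear maps that are
natural in X, once the embeddings of H^t match under α. That they are right linear has to be tested
only at X = H, again by coefficient maps, and there it is the J-twisted equation read through A
⊗_{H^t} H ≅ F(H).

For the second statement, the kernel of z ↦ z·1 is a submodule of H^t, since h·1 = ε_t(h)·1. -/

theorem Repr.map_comul {P Q : Type*} [AddCommGroup P] [Module k P] [AddCommGroup Q] [Module k Q]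
    {ι : Type*} {h : H} (r : Coalgebra.Repr k h ι) (f : H →ₗ[k] P) (g : H →ₗ[k] Q) :
    TensorProduct.map f g (comul (R := k) h) = ∑ i ∈ r.index, f (r.left i) ⊗ₜ[k] g (r.right i) := by
  rw [← r.eq]; simp

theorem Repr.targetMap_eq {ι : Type*} (r : Coalgebra.Repr k (1 : H) ι) (h : H) :
    targetMap k H h = ∑ i ∈ r.index, counit (R := k) (r.left i * h) • r.right i := by
  rw [BasedAct.targetMap_eq, ← r.eq]; simp

/-- The value ε_t(g h) depends on h only through numbers ε(x h), and ε(x h) = ε(x ε_t(h)). -/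
theorem targetMap_mul_targetMap (g h : H) :
    targetMap k H (g * targetMap k H h) = targetMap k H (g * h) := by
  simp only [Repr.targetMap_eq (ℛ k (1 : H)) (g * _), ← mul_assoc, counit_mul_targetMap]

/-- Replace h by ε_t(h) under ε_t; then z ε_t(h) already lies in H^t, where ε_t is the identity. -/
theorem targetMap_coe_mul (z : targetSubalgebra k H) (h : H) :
    targetMap k H ((z : H) * h) = z * targetMap k H h := by
  rw [← targetMap_mul_targetMap]
  exact targetMap_coe (z * toTarget k H h)

theorem targetMap_targetMap (h : H) : targetMap k H (targetMap k H h) = targetMap k H h :=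
  targetMap_coe (toTarget k H h)

/-- `ε_t(h₁) h₂ = h` -/
theorem targetMap_mul_comul (h : H) :
    LinearMap.mul' k H ((targetMap k H).rTensor H (comul h)) = h := by
  -- With `s` in place of Δ(1) and `t` in place of Δ(h) the claim is bilinear, so pure tensors
  -- suffice. Afterwards Δ(1) Δ(h) = Δ(h).
  have h1 : ∀ s t : H ⊗[k] H, LinearMap.mul' k H
      (((TensorProduct.lid k H).toLinearMap ∘ₗ (counit (R := k) (A := H)).rTensor H ∘ₗ
        LinearMap.mulLeft k s ∘ₗ (TensorProduct.mk k H H).flip 1).rTensor H t)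
      = TensorProduct.lid k H ((counit (R := k) (A := H)).rTensor H (s * t)) := fun s t => by
    induction t using TensorProduct.induction_on with
    | zero => simp
    | add t t' ht ht' => simp only [map_add, mul_add, ht, ht']
    | tmul c d =>
      induction s using TensorProduct.induction_on with
      | zero => simp
      | add s s' hs hs' =>
        simp only [add_mul, map_add, ← hs, ← hs']
        simp [add_mul]
      | tmul a b => simp
  refine (h1 _ _).trans ?_
  rw [comul_one_mul, Coalgebra.rTensor_counit_comul]
  simp

/-- `ε(f g h) = ε(f g₁) ε(g₂ h)` -/
theorem Repr.counit_mul {ι : Type*} {g : H} (r : Coalgebra.Repr k g ι) (f h : H) :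
    counit (R := k) (f * g * h) = ∑ i ∈ r.index,
      counit (R := k) (f * r.left i) * counit (R := k) (r.right i * h) := by
  rw [WeakHopfAlgebra.counit_mul, Repr.map_comul r]; simp

/-- `ε_t(h₁) ε(h₂ g) = ε_t(h g)` -/
theorem targetMap_counit_mul (h g : H) : TensorProduct.rid k H
    (TensorProduct.map (targetMap k H) (counit ∘ₗ LinearMap.mulRight k g) (comul h))
      = targetMap k H (h * g) := by
  -- Both sides are expanded along the second legs of Δ(1); the coefficients agree by ε(1₁ h g) =
  -- ε(1₁ h₁) ε(h₂ g).
  rw [Repr.map_comul (ℛ k h), Repr.targetMap_eq (ℛ k (1 : H)) (h * g)]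
  simp only [Repr.targetMap_eq (ℛ k (1 : H)), map_sum, ← mul_assoc, Repr.counit_mul (ℛ k h),
    Finset.sum_smul]
  rw [Finset.sum_comm]
  simp [TensorProduct.sum_tmul, smul_smul, mul_comm]

variable (k H) in
/-- The source map `ε_s(h) = 1₁ ε(h 1₂)`. -/
def sourceMap : H →ₗ[k] H :=
  (TensorProduct.rid k H).toLinearMap ∘ₗ (counit : H →ₗ[k] k).lTensor H ∘ₗ
    LinearMap.mulRight k (comul (R := k) (1 : H)) ∘ₗ TensorProduct.mk k H H 1

theorem sourceMap_apply (h : H) : sourceMap k H h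
    = TensorProduct.rid k H ((counit : H →ₗ[k] k).lTensor H ((1 ⊗ₜ[k] h) * comul 1)) := rfl

theorem Repr.sourceMap_eq {ι : Type*} (r : Coalgebra.Repr k (1 : H) ι) (h : H) :
    sourceMap k H h = ∑ i ∈ r.index, counit (R := k) (h * r.right i) • r.left i := by
  rw [sourceMap_apply, ← r.eq]; simp [Finset.mul_sum]

/-- `h₁ ⊗ ε_t(h₂) = 1₁ h ⊗ 1₂` -/
theorem lTensor_targetMap_comul (h : H) :
    (targetMap k H).lTensor H (comul h) = comul (1 : H) * (h ⊗ₜ[k] 1) := by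
  -- `E` undoes Δ ⊗ id. Applying Δ ⊗ id to 1₁ h ⊗ 1₂ gives (1 ⊗ Δ(1))(Δ(1) ⊗ 1)(Δ(h) ⊗ 1); the
  -- middle factor is absorbed by Δ(h), and `E` then leaves h₁ ⊗ ε(1₁ h₂) 1₂.
  let E : (H ⊗[k] H) ⊗[k] H →ₗ[k] H ⊗[k] H :=
    ((TensorProduct.rid k H).toLinearMap ∘ₗ (counit (R := k) (A := H)).lTensor H).rTensor H
  have h1 : ∀ t : H ⊗[k] H, E ((comul (R := k) (A := H)).rTensor H t) = t := fun t => by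
    induction t using TensorProduct.induction_on with
    | zero => simp
    | add s t hs ht => simp only [map_add, hs, ht]
    | tmul g h => simp [E]
  have h2 : ∀ s t : H ⊗[k] H,
      E ((TensorProduct.assoc k H H H).symm (1 ⊗ₜ s) * (t ⊗ₜ[k] (1 : H)))
      = ((TensorProduct.lid k H).toLinearMap ∘ₗ (counit (R := k) (A := H)).rTensor H ∘ₗ
        LinearMap.mulLeft k s ∘ₗ (TensorProduct.mk k H H).flip 1).lTensor H t := fun s t => by
    induction t using TensorProduct.induction_on with
    | zero => simp
    | add t t' ht ht' => simp only [TensorProduct.add_tmul, map_add, mul_add, ht, ht']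
    | tmul c d =>
      induction s using TensorProduct.induction_on with
      | zero => simp
      | add s s' hs hs' =>
        simp only [TensorProduct.tmul_add, map_add, add_mul, hs, hs']
        simp [add_mul, TensorProduct.tmul_add]
      | tmul a b => simp [E, TensorProduct.smul_tmul']
  have h3 : ∀ t : H ⊗[k] H, (comul (R := k) (A := H)).rTensor H (t * (h ⊗ₜ[k] 1))
      = (comul (R := k) (A := H)).rTensor H t * (comul h ⊗ₜ[k] 1) := fun t => by
    induction t using TensorProduct.induction_on with
    | zero => simp
    | add s t hs ht => simp only [map_add, add_mul, hs, ht]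
    | tmul a b => simp [comul_mul]
  rw [← h1 (comul (1 : H) * (h ⊗ₜ[k] 1)), h3, comul_one_right, mul_assoc,
    Algebra.TensorProduct.tmul_mul_tmul, comul_one_mul, mul_one, h2]
  rfl

/-- `ε_s(h₁) ⊗ h₂ = 1₁ ⊗ h 1₂` -/
theorem rTensor_sourceMap_comul (h : H) :
    (sourceMap k H).rTensor H (comul h) = (1 ⊗ₜ[k] h) * comul (1 : H) := by
  -- The mirror image of the argument for ε_t: `E` undoes id ⊗ Δ, and 1 ⊗ Δ(h) absorbs the factor 1
  -- ⊗ Δ(1).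
  let E : H ⊗[k] (H ⊗[k] H) →ₗ[k] H ⊗[k] H :=
    ((TensorProduct.lid k H).toLinearMap ∘ₗ (counit (R := k) (A := H)).rTensor H).lTensor H
  have h1 : ∀ t : H ⊗[k] H, E ((comul (R := k) (A := H)).lTensor H t) = t := fun t => by
    induction t using TensorProduct.induction_on with
    | zero => simp
    | add s t hs ht => simp only [map_add, hs, ht]
    | tmul g h => simp [E]
  have h2 : ∀ s t : H ⊗[k] H,
      E ((1 ⊗ₜ t) * TensorProduct.assoc k H H H (s ⊗ₜ[k] (1 : H)))
      = ((TensorProduct.rid k H).toLinearMap ∘ₗ (counit (R := k) (A := H)).lTensor H ∘ₗ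
        LinearMap.mulRight k s ∘ₗ TensorProduct.mk k H H 1).rTensor H t := fun s t => by
    induction t using TensorProduct.induction_on with
    | zero => simp
    | add t t' ht ht' => simp only [TensorProduct.tmul_add, map_add, add_mul, ht, ht']
    | tmul c d =>
      induction s using TensorProduct.induction_on with
      | zero => simp
      | add s s' hs hs' =>
        simp only [TensorProduct.add_tmul, map_add, mul_add, hs, hs']
        simp [mul_add, TensorProduct.add_tmul]
      | tmul a b => simp [E, TensorProduct.smul_tmul']
  have h3 : ∀ t : H ⊗[k] H, (comul (R := k) (A := H)).lTensor H ((1 ⊗ₜ[k] h) * t)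
      = (1 ⊗ₜ[k] comul h) * (comul (R := k) (A := H)).lTensor H t := fun t => by
    induction t using TensorProduct.induction_on with
    | zero => simp
    | add s t hs ht => simp only [map_add, mul_add, hs, ht]
    | tmul a b => simp [comul_mul]
  have h4 : ∀ s t : (H ⊗[k] H) ⊗[k] H, TensorProduct.assoc k H H H (s * t)
      = TensorProduct.assoc k H H H s * TensorProduct.assoc k H H H t :=
    map_mul (Algebra.TensorProduct.assoc k k k H H H)
  rw [← h1 ((1 ⊗ₜ[k] h) * comul (1 : H)), h3, coassoc_one, comul_one_right, h4,
    LinearEquiv.apply_symm_apply, ← mul_assoc,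
    Algebra.TensorProduct.tmul_mul_tmul, mul_comul_one, mul_one, h2]
  rfl

/-- `Δ(ε_s(h)) = (1 ⊗ ε_s(h)) Δ(1)` -/
theorem comul_sourceMap (h : H) : comul (R := k) (sourceMap k H h)
    = (1 ⊗ₜ[k] sourceMap k H h) * comul (1 : H) := by
  have h0 : ∀ t : H ⊗[k] H, TensorProduct.rid k H ((counit : H →ₗ[k] k).lTensor H
      ((1 ⊗ₜ[k] h) * t)) = TensorProduct.rid k H
      ((counit ∘ₗ LinearMap.mulLeft k h).lTensor H t) := fun t => by
    induction t using TensorProduct.induction_on with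
    | zero => simp
    | add s t hs ht => simp only [map_add, mul_add, hs, ht]
    | tmul a b => simp
  have h1 : ∀ (φ : H →ₗ[k] k) (t : H ⊗[k] H), comul (R := k)
      (TensorProduct.rid k H (φ.lTensor H t))
      = TensorProduct.rid k _ (φ.lTensor _ ((comul (R := k) (A := H)).rTensor H t)) :=
    fun φ t => by
    induction t using TensorProduct.induction_on with
    | zero => simp
    | tmul g h => simp
    | add s t hs ht => simp only [map_add, hs, ht]
  have h2 : ∀ (φ : H →ₗ[k] k) (s t : H ⊗[k] H), TensorProduct.rid k _ (φ.lTensor _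
      ((TensorProduct.assoc k H H H).symm (1 ⊗ₜ t) * (s ⊗ₜ[k] (1 : H))))
      = (1 ⊗ₜ TensorProduct.rid k H (φ.lTensor H t)) * s := fun φ s t => by
    induction s using TensorProduct.induction_on with
    | zero => simp
    | add s s' hs hs' => simp only [TensorProduct.add_tmul, map_add, mul_add, hs, hs']
    | tmul a b =>
      induction t using TensorProduct.induction_on with
      | zero => simp
      | add t t' ht ht' => simp only [TensorProduct.tmul_add, map_add, add_mul, ht, ht']
      | tmul c d => simp
  -- The functional ε(h ·) sits on the last leg of 1₁ ⊗ 1'₁ 1₂ ⊗ 1'₂ and so contracts only the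
  -- second copy of Δ(1), to ε_s(h).
  rw [sourceMap_apply, h0, h1, comul_one_right, h2]

/-- `ε_s(h₁) ⊗ ε_t(h₂) = ε_s(h₂) ⊗ ε_t(h₁)` -/
theorem map_sourceMap_targetMap_comm (h : H) :
    TensorProduct.map (sourceMap k H) (targetMap k H)
      (TensorProduct.comm k H H (comul (R := k) h))
      = TensorProduct.map (sourceMap k H) (targetMap k H) (comul (R := k) h) := by
  have h1 : TensorProduct.map (sourceMap k H) (targetMap k H) (comul (R := k) h)
      = ∑ i ∈ (ℛ k (1 : H)).index, (ℛ k (1 : H)).left i ⊗ₜ[k]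
        targetMap k H (h * (ℛ k (1 : H)).right i) := by
    rw [← LinearMap.lTensor_comp_rTensor, LinearMap.comp_apply, rTensor_sourceMap_comul,
      ← (ℛ k (1 : H)).eq]
    simp [Finset.mul_sum]
  have h2 : TensorProduct.map (sourceMap k H) (targetMap k H)
      (TensorProduct.comm k H H (comul (R := k) h))
      = ∑ i ∈ (ℛ k h).index, sourceMap k H ((ℛ k h).right i) ⊗ₜ[k]
        targetMap k H ((ℛ k h).left i) := by
    conv_lhs => rw [← (ℛ k h).eq]
    simp
  -- Both sides are combinations of the tensors 1₁ ⊗ 1'₂ for two copies of Δ(1). The coefficients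
  -- are ε(1'₁ h₁) ε(h₂ 1₂) and ε(1'₁ h 1₂), equal by weak multiplicativity of ε.
  rw [h1, h2]
  simp only [Repr.targetMap_eq (ℛ k (1 : H)), Repr.sourceMap_eq (ℛ k (1 : H)),
    ← mul_assoc, Repr.counit_mul (ℛ k h), TensorProduct.tmul_sum,
    TensorProduct.sum_tmul, Finset.sum_smul, TensorProduct.tmul_smul, TensorProduct.smul_tmul',
    Finset.smul_sum, smul_smul]
  conv_lhs => enter [2, i]; rw [Finset.sum_comm]
  rw [Finset.sum_comm]
  refine Finset.sum_congr rfl fun j _ => ?_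
  rw [Finset.sum_comm]

/-! The antipode is computed in the convolution algebra of maps `H → H ⊗ H`. -/

open WithConv

variable (k H) in
/-- The convolution algebra of linear maps `H → H ⊗ H`. -/
abbrev ConvAlg := WithConv (H →ₗ[k] H ⊗[k] H)

/-- The map `h ↦ f(h) ⊗ 1`. -/
def convL (f : H →ₗ[k] H) : ConvAlg k H :=
  toConv ((Algebra.TensorProduct.includeLeft : H →ₐ[k] H ⊗[k] H).toLinearMap ∘ₗ f)

/-- The map `h ↦ 1 ⊗ f(h)`. -/
def convR (f : H →ₗ[k] H) : ConvAlg k H :=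
  toConv ((Algebra.TensorProduct.includeRight : H →ₐ[k] H ⊗[k] H).toLinearMap ∘ₗ f)

theorem convL_mul (f g : H →ₗ[k] H) :
    convL f * convL g = convL (toConv f * toConv g).ofConv :=
  congrArg toConv (LinearMap.algHom_comp_convMul_distrib
    (Algebra.TensorProduct.includeLeft : H →ₐ[k] H ⊗[k] H) (toConv f) (toConv g)).symm

theorem convR_mul (f g : H →ₗ[k] H) :
    convR f * convR g = convR (toConv f * toConv g).ofConv :=
  congrArg toConv (LinearMap.algHom_comp_convMul_distrib
    (Algebra.TensorProduct.includeRight : H →ₐ[k] H ⊗[k] H) (toConv f) (toConv g)).symm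

theorem convL_mul_convR (f g : H →ₗ[k] H) :
    convL f * convR g = toConv (TensorProduct.map f g ∘ₗ comul) := by
  refine congrArg toConv (LinearMap.ext fun h => ?_)
  simp only [LinearMap.comp_apply]
  generalize comul (R := k) h = t
  induction t using TensorProduct.induction_on with
  | zero => simp
  | add s t hs ht => simp only [map_add, hs, ht]
  | tmul a b => simp [convL, convR]

/-- The values f(a) ⊗ 1 and 1 ⊗ g(b) commute in H ⊗ H, but convolution hands out the legs of Δ(h) in
order, so the reversed product acquires a flip. -/
theorem convR_mul_convL (f g : H →ₗ[k] H) : convR f * convL g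
    = toConv (TensorProduct.map g f ∘ₗ (TensorProduct.comm k H H).toLinearMap ∘ₗ comul) := by
  refine congrArg toConv (LinearMap.ext fun h => ?_)
  simp only [LinearMap.comp_apply]
  generalize comul (R := k) h = t
  induction t using TensorProduct.induction_on with
  | zero => simp
  | add s t hs ht => simp only [map_add, hs, ht]
  | tmul a b => simp [convL, convR]

/-- Multiplicativity of Δ suffices for f ↦ Δ ∘ f to respect convolution; Δ need not preserve the
unit. -/
theorem conv_comul_mul (f g : H →ₗ[k] H) :
    (toConv (comul ∘ₗ f) * toConv (comul ∘ₗ g) : ConvAlg k H)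
      = toConv (comul ∘ₗ (toConv f * toConv g).ofConv) := by
  refine congrArg toConv (LinearMap.ext fun h => ?_)
  simp only [LinearMap.comp_apply, LinearMap.convMul_def]
  generalize comul (R := k) h = t
  induction t using TensorProduct.induction_on with
  | zero => simp
  | add s t hs ht => simp only [map_add, hs, ht]
  | tmul a b => simp [comul_mul]

/-- `h₁ S(h₂) = ε_t(h)` -/
theorem id_conv_antipode :
    (toConv LinearMap.id * toConv (antipode (k := k)) : WithConv (H →ₗ[k] H))
      = toConv (targetMap k H) :=
  congrArg toConv (LinearMap.ext fun h => (mul_antipode (k := k) h).trans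
    (targetMap_apply h).symm)

/-- `S(h₁) h₂ = ε_s(h)` -/
theorem antipode_conv_id :
    (toConv (antipode (k := k)) * toConv LinearMap.id : WithConv (H →ₗ[k] H))
      = toConv (sourceMap k H) :=
  congrArg toConv (LinearMap.ext fun h => (antipode_mul (k := k) h).trans
    (sourceMap_apply h).symm)

/-- `ε_s(h₁) S(h₂) = S(h)` -/
theorem sourceMap_conv_antipode :
    (toConv (sourceMap k H) * toConv (antipode (k := k)) : WithConv (H →ₗ[k] H))
      = toConv (antipode (k := k)) := by
  rw [← antipode_conv_id]
  refine congrArg toConv (LinearMap.ext fun h => ?_)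
  refine Eq.trans ?_ (antipode_mul_antipode (k := k) h)
  simp only [LinearMap.comp_apply]
  generalize comul (R := k) h = t
  induction t using TensorProduct.induction_on with
  | zero => simp
  | add s t hs ht => simp only [map_add, hs, ht]
  | tmul a b => simp [LinearMap.convMul_def, LinearMap.rTensor]

/-- `S(h₁) ε_t(h₂) = S(h)` -/
theorem antipode_conv_targetMap :
    (toConv (antipode (k := k)) * toConv (targetMap k H) : WithConv (H →ₗ[k] H))
      = toConv (antipode (k := k)) := by
  rw [← id_conv_antipode, ← mul_assoc, antipode_conv_id, sourceMap_conv_antipode]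

/-- `Δ(ε_t(h)) = h₁ S(h₃) ⊗ ε_t(h₂)` -/
theorem conv_comul_targetMap : (toConv (comul ∘ₗ targetMap k H) : ConvAlg k H)
    = convL LinearMap.id * convR (targetMap k H) * convL antipode := by
  rw [convL_mul_convR]
  refine congrArg toConv (LinearMap.ext fun h => ?_)
  have h1 : targetMap k H h = LinearMap.mul' k H
      (TensorProduct.map LinearMap.id antipode (comul (R := k) h)) :=
    (LinearMap.congr_fun (congrArg ofConv (id_conv_antipode (k := k) (H := H))) h).symm
  -- Δ(ε_t(h)) = Δ(1)(ε_t(h) ⊗ 1) with ε_t(h) = h₁ S(h₂). The factor Δ(1)(h₁ ⊗ 1) is then an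
  -- instance of `lTensor_targetMap_comul`.
  rw [LinearMap.comp_apply, comul_targetMap, h1]
  simp only [LinearMap.comp_apply]
  generalize comul (R := k) h = t
  induction t using TensorProduct.induction_on with
  | zero => simp
  | add s t hs ht => simp only [map_add, TensorProduct.add_tmul, mul_add, hs, ht]
  | tmul a b =>
    have h2 : TensorProduct.map LinearMap.id (targetMap k H) (comul (R := k) a)
      = comul (R := k) (1 : H) * (a ⊗ₜ[k] 1) := lTensor_targetMap_comul a
    simp [h2, convL, mul_assoc]

/-- `Δ(ε_s(h)) = ε_s(h₂) ⊗ S(h₁) h₃` -/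
theorem conv_comul_sourceMap : (toConv (comul ∘ₗ sourceMap k H) : ConvAlg k H)
    = convR antipode * (convL (sourceMap k H) * convR LinearMap.id) := by
  rw [convL_mul_convR]
  refine congrArg toConv (LinearMap.ext fun h => ?_)
  have h1 : sourceMap k H h = LinearMap.mul' k H
      (TensorProduct.map antipode LinearMap.id (comul (R := k) h)) :=
    (LinearMap.congr_fun (congrArg ofConv (antipode_conv_id (k := k) (H := H))) h).symm
  rw [LinearMap.comp_apply, comul_sourceMap, h1]
  simp only [LinearMap.comp_apply]
  generalize comul (R := k) h = t
  induction t using TensorProduct.induction_on with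
  | zero => simp
  | add s t hs ht => simp only [map_add, TensorProduct.tmul_add, add_mul, hs, ht]
  | tmul a b =>
    have h2 : TensorProduct.map (sourceMap k H) LinearMap.id (comul (R := k) b)
      = (1 ⊗ₜ[k] b) * comul (R := k) (1 : H) := rTensor_sourceMap_comul b
    simp [h2, convR, ← mul_assoc]

/-- In a Hopf algebra both sides are convolution inverses of Δ. Here S is only a generalised inverse
of the identity, with S * id = ε_s, id * S = ε_t, ε_s * S = S and S * ε_t = S. Writing L and R for
`convL` and `convR`, so that Δ = L(id) R(id), the replacement for uniqueness of inverses is the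
chain Δ∘S = (Δ∘ε_s)(Δ∘S) = R(S) L(S) Δ (Δ∘S) = R(S) L(S) (Δ∘ε_t) = R(S) L(ε_s) R(ε_t) L(S), after
which L(ε_s) and R(ε_t) are exchanged and absorbed. -/
theorem conv_comul_antipode : (toConv (comul ∘ₗ antipode) : ConvAlg k H)
    = convR antipode * convL antipode := by
  have hΔ : (toConv (comul ∘ₗ LinearMap.id) : ConvAlg k H)
      = convL LinearMap.id * convR LinearMap.id := by
    rw [convL_mul_convR, TensorProduct.map_id]; rfl
  -- The one place where a left and a right factor change order; cocommutativity is not available,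
  -- and only the pair ε_s, ε_t allows it.
  have hcomm : convR (targetMap k H) * convL (sourceMap k H)
      = convL (sourceMap k H) * convR (targetMap k H) := by
    rw [convL_mul_convR, convR_mul_convL]
    exact congrArg toConv (LinearMap.ext map_sourceMap_targetMap_comm)
  have h1 := conv_comul_mul (k := k) (H := H) antipode LinearMap.id
  have h2 := conv_comul_mul (k := k) (H := H) LinearMap.id antipode
  have h3 := conv_comul_mul (k := k) (H := H) (sourceMap k H) antipode
  rw [antipode_conv_id, ofConv_toConv, conv_comul_sourceMap] at h1
  rw [id_conv_antipode, ofConv_toConv, conv_comul_targetMap] at h2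
  rw [sourceMap_conv_antipode, ofConv_toConv, conv_comul_sourceMap] at h3
  have hL : convL (antipode (k := k) (H := H)) * convL LinearMap.id = convL (sourceMap k H) := by
    rw [convL_mul, antipode_conv_id]
  have hR : convR (LinearMap.id (R := k) (M := H)) * convR antipode = convR (targetMap k H) := by
    rw [convR_mul, id_conv_antipode]
  have hR' : convR (antipode (k := k) (H := H)) * convR (targetMap k H) = convR antipode := by
    rw [convR_mul, antipode_conv_targetMap]
  have hL' : convL (sourceMap k H) * convL (antipode (k := k) (H := H)) = convL antipode := by
    rw [convL_mul, sourceMap_conv_antipode]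
  calc (toConv (comul ∘ₗ antipode) : ConvAlg k H)
      = convR antipode * convL antipode *
        (toConv (comul ∘ₗ LinearMap.id) * toConv (comul ∘ₗ antipode)) := by
        conv_lhs => rw [← h3, ← hL]
        rw [hΔ]; simp only [mul_assoc]
    _ = convR antipode * (convL antipode * convL LinearMap.id) * convR (targetMap k H)
          * convL antipode := by rw [h2]; simp only [mul_assoc]
    _ = convR antipode * (convL (sourceMap k H) * convR (targetMap k H)) * convL antipode := by
        rw [hL]; simp only [mul_assoc]
    _ = (convR antipode * convR (targetMap k H)) * (convL (sourceMap k H) * convL antipode) := by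
        rw [← hcomm]; simp only [mul_assoc]
    _ = _ := by rw [hR', hL']

/-- `Δ(S(h)) = S(h₂) ⊗ S(h₁)` -/
theorem comul_antipode (h : H) : comul (R := k) (antipode (k := k) h)
    = TensorProduct.map antipode antipode (TensorProduct.comm k H H (comul h)) := by
  have h1 := conv_comul_antipode (k := k) (H := H)
  rw [convR_mul_convL] at h1
  exact LinearMap.congr_fun (congrArg ofConv h1) h

/-- `ε(z S(h)) = ε(h z)` for `z ∈ H^t` -/
theorem counit_coe_mul_antipode (z : targetSubalgebra k H) (h : H) :
    counit (R := k) ((z : H) * antipode (k := k) h) = counit (R := k) (h * (z : H)) := by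
  -- Write S(h) = S(h₁) ε_t(h₂). Under ε the factor ε_t(h₂) may be replaced by h₂, and S(h₁) h₂ =
  -- ε_s(h).
  have h1 : counit (R := k) ((z : H) * antipode (k := k) h)
      = counit (R := k) ((z : H) * sourceMap k H h) := by
    have e1 := LinearMap.congr_fun (congrArg ofConv (antipode_conv_targetMap (k := k) (H := H))) h
    have e2 := LinearMap.congr_fun (congrArg ofConv (antipode_conv_id (k := k) (H := H))) h
    simp only [LinearMap.convMul_def, ofConv_toConv, LinearMap.comp_apply] at e1 e2
    rw [← e1, ← e2]
    generalize comul (R := k) h = t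
    induction t using TensorProduct.induction_on with
    | zero => simp
    | add s t hs ht => simp only [map_add, mul_add, hs, ht]
    | tmul a b => simp [← mul_assoc, counit_mul_targetMap]
  have h2 := counit_coe_mul (k := k) z 1
  -- Both z = ε(z 1₁) 1₂ and ε_s(h) = 1₁ ε(h 1₂) come from Δ(1), so both sides of the claim equal
  -- ε(z 1₁) ε(h 1₂).
  rw [LinearMap.mulLeft_apply, mul_one, ← (ℛ k (1 : H)).eq] at h2
  rw [h1, Repr.sourceMap_eq (ℛ k (1 : H))]
  conv_rhs => rw [← h2]
  simp [Finset.mul_sum, mul_comm]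

/-- `ε(S(h)) = ε(h)` -/
theorem counit_antipode (h : H) : counit (R := k) (antipode (k := k) h) = counit (R := k) h := by
  simpa using counit_coe_mul_antipode (k := k) 1 h

end weakHopf
end BasedAct

/-! ### The separability idempotent of the target algebra -/

namespace BasedAct

section separability

open Coalgebra WeakHopfAlgebra CoRep

variable {k H : Type u} [Field k] [Ring H] [Algebra k H] [WeakHopfAlgebra k H]

variable (k H) in
/-- The separability idempotent `ε_t(1₁) ⊗ ε_t(1₂)` of the target algebra. -/
def separability : targetSubalgebra k H ⊗[k] targetSubalgebra k H :=
  TensorProduct.map (toTarget k H) (toTarget k H) (comul (R := k) (1 : H))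

theorem mul_separability : LinearMap.mul' k (targetSubalgebra k H) (separability k H) = 1 :=
  mul_toTarget_comul_one

/-- The second leg of Δ(1) lies in H^t, where ε_t is the identity. -/
theorem map_comp_targetMap_comul_one {P Q : Type*} [AddCommGroup P] [Module k P]
    [AddCommGroup Q] [Module k Q] (f : H →ₗ[k] P) (g : H →ₗ[k] Q) :
    TensorProduct.map f (g ∘ₗ targetMap k H) (comul (R := k) (1 : H))
      = TensorProduct.map f g (comul (1 : H)) := by
  conv_rhs => rw [← lTensor_targetMap_comul_one, ← LinearMap.comp_apply,
    LinearMap.map_comp_lTensor]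

/-- Apply ε ⊗ id to Δ(z) = (z ⊗ 1) Δ(1). The second legs of Δ(1) thus span H^t with explicit
coefficient functionals, and serve as a substitute for a pair of dual bases. -/
theorem coe_eq_sum {ι : Type*} (r : Coalgebra.Repr k (1 : H) ι) (z : targetSubalgebra k H) :
    (z : H) = ∑ i ∈ r.index, counit (R := k) ((z : H) * r.left i) • r.right i := by
  have h := counit_coe_mul (k := k) z 1
  rw [LinearMap.mulLeft_apply, mul_one, ← r.eq] at h
  conv_lhs => rw [← h]
  simp

theorem map_sum_right {ι P Q R S : Type*} [AddCommGroup P] [Module k P] [AddCommGroup Q]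
    [Module k Q] [AddCommGroup R] [Module k R] [AddCommGroup S] [Module k S] (s : Finset ι)
    (f : P →ₗ[k] Q) (g : ι → R →ₗ[k] S) :
    TensorProduct.map f (∑ i ∈ s, g i) = ∑ i ∈ s, TensorProduct.map f (g i) :=
  map_sum (TensorProduct.mapBilinear (RingHom.id k) P R Q S f) g s

/-- Expand ε_t(1₂) z along the second legs of another copy of Δ(1), with coefficients ε(1₂ z 1'₁).
Then ε_t(1₁) ε(1₂ g) = ε_t(g) for g = z 1'₁ produces the left side. -/
theorem coe_mul_separability (z : targetSubalgebra k H) :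
    TensorProduct.map (targetMap k H ∘ₗ LinearMap.mulLeft k (z : H)) LinearMap.id
        (comul (R := k) (1 : H))
      = TensorProduct.map (targetMap k H) (LinearMap.mulRight k (z : H) ∘ₗ targetMap k H)
        (comul (R := k) (1 : H)) := by
  have h1 : LinearMap.mulRight k (z : H) ∘ₗ targetMap k H
      = ∑ i ∈ (ℛ k (1 : H)).index, LinearMap.toSpanSingleton k H ((ℛ k (1 : H)).right i) ∘ₗ
        (counit ∘ₗ LinearMap.mulRight k ((z : H) * (ℛ k (1 : H)).left i)) ∘ₗ targetMap k H := by
    ext h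
    refine (coe_eq_sum (ℛ k (1 : H)) (toTarget k H h * z)).trans ?_
    simp [mul_assoc]
  have h2 : ∀ (φ : H →ₗ[k] k) (y : H), TensorProduct.map (targetMap k H)
      (LinearMap.toSpanSingleton k H y ∘ₗ φ) (comul (R := k) (1 : H))
      = TensorProduct.rid k H (TensorProduct.map (targetMap k H) φ (comul (R := k) (1 : H)))
        ⊗ₜ[k] y := fun φ y => by
    rw [Repr.map_comul (ℛ k (1 : H)), Repr.map_comul (ℛ k (1 : H))]
    simp [TensorProduct.sum_tmul, TensorProduct.smul_tmul']
  rw [h1, map_sum_right, LinearMap.sum_apply, Repr.map_comul (ℛ k (1 : H))]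
  refine Finset.sum_congr rfl fun i _ => ?_
  rw [← LinearMap.comp_assoc, map_comp_targetMap_comul_one, h2, targetMap_counit_mul, one_mul]
  rfl

theorem map_val_injective : Function.Injective (TensorProduct.map
    (targetSubalgebra k H).val.toLinearMap (targetSubalgebra k H).val.toLinearMap) := by
  have hv : Function.Injective (targetSubalgebra k H).val.toLinearMap := Subtype.val_injective
  rw [← LinearMap.lTensor_comp_rTensor]
  exact (Module.Flat.lTensor_preserves_injective_linearMap (M := H) _ hv).comp
    (Module.Flat.rTensor_preserves_injective_linearMap (M := targetSubalgebra k H) _ hv)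

theorem map_toTarget (f g : targetSubalgebra k H →ₗ[k] targetSubalgebra k H) (f' g' : H →ₗ[k] H)
    (hf : ∀ h, (f (toTarget k H h) : H) = f' h) (hg : ∀ h, (g (toTarget k H h) : H) = g' h)
    (t : H ⊗[k] H) : TensorProduct.map
      (targetSubalgebra k H).val.toLinearMap (targetSubalgebra k H).val.toLinearMap
      (TensorProduct.map f g (TensorProduct.map (toTarget k H) (toTarget k H) t))
      = TensorProduct.map f' g' t := by
  induction t using TensorProduct.induction_on with
  | zero => simp
  | add s t hs ht => simp only [map_add, hs, ht]
  | tmul a b =>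
    simp only [TensorProduct.map_tmul]
    exact congrArg₂ (· ⊗ₜ[k] ·) (hf a) (hg b)

/-- `z e₁ ⊗ e₂ = e₁ ⊗ e₂ z` -/
theorem map_mulLeft_separability (z : targetSubalgebra k H) :
    TensorProduct.map (LinearMap.mulLeft k z) LinearMap.id (separability k H)
      = TensorProduct.map LinearMap.id (LinearMap.mulRight k z) (separability k H) := by
  -- The identity is compared inside H ⊗ H, where it becomes `coe_mul_separability`.
  apply map_val_injective
  refine (map_toTarget (LinearMap.mulLeft k z) LinearMap.id
      (targetMap k H ∘ₗ LinearMap.mulLeft k (z : H)) (targetMap k H)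
      (fun h => (targetMap_coe_mul z h).symm) (fun h => rfl) _).trans ?_
  refine Eq.trans ?_ (map_toTarget LinearMap.id (LinearMap.mulRight k z) (targetMap k H)
      (LinearMap.mulRight k (z : H) ∘ₗ targetMap k H) (fun h => rfl) (fun h => rfl) _).symm
  rw [← coe_mul_separability]
  have h := map_comp_targetMap_comul_one (k := k) (targetMap k H ∘ₗ LinearMap.mulLeft k (z : H))
    LinearMap.id
  rwa [LinearMap.id_comp] at h

end separability

/-! ### Duals of comodules -/

namespace CoRep

open Coalgebra WeakHopfAlgebra

variable {k H : Type u} [Field k] [Ring H] [Algebra k H] [WeakHopfAlgebra k H]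

/-- Coassociativity in computational form: a linear expression in x₋₂ ⊗ (x₋₁ ⊗ x₀) is obtained by
splitting x₋₁ with Δ. The comodule then enters only as a generic tensor, and what remains is an
identity about Δ(h) for a single h. -/
theorem coact_coassoc (X : CoRep k H) {P : Type*} [AddCommGroup P] [Module k P]
    (G : H ⊗[k] (H ⊗[k] X.bimod.carrier) →ₗ[k] P) (x : X.bimod.carrier) :
    G (X.coact.lTensor H (X.coact x)) = TensorProduct.lift
      (LinearMap.mk₂ k (fun h y => G (TensorProduct.assoc k H H _ (comul (R := k) h ⊗ₜ y)))
        (fun _ _ _ => by simp [TensorProduct.add_tmul]) (fun _ _ _ => by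
          simp [← TensorProduct.smul_tmul'])
        (fun _ _ _ => by simp [TensorProduct.tmul_add]) (fun _ _ _ => by simp)) (X.coact x) := by
  rw [← X.coassoc]
  generalize X.coact x = t
  induction t using TensorProduct.induction_on with
  | zero => simp
  | add s t hs ht => simp only [map_add, hs, ht]
  | tmul a b => simp

/-- `ε_t(x₋₁) x₀ = x` -/
theorem targetMap_coact (X : CoRep k H) (x : X.bimod.carrier) :
    TensorProduct.lift (X.bimod.lact ∘ₗ toTarget k H) (X.coact x) = x := by
  let G : H ⊗[k] (H ⊗[k] X.bimod.carrier) →ₗ[k] X.bimod.carrier :=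
    TensorProduct.lift (LinearMap.mk₂ k (fun h t => TensorProduct.lid k _
        ((counitL k H (toTarget k H h)).rTensor _ t))
      (fun _ _ _ => by simp [LinearMap.rTensor_add]) (fun _ _ _ => by
        simp [LinearMap.rTensor_smul])
      (fun _ _ _ => by simp) (fun _ _ _ => by simp))
  have h1 : ∀ t, TensorProduct.lift (X.bimod.lact ∘ₗ toTarget k H) t = G (X.coact.lTensor H t) :=
    fun t => by
    induction t using TensorProduct.induction_on with
    | zero => simp
    | add s t hs ht => simp only [map_add, hs, ht]
    | tmul a b =>
      have := X.lact_eq (toTarget k H a) b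
      simpa [G, hit_apply] using this
  rw [h1, coact_coassoc]
  conv_rhs => rw [← X.counit_coact x, hit_apply]
  generalize X.coact x = t
  induction t using TensorProduct.induction_on with
  | zero => simp
  | add s t hs ht => simp only [map_add, hs, ht]
  | tmul a y =>
    -- The left action gives ε_t(x₋₁) x₀ = ε(ε_t(x₋₂) x₋₁) x₀, so only the counit of ε_t(h₁) h₂ = h
    -- is needed.
    have h2 := congrArg (counit (R := k)) (targetMap_mul_comul (k := k) a)
    have h3 : ∀ t : H ⊗[k] H, G (TensorProduct.assoc k H H _ (t ⊗ₜ y))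
        = counit (R := k) (LinearMap.mul' k H ((targetMap k H).rTensor H t)) • y := fun t => by
      induction t using TensorProduct.induction_on with
      | zero => simp
      | add s t hs ht => simp only [map_add, TensorProduct.add_tmul, add_smul, hs, ht]
      | tmul a b => simp [G]
    simp [h3, h2]

/-- `ε_t(x₋₁) f(x₀ z) = ε_t((x z)₋₁) f((x z)₀)` -/
theorem map_targetMap_ract (X : CoRep k H) {P : Type*} [AddCommGroup P] [Module k P]
    (f : X.bimod.carrier →ₗ[k] P) (z : targetSubalgebra k H) (x : X.bimod.carrier) :
    TensorProduct.map (targetMap k H) (f ∘ₗ X.bimod.ract z) (X.coact x)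
      = TensorProduct.map (targetMap k H) f (X.coact (X.bimod.ract z x)) := by
  rw [coact_ract, show X.bimod.ract z = hit X.coact (counitR k H z) from
    LinearMap.ext (X.ract_eq z)]
  rw [← LinearMap.map_comp_lTensor, LinearMap.comp_apply, lTensor_hit,
    ← LinearMap.comp_apply (TensorProduct.map _ _), LinearMap.map_comp_rTensor,
    ← LinearMap.comp_apply (TensorProduct.map _ _) (LinearMap.rTensor _ _),
    LinearMap.map_comp_rTensor]
  congr 2
  ext h
  -- The comodule has dropped out; what is left is ε_t(h₁) ε(h₂ z) = ε_t(h z).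
  refine Eq.trans ?_ (targetMap_counit_mul h (z : H))
  simp only [LinearMap.comp_apply]
  generalize comul (R := k) h = t
  induction t using TensorProduct.induction_on with
  | zero => simp
  | add s t hs ht => simp only [map_add, hs, ht]
  | tmul a b => simp

section dual

variable (k H) in
/-- The map `h ⊗ f ↦ f(x) h`. -/
def evalR {X : Type u} [AddCommGroup X] [Module k X] (x : X) :
    H ⊗[k] Module.Dual k X →ₗ[k] H :=
  (TensorProduct.rid k H).toLinearMap ∘ₗ (Module.Dual.eval k X x).lTensor H

@[simp] theorem evalR_tmul {X : Type u} [AddCommGroup X] [Module k X] (x : X) (h : H)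
    (f : Module.Dual k X) : evalR k H x (h ⊗ₜ f) = f x • h := by simp [evalR]

/-- For finite-dimensional X a functional is recovered from its values on a basis, so an element
with a leg in X^* is recovered from its evaluations. -/
theorem tensor_tensor_dual_ext {X : Type u} [AddCommGroup X] [Module k X]
    [FiniteDimensional k X] {s t : H ⊗[k] (H ⊗[k] Module.Dual k X)}
    (h : ∀ x, (evalR k H x).lTensor H s = (evalR k H x).lTensor H t) : s = t := by
  let b := Module.finBasis k X
  let L : H ⊗[k] Module.Dual k X →ₗ[k] H ⊗[k] Module.Dual k X :=
    ∑ i, (TensorProduct.mk k H (Module.Dual k X)).flip (b.coord i) ∘ₗ evalR k H (b i)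
  have hL : L = LinearMap.id := TensorProduct.ext' fun a f => by
    simp only [L, LinearMap.sum_apply, LinearMap.comp_apply, evalR_tmul, LinearMap.flip_apply,
      TensorProduct.mk_apply, TensorProduct.smul_tmul, ← TensorProduct.tmul_sum,
      b.sum_dual_apply_smul_coord, LinearMap.id_apply]
  have h1 : ∀ t, t = ∑ i, ((TensorProduct.mk k H (Module.Dual k X)).flip (b.coord i)).lTensor H
      ((evalR k H (b i)).lTensor H t) := fun t => by
    conv_lhs => rw [← LinearMap.lTensor_id_apply H _ t, ← hL]
    simp only [L, LinearMap.lTensor, map_sum_right, LinearMap.sum_apply]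
    refine Finset.sum_congr rfl fun i _ => ?_
    rw [← LinearMap.comp_apply, ← TensorProduct.map_comp, LinearMap.id_comp]
  rw [h1 s, h1 t]
  simp only [h]

variable (X : CoRep k H)

/-- The map `f ↦ S(h) f(x)` for `t = h ⊗ x`. -/
noncomputable def antipodeEval {X : Type u} [AddCommGroup X] [Module k X] (t : H ⊗[k] X) :
    Module.Dual k X →ₗ[k] H :=
  (TensorProduct.rid k H).toLinearMap ∘ₗ (LinearMap.lTensorHom H).flip (antipode.rTensor _ t)

theorem antipodeEval_apply {X : Type u} [AddCommGroup X] [Module k X] (t : H ⊗[k] X)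
    (f : Module.Dual k X) :
    antipodeEval t f = TensorProduct.rid k H (TensorProduct.map antipode f t) := by
  rw [← LinearMap.lTensor_comp_rTensor]
  rfl

/-- The coaction on the dual, with `f₋₁ f₀(x) = S(x₋₁) f(x₀)`. -/
noncomputable def dualCoact :
    Module.Dual k X.bimod.carrier →ₗ[k] H ⊗[k] Module.Dual k X.bimod.carrier :=
  ∑ i, (TensorProduct.mk k H _).flip ((Module.finBasis k X.bimod.carrier).coord i) ∘ₗ
    antipodeEval (X.coact (Module.finBasis k X.bimod.carrier i))

/-- The basis chosen in `dualCoact` disappears here. This form is the one used to verify the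
comodule axioms. -/
theorem evalR_dualCoact (f : Module.Dual k X.bimod.carrier) (x : X.bimod.carrier) :
    evalR k H x (dualCoact X f)
      = TensorProduct.rid k H (TensorProduct.map antipode f (X.coact x)) := by
  let b := Module.finBasis k X.bimod.carrier
  conv_rhs => rw [← b.sum_repr x]
  simp only [dualCoact, LinearMap.sum_apply, map_sum, map_smul]
  refine Finset.sum_congr rfl fun i _ => ?_
  rw [← antipodeEval_apply]
  simp [b]

/-- Evaluated at x, both sides are S(x₋₁) ⊗ S(x₋₂) f(x₀). Since S reverses Δ, the dual of a left
comodule is again a left comodule. -/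
theorem dualCoact_coassoc (f : Module.Dual k X.bimod.carrier) :
    TensorProduct.assoc k H H _ ((comul (R := k) (A := H)).rTensor _ (dualCoact X f))
      = (dualCoact X).lTensor H (dualCoact X f) := by
  refine tensor_tensor_dual_ext fun x => ?_
  have h1 : ∀ t, (evalR k H x).lTensor H (TensorProduct.assoc k H H _
      ((comul (R := k) (A := H)).rTensor _ t)) = comul (R := k) (evalR k H x t) := fun t => by
    induction t using TensorProduct.induction_on with
    | zero => simp
    | add s t hs ht => simp only [map_add, hs, ht]
    | tmul a g =>
      simp only [LinearMap.rTensor_tmul, evalR_tmul, map_smul]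
      generalize comul (R := k) a = s
      induction s using TensorProduct.induction_on with
      | zero => simp
      | add s t hs ht => simp only [map_add, TensorProduct.add_tmul, smul_add, hs, ht]
      | tmul a b => simp
  let G : H ⊗[k] (H ⊗[k] X.bimod.carrier) →ₗ[k] H ⊗[k] H :=
    TensorProduct.map antipode antipode ∘ₗ (TensorProduct.comm k H H).toLinearMap ∘ₗ
      ((TensorProduct.rid k H).toLinearMap ∘ₗ f.lTensor H).lTensor H
  have h2 : ∀ t : H ⊗[k] X.bimod.carrier, (antipodeEval t).lTensor H (dualCoact X f)
      = G (X.coact.lTensor H t) := fun t => by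
    induction t using TensorProduct.induction_on with
    | zero => simp [antipodeEval]
    | add s t hs ht =>
      simp only [map_add, ← hs, ← ht]
      simp [antipodeEval, LinearMap.lTensor_add, LinearMap.comp_add]
    | tmul a y =>
      have h3 : ∀ s : H ⊗[k] Module.Dual k X.bimod.carrier,
          (antipodeEval (a ⊗ₜ y)).lTensor H s = evalR k H y s ⊗ₜ[k] antipode (k := k) a :=
        fun s => by
        induction s using TensorProduct.induction_on with
        | zero => simp
        | add s t hs ht => simp only [map_add, TensorProduct.add_tmul, hs, ht]
        | tmul c g => simp [antipodeEval_apply, TensorProduct.smul_tmul]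
      rw [h3, evalR_dualCoact]
      simp only [G, LinearMap.lTensor_tmul, LinearMap.comp_apply]
      generalize X.coact y = s
      induction s using TensorProduct.induction_on with
      | zero => simp
      | add s t hs ht => simp only [map_add, TensorProduct.tmul_add, TensorProduct.add_tmul, hs, ht]
      | tmul c y => simp [TensorProduct.smul_tmul']
  have h4 : evalR k H x ∘ₗ dualCoact X = antipodeEval (X.coact x) :=
    LinearMap.ext fun f => (evalR_dualCoact X f x).trans (antipodeEval_apply _ f).symm
  rw [h1, evalR_dualCoact, ← LinearMap.comp_apply (LinearMap.lTensor _ _),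
    ← LinearMap.lTensor_comp, h4, h2, coact_coassoc]
  generalize X.coact x = t
  induction t using TensorProduct.induction_on with
  | zero => simp
  | add s t hs ht => simp only [map_add, hs, ht]
  | tmul a y =>
    simp only [TensorProduct.map_tmul, TensorProduct.rid_tmul, map_smul, comul_antipode,
      TensorProduct.lift.tmul, LinearMap.mk₂_apply]
    generalize comul (R := k) a = s
    induction s using TensorProduct.induction_on with
    | zero => simp
    | add s t hs ht => simp only [map_add, TensorProduct.add_tmul, smul_add, hs, ht]
    | tmul c d => simp [G]

theorem hit_dualCoact (φ : H →ₗ[k] k) (f : Module.Dual k X.bimod.carrier)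
    (x : X.bimod.carrier) : hit (dualCoact X) φ f x
      = LinearMap.mul' k k (TensorProduct.map (φ ∘ₗ antipode) f (X.coact x)) := by
  have h1 : ∀ t : H ⊗[k] Module.Dual k X.bimod.carrier, TensorProduct.lid k
      (Module.Dual k X.bimod.carrier) (φ.rTensor _ t) x = φ (evalR k H x t) := fun t => by
    induction t using TensorProduct.induction_on with
    | zero => simp
    | add s t hs ht => simp only [map_add, LinearMap.add_apply, hs, ht]
    | tmul a g => simp [mul_comm]
  rw [hit_apply, h1, evalR_dualCoact]
  generalize X.coact x = t
  induction t using TensorProduct.induction_on with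
  | zero => simp
  | add s t hs ht => simp only [map_add, hs, ht]
  | tmul a y => simp [mul_comm]

/-- This is ε ∘ S = ε together with the counit law of X. -/
theorem hit_counit_dualCoact (f : Module.Dual k X.bimod.carrier) :
    hit (dualCoact X) counit f = f := LinearMap.ext fun x => by
  conv_rhs => rw [← X.counit_coact x, hit_apply]
  rw [hit_dualCoact, show (counit : H →ₗ[k] k) ∘ₗ antipode = counit from
    LinearMap.ext counit_antipode]
  generalize X.coact x = t
  induction t using TensorProduct.induction_on with
  | zero => simp
  | add s t hs ht => simp only [map_add, hs, ht]
  | tmul a y => simp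

/-- The dual comodule. -/
noncomputable def dual : CoRep k H :=
  ofComodule (Module.Dual k X.bimod.carrier) (dualCoact X) (dualCoact_coassoc X)
    (hit_counit_dualCoact X)

/-- `(z f)(x) = f(x z)` -/
theorem dual_lact (z : targetSubalgebra k H) (f : Module.Dual k X.bimod.carrier) :
    (dual X).bimod.lact z f = f ∘ₗ X.bimod.ract z := LinearMap.ext fun x => by
  refine (hit_dualCoact X _ f x).trans ?_
  rw [LinearMap.comp_apply, X.ract_eq, hit_apply]
  generalize X.coact x = t
  induction t using TensorProduct.induction_on with
  | zero => simp
  | add s t hs ht => simp only [map_add, hs, ht]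
  | tmul a y => simp [counit_coe_mul_antipode]

end dual
end CoRep
end BasedAct

/-! ### Evaluation, coevaluation and the zigzag identity. -/

namespace BasedAct
namespace CoRep

open Coalgebra WeakHopfAlgebra

section duality

variable {k H : Type u} [Field k] [Ring H] [Algebra k H] [WeakHopfAlgebra k H]
  [FiniteDimensional k H] (X : CoRep k H)

/-- The map `(x, f) ↦ ε_t(x₋₁) f(x₀)`. -/
noncomputable def pairing : X.bimod.carrier →ₗ[k] Module.Dual k X.bimod.carrier →ₗ[k]
    targetSubalgebra k H :=
  LinearMap.mk₂ k (fun x f => TensorProduct.rid k _ (TensorProduct.map (toTarget k H) f (X.coact x)))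
    (fun _ _ _ => by simp) (fun _ _ _ => by simp)
    (fun _ _ _ => by simp [TensorProduct.map_add_right])
    (fun _ _ _ => by simp [TensorProduct.map_smul_right])

theorem coe_pairing (x : X.bimod.carrier) (f : Module.Dual k X.bimod.carrier) :
    (pairing X x f : H) = TensorProduct.rid k H
      (TensorProduct.map (targetMap k H) f (X.coact x)) := by
  change (((TensorProduct.rid k _ (TensorProduct.map (toTarget k H) f (X.coact x))) :
    targetSubalgebra k H) : H) = _
  generalize X.coact x = t
  induction t using TensorProduct.induction_on with
  | zero => simp
  | add s t hs ht => simp only [map_add, ← hs, ← ht, Subalgebra.coe_add]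
  | tmul a y => simp only [TensorProduct.map_tmul, TensorProduct.rid_tmul]; rfl

/-- On X^* the element z acts by precomposition with right multiplication by z, and
`map_targetMap_ract` moves this multiplication inside the coaction. -/
theorem pairing_balanced (x : X.bimod.carrier) (z : targetSubalgebra k H)
    (f : Module.Dual k X.bimod.carrier) :
    pairing X (X.bimod.ract z x) f = pairing X x ((dual X).bimod.lact z f) := by
  apply Subtype.ext
  refine (coe_pairing X _ f).trans (Eq.trans ?_ (coe_pairing X x _).symm)
  rw [dual_lact, ← map_targetMap_ract]

/-- The linear map underlying the evaluation. -/
noncomputable def evalLin : (Bimod.tensor X.bimod (dual X).bimod).carrier →ₗ[k]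
    targetSubalgebra k H :=
  Bimod.lift (M := X.bimod) (N := (dual X).bimod) (pairing X) (pairing_balanced X)

/-- The convolution formula for Δ ∘ ε_t on elements. It isolates a factor S(h₃), which can be
recognised as the coaction of a dual vector. -/
theorem comul_targetMap_eq (h : H) : comul (R := k) (targetMap k H h)
    = LinearMap.mul' k (H ⊗[k] H) (TensorProduct.map
      (TensorProduct.map LinearMap.id (targetMap k H) ∘ₗ comul)
      ((TensorProduct.mk k H H).flip 1 ∘ₗ antipode) (comul h)) := by
  have h1 := conv_comul_targetMap (k := k) (H := H)
  rw [convL_mul_convR] at h1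
  exact LinearMap.congr_fun (congrArg WithConv.ofConv h1) h

theorem lTensor_codiag {A B C : Alg k} (M : Bimod A B) (N : Bimod B C) {P : Type*}
    [AddCommGroup P] [Module k P] (g : (Bimod.tensor M N).carrier →ₗ[k] P)
    (p : H ⊗[k] M.carrier) (q : H ⊗[k] N.carrier) : g.lTensor H (codiag M N p q)
      = TensorProduct.map₂ (LinearMap.mul k H) ((Bimod.tmul M N).compr₂ g) p q := by
  induction p using TensorProduct.induction_on with
  | zero => simp
  | add s t hs ht => simp only [map_add, LinearMap.add_apply, hs, ht]
  | tmul a x =>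
    induction q using TensorProduct.induction_on with
    | zero => simp
    | add s t hs ht => simp only [map_add, hs, ht]
    | tmul b y => simp

/-- The map `x ↦ f(x) h` for `s = h ⊗ f`. -/
noncomputable def evalAt {X : Type u} [AddCommGroup X] [Module k X]
    (s : H ⊗[k] Module.Dual k X) : X →ₗ[k] H where
  toFun x := evalR k H x s
  map_add' _ _ := by simp [evalR, LinearMap.lTensor_add]
  map_smul' _ _ := by simp [evalR, LinearMap.lTensor_smul]

/-- The map `a ⊗ b ⊗ x ↦ f(x) a h ⊗ ε_t(b)` for `s = h ⊗ f`. -/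
noncomputable def mulEval {X : Type u} [AddCommGroup X] [Module k X]
    (s : H ⊗[k] Module.Dual k X) : H ⊗[k] (H ⊗[k] X) →ₗ[k] H ⊗[k] H :=
  TensorProduct.lift ((LinearMap.mul k (H ⊗[k] H)).compl₁₂ ((TensorProduct.mk k H H).flip 1)
    ((TensorProduct.comm k H H).toLinearMap ∘ₗ TensorProduct.map (targetMap k H) (evalAt s)))

theorem mulEval_tmul {X : Type u} [AddCommGroup X] [Module k X]
    (s : H ⊗[k] Module.Dual k X) (a b : H) (x : X) :
    mulEval s (a ⊗ₜ (b ⊗ₜ x)) = (a * evalR k H x s) ⊗ₜ[k] targetMap k H b := by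
  simp only [mulEval, TensorProduct.lift.tmul, LinearMap.compl₁₂_apply, LinearMap.comp_apply,
    TensorProduct.map_tmul, LinearEquiv.coe_coe, TensorProduct.comm_tmul, LinearMap.flip_apply,
    TensorProduct.mk_apply, LinearMap.mul_apply', Algebra.TensorProduct.tmul_mul_tmul, one_mul]
  rfl

/-- Colinearity of the evaluation, viewed in H ⊗ H. By Δ(ε_t(h)) = h₁ S(h₃) ⊗ ε_t(h₂) the left side
is x₋₃ S(x₋₁) f(x₀) ⊗ ε_t(x₋₂). The part S(x₋₁) f(x₀) is f₋₁ f₀(x₀) by definition of the dual, which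
leaves x₋₂ f₋₁ ⊗ ε_t(x₋₁) f₀(x₀), the evaluation of the diagonal coaction. -/
theorem evalLin_coact (x : X.bimod.carrier) (f : Module.Dual k X.bimod.carrier) :
    comul (R := k) (pairing X x f : H)
      = ((targetSubalgebra k H).val.toLinearMap ∘ₗ evalLin X).lTensor H
        (codiag X.bimod (dual X).bimod (X.coact x) (dualCoact X f)) := by
  let c : H →ₗ[k] H ⊗[k] H := TensorProduct.map LinearMap.id (targetMap k H) ∘ₗ comul
  let G : H ⊗[k] (H ⊗[k] X.bimod.carrier) →ₗ[k] H ⊗[k] H :=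
    TensorProduct.lift ((LinearMap.mul k (H ⊗[k] H)).compl₁₂ c
      ((TensorProduct.mk k H H).flip 1 ∘ₗ (TensorProduct.rid k H).toLinearMap ∘ₗ
        TensorProduct.map antipode f))
  have hA : comul (R := k) (pairing X x f : H) = G (X.coact.lTensor H (X.coact x)) := by
    rw [coe_pairing, coact_coassoc]
    generalize X.coact x = t
    induction t using TensorProduct.induction_on with
    | zero => simp
    | add s t hs ht => simp only [map_add, hs, ht]
    | tmul a y =>
      simp only [TensorProduct.map_tmul, TensorProduct.rid_tmul, map_smul, comul_targetMap_eq,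
        TensorProduct.lift.tmul, LinearMap.mk₂_apply]
      generalize comul (R := k) a = s
      induction s using TensorProduct.induction_on with
      | zero => simp
      | add s t hs ht => simp only [map_add, TensorProduct.add_tmul, smul_add, hs, ht]
      | tmul a b => simp [G, c]
  have hB : G (X.coact.lTensor H (X.coact x))
      = mulEval (dualCoact X f) (X.coact.lTensor H (X.coact x)) := by
    rw [coact_coassoc X (mulEval _)]
    generalize X.coact x = t
    induction t using TensorProduct.induction_on with
    | zero => simp
    | add s t hs ht => simp only [map_add, hs, ht]
    | tmul a y =>
      simp only [LinearMap.lTensor_tmul, TensorProduct.lift.tmul, LinearMap.mk₂_apply, G,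
        LinearMap.compl₁₂_apply, LinearMap.comp_apply, LinearEquiv.coe_coe, c,
        ← evalR_dualCoact]
      generalize comul (R := k) a = s
      induction s using TensorProduct.induction_on with
      | zero => simp
      | add s t hs ht =>
        simp only [map_add, TensorProduct.add_tmul, LinearMap.add_apply, hs, ht]
      | tmul a b => simp [mulEval_tmul]
  have hC : ∀ (t : H ⊗[k] X.bimod.carrier) (s : H ⊗[k] Module.Dual k X.bimod.carrier),
      mulEval s (X.coact.lTensor H t) = TensorProduct.map₂ (LinearMap.mul k H)
        ((pairing X).compr₂ (targetSubalgebra k H).val.toLinearMap) t s := fun t s => by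
    induction t using TensorProduct.induction_on with
    | zero => simp
    | add s t hs ht => simp only [map_add, LinearMap.add_apply, hs, ht]
    | tmul a y =>
      induction s using TensorProduct.induction_on with
      | zero =>
        rw [show mulEval (0 : H ⊗[k] Module.Dual k X.bimod.carrier) = 0 from
          TensorProduct.ext_threefold' fun a b x => by simp [mulEval_tmul]]
        simp
      | add s t hs ht =>
        rw [show mulEval (s + t) = mulEval s + mulEval t from
          TensorProduct.ext_threefold' fun a b x => by
            simp [mulEval_tmul, mul_add, TensorProduct.add_tmul]]
        simp only [map_add, LinearMap.add_apply, hs, ht]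
      | tmul h g =>
        have h1 : TensorProduct.map₂ (LinearMap.mul k H)
          ((pairing X).compr₂ (targetSubalgebra k H).val.toLinearMap) (a ⊗ₜ y) (h ⊗ₜ g)
          = (a * h) ⊗ₜ[k] (pairing X y g : H) := rfl
        rw [h1, coe_pairing, LinearMap.lTensor_tmul]
        generalize X.coact y = w
        induction w using TensorProduct.induction_on with
        | zero => simp
        | add s t hs ht => simp only [map_add, TensorProduct.tmul_add, hs, ht]
        | tmul b y => simp [mulEval_tmul, TensorProduct.smul_tmul]
  rw [hA, hB, hC]
  exact (lTensor_codiag X.bimod (dual X).bimod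
    ((targetSubalgebra k H).val.toLinearMap ∘ₗ evalLin X) (X.coact x) (dualCoact X f)).symm

/-- The evaluation `X ⊗ X^* → H^t`, `x ⊗ f ↦ ε_t(x₋₁) f(x₀)`. -/
noncomputable def evaluation : MonoidalCategoryStruct.tensorObj X (dual X) ⟶
    MonoidalCategoryStruct.tensorUnit (CoRep k H) where
  toLin := evalLin X
  map_coact := LinearMap.congr_fun (f := unitCoact k H ∘ₗ evalLin X)
    (g := (evalLin X).lTensor H ∘ₗ tensorCoact X (dual X)) (Bimod.tensor_ext fun x f => by
      have hv : Function.Injective (targetSubalgebra k H).val.toLinearMap :=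
        Subtype.val_injective
      apply Module.Flat.lTensor_preserves_injective_linearMap (M := H) _ hv
      refine (lTensor_val_unitCoact _).trans ((evalLin_coact X x f).trans ?_)
      rw [LinearMap.lTensor_comp]
      rfl)

/-- The element `Σ f_i ⊗ x_i` for dual bases of `X^*` and `X`. -/
noncomputable def coevalElem : (Bimod.tensor (dual X).bimod X.bimod).carrier :=
  ∑ i, Bimod.tmul (dual X).bimod X.bimod
    ((Module.finBasis k X.bimod.carrier).coord i : Module.Dual k X.bimod.carrier)
    (Module.finBasis k X.bimod.carrier i)

theorem sum_repr_smul_map {V P : Type*} [AddCommGroup V] [Module k V] [AddCommGroup P]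
    [Module k P] {ι : Type*} [Fintype ι] (b : Module.Basis ι k V) (v : V) (F : V →ₗ[k] P) :
    ∑ i, b.repr v i • F (b i) = F v := by
  conv_rhs => rw [← b.sum_repr v, map_sum]
  simp only [map_smul]

/-- Invariance of the canonical element Σ f_i ⊗ x_i: both sides are the same double sum over the
matrix entries of `g`. -/
theorem sum_coord_comp {V P : Type*} [AddCommGroup V] [Module k V] [AddCommGroup P] [Module k P]
    {ι : Type*} [Fintype ι] (b : Module.Basis ι k V) (B : Module.Dual k V →ₗ[k] V →ₗ[k] P)
    (g : V →ₗ[k] V) : ∑ i, B (b.coord i ∘ₗ g) (b i) = ∑ i, B (b.coord i) (g (b i)) := by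
  have h1 : ∀ i, b.coord i ∘ₗ g = ∑ j, b.coord i (g (b j)) • b.coord j := fun i =>
    (b.sum_dual_apply_smul_coord (b.coord i ∘ₗ g)).symm
  have h2 : ∀ j, g (b j) = ∑ i, b.coord i (g (b j)) • b i := fun j => (b.sum_repr _).symm
  simp only [h1]
  conv_rhs => enter [2, j]; rw [h2 j]
  simp only [map_sum, LinearMap.sum_apply, map_smul, LinearMap.smul_apply]
  exact Finset.sum_comm

/-- The left action on X^* is the transpose of the right action on X, and the canonical element lets
a transpose pass to the other factor. -/
theorem lact_coevalElem (z : targetSubalgebra k H) :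
    (Bimod.tensor (dual X).bimod X.bimod).lact z (coevalElem X)
      = ∑ i, Bimod.tmul (dual X).bimod X.bimod
        ((Module.finBasis k X.bimod.carrier).coord i : Module.Dual k X.bimod.carrier)
        (X.bimod.ract z (Module.finBasis k X.bimod.carrier i)) := by
  refine Eq.trans ?_ (sum_coord_comp (Module.finBasis k X.bimod.carrier)
    (Bimod.tmul (dual X).bimod X.bimod) (X.bimod.ract z))
  refine (map_sum _ _ _).trans (Finset.sum_congr rfl fun i _ => ?_)
  exact congrArg (fun t => Bimod.tmul (dual X).bimod X.bimod t _) (dual_lact X z _)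

/-- Expand the coaction of f_i in dual vectors f_j, with coefficients S((x_j)₋₁) f_i((x_j)₀).
Summing over i replaces x_i by (x_j)₀, so that S(h₁) h₂ = ε_s(h) appears with h = (x_j)₋₁. -/
theorem sum_map₂_dualCoact {P : Type*} [AddCommGroup P] [Module k P]
    (τ : Module.Dual k X.bimod.carrier →ₗ[k] X.bimod.carrier →ₗ[k] P) :
    ∑ i, TensorProduct.map₂ (LinearMap.mul k H) τ
        (dualCoact X ((Module.finBasis k X.bimod.carrier).coord i))
        (X.coact (Module.finBasis k X.bimod.carrier i))
      = ∑ i, TensorProduct.map (sourceMap k H) (τ ((Module.finBasis k X.bimod.carrier).coord i))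
        (X.coact (Module.finBasis k X.bimod.carrier i)) := by
  let b := Module.finBasis k X.bimod.carrier
  let L : Module.Dual k X.bimod.carrier → H ⊗[k] (H ⊗[k] X.bimod.carrier) →ₗ[k] H ⊗[k] P :=
    fun φ => TensorProduct.lift (TensorProduct.map₂ (LinearMap.mul k H) τ ∘ₗ
      (TensorProduct.mk k H _).flip φ ∘ₗ antipode)
  have h1 : ∀ φ w, ∑ i, TensorProduct.map₂ (LinearMap.mul k H) τ
      (antipodeEval w (b.coord i) ⊗ₜ φ) (X.coact (b i)) = L φ (X.coact.lTensor H w) :=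
    fun φ w => by
    induction w using TensorProduct.induction_on with
    | zero => simp [antipodeEval_apply]
    | add s t hs ht =>
      simp only [map_add, ← hs, ← ht, antipodeEval_apply, TensorProduct.add_tmul,
        LinearMap.add_apply, Finset.sum_add_distrib]
    | tmul a y =>
      simpa [L, antipodeEval_apply, ← TensorProduct.smul_tmul'] using sum_repr_smul_map b y
        (TensorProduct.map (LinearMap.mul k H (antipode a)) (τ φ) ∘ₗ X.coact)
  have h2 : ∀ φ x, L φ (X.coact.lTensor H (X.coact x))
      = TensorProduct.map (sourceMap k H) (τ φ) (X.coact x) := fun φ x => by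
    rw [coact_coassoc]
    generalize X.coact x = t
    induction t using TensorProduct.induction_on with
    | zero => simp
    | add s t hs ht => simp only [map_add, hs, ht]
    | tmul a y =>
      have h3 : sourceMap k H a = LinearMap.mul' k H (TensorProduct.map antipode LinearMap.id
          (comul (R := k) a)) :=
        (LinearMap.congr_fun (congrArg WithConv.ofConv (antipode_conv_id (k := k) (H := H))) a).symm
      rw [TensorProduct.map_tmul, h3, TensorProduct.lift.tmul, LinearMap.mk₂_apply]
      generalize comul (R := k) a = s
      induction s using TensorProduct.induction_on with
      | zero => simp
      | add s t hs ht => simp only [map_add, TensorProduct.add_tmul, hs, ht]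
      | tmul c d => simp [L]
  simp only [← h2, ← h1, dualCoact, LinearMap.sum_apply, map_sum]
  rw [Finset.sum_comm]
  rfl

/-- After the preceding lemma the coaction is a sum of ε_s(x₋₁) ⊗ (f ⊗ x₀). Since ε_s(h) = 1₁ ε(h
1₂), this is 1₁ ⊗ (f ⊗ x ε_t(1₂)), and the right multiplication on x turns into the left action on
the canonical element. -/
theorem coact_coevalElem : tensorCoact (dual X) X (coevalElem X)
    = ((Bimod.tensor (dual X).bimod X.bimod).lact.flip (coevalElem X)).lTensor H
      ((toTarget k H).lTensor H (comul (1 : H))) := by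
  let b := Module.finBasis k X.bimod.carrier
  let τ : Module.Dual k X.bimod.carrier →ₗ[k] X.bimod.carrier →ₗ[k]
    (Bimod.tensor (dual X).bimod X.bimod).carrier := Bimod.tmul (dual X).bimod X.bimod
  have h1 : tensorCoact (dual X) X (coevalElem X) = ∑ i, TensorProduct.map₂ (LinearMap.mul k H) τ
        (dualCoact X (b.coord i)) (X.coact (b i)) := map_sum (tensorCoact (dual X) X) _ _
  have h2 : ∀ (g : X.bimod.carrier →ₗ[k] (Bimod.tensor (dual X).bimod X.bimod).carrier) (x),
      TensorProduct.map (sourceMap k H) g (X.coact x) = ∑ j ∈ (ℛ k (1 : H)).index,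
      (ℛ k (1 : H)).left j ⊗ₜ[k] g (X.bimod.ract (toTarget k H ((ℛ k (1 : H)).right j)) x) :=
    fun g x => by
    simp only [X.ract_eq, hit_apply]
    generalize X.coact x = t
    induction t using TensorProduct.induction_on with
    | zero => simp
    | add s t hs ht =>
      simp only [map_add, TensorProduct.tmul_add, Finset.sum_add_distrib, hs, ht]
    | tmul a y =>
      rw [TensorProduct.map_tmul, Repr.sourceMap_eq (ℛ k (1 : H))]
      simp [TensorProduct.sum_tmul, TensorProduct.smul_tmul, counit_mul_targetMap]
  rw [h1, sum_map₂_dualCoact]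
  simp only [h2]
  rw [Finset.sum_comm]
  conv_rhs => rw [← (ℛ k (1 : H)).eq]
  simp only [map_sum, LinearMap.lTensor_tmul, LinearMap.flip_apply]
  refine Finset.sum_congr rfl fun j _ => ?_
  rw [← TensorProduct.tmul_sum]
  exact congrArg _ (lact_coevalElem X _).symm

/-- Colinearity of the coevaluation: the coaction of z v is z v₋₁ ⊗ v₀, and likewise Δ(z) = (z ⊗ 1)
Δ(1), so the case z = 1 suffices. -/
theorem tensorCoact_lact_coevalElem (z : targetSubalgebra k H) :
    tensorCoact (dual X) X ((Bimod.tensor (dual X).bimod X.bimod).lact z (coevalElem X))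
      = ((Bimod.tensor (dual X).bimod X.bimod).lact.flip (coevalElem X)).lTensor H
        (unitCoact k H z) := by
  have h1 : unitCoact k H z = (toTarget k H).lTensor H (((z : H) ⊗ₜ[k] 1) * comul (1 : H)) := by
    have := comul_coe_mul (k := k) z (1 : H)
    rw [mul_one] at this
    rw [← this]; rfl
  have h2 : tensorCoact (dual X) X ((Bimod.tensor (dual X).bimod X.bimod).lact z (coevalElem X))
    = (LinearMap.mulLeft k (z : H)).rTensor _ (tensorCoact (dual X) X (coevalElem X)) :=
    coact_lact (tensor (dual X) X) z (coevalElem X)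
  rw [h2, h1, coact_coevalElem]
  generalize comul (R := k) (1 : H) = t
  induction t using TensorProduct.induction_on with
  | zero => simp
  | add s t hs ht => simp only [map_add, mul_add, hs, ht]
  | tmul a b => simp

/-- The coevaluation `H^t → X^* ⊗ X`. -/
noncomputable def coevaluation : MonoidalCategoryStruct.tensorUnit (CoRep k H) ⟶
    MonoidalCategoryStruct.tensorObj (dual X) X where
  toLin := (Bimod.tensor (dual X).bimod X.bimod).lact.flip (coevalElem X)
  map_coact z := tensorCoact_lact_coevalElem X z

/-- Summing over dual bases leaves ε_t(x₋₁) x₀, which is x. -/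
theorem evaluation_coevalElem (x : X.bimod.carrier) :
    ∑ i, X.bimod.lact (pairing X x ((Module.finBasis k X.bimod.carrier).coord i))
      (Module.finBasis k X.bimod.carrier i) = x := by
  let b := Module.finBasis k X.bimod.carrier
  conv_rhs => rw [← targetMap_coact X x]
  change ∑ i, X.bimod.lact (TensorProduct.rid k _ (TensorProduct.map (toTarget k H)
    (b.coord i) (X.coact x))) (b i) = _
  generalize X.coact x = t
  induction t using TensorProduct.induction_on with
  | zero => simp
  | add s t hs ht => simp only [map_add, LinearMap.add_apply, Finset.sum_add_distrib, hs, ht]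
  | tmul a y =>
    simpa using sum_repr_smul_map b y (X.bimod.lact (toTarget k H a))

open MonoidalCategory in
-- On x ⊗ z both sides are 1 ⊗ x z; the content is `evaluation_coevalElem`. This one of the two
-- triangle identities is all that the reconstruction of F(X) uses.
theorem zigzag : X ◁ coevaluation X ≫ (α_ X (dual X) X).inv ≫ evaluation X ▷ X
    = (ρ_ X).hom ≫ (λ_ X).inv := by
  refine hom_ext (Bimod.tensor_ext fun x (z : targetSubalgebra k H) => ?_)
  let b := Module.finBasis k X.bimod.carrier
  let y := X.bimod.ract z x
  let K : (Bimod.tensor X.bimod (Bimod.tensor (dual X).bimod X.bimod)).carrier →ₗ[k]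
      (Bimod.tensor (Bimod.regular (targetAlg k H)) X.bimod).carrier :=
    Hom.toLin ((α_ X (dual X) X).inv ≫ evaluation X ▷ X)
  have h1 : Bimod.tmul X.bimod (Bimod.tensor (dual X).bimod X.bimod) x
      ((Bimod.tensor (dual X).bimod X.bimod).lact z (coevalElem X))
      = ∑ i, Bimod.tmul X.bimod (Bimod.tensor (dual X).bimod X.bimod) y
        (Bimod.tmul (dual X).bimod X.bimod (b.coord i : Module.Dual k _) (b i)) :=
    (Bimod.ract_tmul _ _ _).symm.trans (map_sum _ _ _)
  have h2 : Bimod.tmul (Bimod.regular (targetAlg k H)) X.bimod (1 : targetSubalgebra k H) y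
      = ∑ i, Bimod.tmul (Bimod.regular (targetAlg k H)) X.bimod (pairing X y (b.coord i))
        (b i) := by
    conv_lhs => rw [← evaluation_coevalElem X y]
    refine (map_sum _ _ _).trans (Finset.sum_congr rfl fun i _ => ?_)
    refine (Bimod.ract_tmul (M := Bimod.regular (targetAlg k H)) _ _ _).symm.trans ?_
    exact congrArg (fun t => Bimod.tmul (Bimod.regular (targetAlg k H)) X.bimod t (b i))
      (one_mul (pairing X y (b.coord i)))
  exact (congrArg K h1).trans ((map_sum K _ _).trans h2.symm)

end duality
end CoRep
end BasedAct

/-! ### Based actions over the weak fibre functor -/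

namespace BasedAct

open Coalgebra WeakHopfAlgebra Functor.LaxMonoidal MonoidalCategoryStruct CoRep

variable {k H : Type u} [Field k] [Ring H] [Algebra k H] [WeakHopfAlgebra k H]
  [FiniteDimensional k H] {A : Alg.{u} k}

namespace BasedAction

variable (V : BasedAction k H A)

/-- The map `F(X) × F(Y) → F(X ⊗ Y)`. -/
def mulF (X Y : CoRep k H) : Bimod.Space (V.functor.obj X) →ₗ[k]
    Bimod.Space (V.functor.obj Y) →ₗ[k] Bimod.Space (V.functor.obj (tensorObj X Y)) :=
  (Bimod.pure (V.functor.obj X) (V.functor.obj Y)).compr₂ (Bimod.lin (μ V.functor X Y))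

variable {X Y Z X' Y' : CoRep k H}

theorem mulF_lact (a : A.carrier) (v : Bimod.Space (V.functor.obj X))
    (w : Bimod.Space (V.functor.obj Y)) : V.mulF X Y ((V.functor.obj X).lact a v) w
      = (V.functor.obj (tensorObj X Y)).lact a (V.mulF X Y v w) :=
  (μ V.functor X Y).map_lact a (Bimod.pure _ _ v w)

theorem mulF_ract (a : A.carrier) (v : Bimod.Space (V.functor.obj X))
    (w : Bimod.Space (V.functor.obj Y)) : V.mulF X Y v ((V.functor.obj Y).ract a w)
      = (V.functor.obj (tensorObj X Y)).ract a (V.mulF X Y v w) :=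
  (μ V.functor X Y).map_ract a (Bimod.pure _ _ v w)

theorem mulF_balanced (v : Bimod.Space (V.functor.obj X)) (a : A.carrier)
    (w : Bimod.Space (V.functor.obj Y)) : V.mulF X Y ((V.functor.obj X).ract a v) w
      = V.mulF X Y v ((V.functor.obj Y).lact a w) :=
  congrArg (Bimod.lin (μ V.functor X Y)) (Bimod.ract_tmul _ _ _)

theorem map_whiskerRight_mulF (f : X ⟶ X') (v : Bimod.Space (V.functor.obj X))
    (w : Bimod.Space (V.functor.obj Y)) :
    Bimod.lin (V.functor.map (MonoidalCategoryStruct.whiskerRight f Y)) (V.mulF X Y v w)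
      = V.mulF X' Y (Bimod.lin (V.functor.map f) v) w :=
  (LinearMap.congr_fun (congrArg Bimod.lin (μ_natural_left V.functor f Y))
    (Bimod.pure _ _ v w)).symm

theorem map_whiskerLeft_mulF (f : Y ⟶ Y') (v : Bimod.Space (V.functor.obj X))
    (w : Bimod.Space (V.functor.obj Y)) :
    Bimod.lin (V.functor.map (MonoidalCategoryStruct.whiskerLeft X f)) (V.mulF X Y v w)
      = V.mulF X Y' v (Bimod.lin (V.functor.map f) w) :=
  (LinearMap.congr_fun (congrArg Bimod.lin (μ_natural_right V.functor X f))
    (Bimod.pure _ _ v w)).symm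

theorem map_associator_mulF (u : Bimod.Space (V.functor.obj X))
    (v : Bimod.Space (V.functor.obj Y)) (w : Bimod.Space (V.functor.obj Z)) :
    Bimod.lin (V.functor.map (MonoidalCategoryStruct.associator X Y Z).hom)
      (V.mulF _ Z (V.mulF X Y u v) w) = V.mulF X _ u (V.mulF Y Z v w) :=
  LinearMap.congr_fun (congrArg Bimod.lin (associativity V.functor X Y Z))
    (Bimod.pure _ _ (Bimod.pure _ _ u v) w)

/-- The map `A → F(1)`. -/
def unitF : A.carrier →ₗ[k] Bimod.Space (V.functor.obj (tensorUnit (CoRep k H))) :=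
  Bimod.lin (ε V.functor)

/-- The map `F(1) → A`. -/
def counitF : Bimod.Space (V.functor.obj (tensorUnit (CoRep k H))) →ₗ[k] A.carrier :=
  Bimod.lin (Functor.OplaxMonoidal.η V.functor)

@[simp] theorem counitF_unitF (a : A.carrier) : V.counitF (V.unitF a) = a :=
  LinearMap.congr_fun (congrArg Bimod.lin (Functor.Monoidal.ε_η V.functor)) a

@[simp] theorem unitF_counitF (v) : V.unitF (V.counitF v) = v :=
  LinearMap.congr_fun (congrArg Bimod.lin (Functor.Monoidal.η_ε V.functor)) v

theorem unitF_mul (a b : A.carrier) : V.unitF (a * b) = Bimod.lact _ a (V.unitF b) :=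
  (ε V.functor).map_lact a b

theorem unitF_mul' (a b : A.carrier) : V.unitF (a * b) = Bimod.ract _ b (V.unitF a) :=
  (ε V.functor).map_ract b a

theorem counitF_lact (a : A.carrier) (v) : V.counitF (Bimod.lact _ a v) = a * V.counitF v :=
  (Functor.OplaxMonoidal.η V.functor).map_lact a v

theorem map_leftUnitor_mulF (a : A.carrier) (v : Bimod.Space (V.functor.obj X)) :
    Bimod.lin (V.functor.map (MonoidalCategoryStruct.leftUnitor X).hom)
      (V.mulF _ X (V.unitF a) v) = (V.functor.obj X).lact a v :=
  (LinearMap.congr_fun (congrArg Bimod.lin (left_unitality V.functor X))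
    (Bimod.pure (𝟙 A) _ a v)).symm

theorem map_rightUnitor_mulF (a : A.carrier) (v : Bimod.Space (V.functor.obj X)) :
    Bimod.lin (V.functor.map (MonoidalCategoryStruct.rightUnitor X).hom)
      (V.mulF X _ v (V.unitF a)) = (V.functor.obj X).ract a v :=
  (LinearMap.congr_fun (congrArg Bimod.lin (right_unitality V.functor X))
    (Bimod.pure _ (𝟙 A) v a)).symm

theorem map_comp_apply {X Y Z : CoRep k H} (f : X ⟶ Y) (g : Y ⟶ Z)
    (v : Bimod.Space (V.functor.obj X)) :
    Bimod.lin (V.functor.map (f ≫ g)) v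
      = Bimod.lin (V.functor.map g) (Bimod.lin (V.functor.map f) v) := by
  rw [V.functor.map_comp]; rfl

end BasedAction

/-! ### The bimodule F(X) as A ⊗_{H^t} X. -/

namespace FiberedAction

variable (V : FiberedAction k H A) {X Y : CoRep k H}

theorem map_baseMap (f : X ⟶ Y) (x : X.bimod.carrier) :
    Bimod.lin (V.functor.map f) (V.baseMap X x) = V.baseMap Y (Hom.toLin f x) :=
  (congrArg Subtype.val (LinearMap.congr_fun (congrArg ModuleCat.Hom.hom
    (V.identification.hom.naturality f)) x)).symm

theorem mulF_baseMap (x : X.bimod.carrier) (y : Y.bimod.carrier) :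
    V.mulF X Y (V.baseMap X x) (V.baseMap Y y)
      = V.baseMap (tensorObj X Y) (Bimod.tmul X.bimod Y.bimod x y) :=
  have := V.isMonoidal
  (congrArg Subtype.val (LinearMap.congr_fun (congrArg ModuleCat.Hom.hom
    (NatTrans.IsMonoidal.tensor (τ := V.identification.hom) X Y)) (x ⊗ₜ[k] y))).symm

theorem baseMap_one : V.baseMap (tensorUnit (CoRep k H)) (1 : targetSubalgebra k H)
    = V.unitF 1 := by
  have := V.isMonoidal
  have h := congrArg Subtype.val (LinearMap.congr_fun (congrArg ModuleCat.Hom.hom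
    (NatTrans.IsMonoidal.unit (τ := V.identification.hom))) (1 : k))
  have h1 : (1 : k) • (1 : targetSubalgebra k H) = 1 := one_smul _ _
  have h2 : (1 : k) • V.unitF 1 = V.unitF 1 := one_smul _ _
  rw [← h1, ← h2]
  exact h

theorem baseMap_injective (X : CoRep k H) : Function.Injective (V.baseMap X) :=
  Subtype.val_injective.comp (fun x y h => by
    have e := fun x => LinearMap.congr_fun (congrArg ModuleCat.Hom.hom
      (V.identification.hom_inv_id_app X)) x
    exact (e x).symm.trans ((congrArg (V.identification.inv.app X).hom h).trans (e y)))

theorem range_baseMap (X : CoRep k H) : LinearMap.range (V.baseMap X) = V.base X := by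
  apply le_antisymm
  · rintro _ ⟨x, rfl⟩
    exact ((V.identification.hom.app X).hom x).2
  · intro v hv
    exact ⟨(V.identification.inv.app X).hom ⟨v, hv⟩, congrArg Subtype.val (LinearMap.congr_fun
      (congrArg ModuleCat.Hom.hom (V.identification.inv_hom_id_app X)) ⟨v, hv⟩)⟩

/-- The inclusion `H^t → A`. -/
def iota : targetSubalgebra k H →ₗ[k] A.carrier :=
  V.counitF ∘ₗ V.baseMap (tensorUnit (CoRep k H))

theorem unitF_iota (z : targetSubalgebra k H) :
    V.unitF (V.iota z) = V.baseMap (tensorUnit (CoRep k H)) z := V.unitF_counitF _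

theorem iota_one : V.iota 1 = 1 := by
  refine (congrArg V.counitF V.baseMap_one).trans (V.counitF_unitF 1)

theorem iota_injective : Function.Injective V.iota := fun z w h =>
  V.baseMap_injective _ ((V.unitF_iota z).symm.trans ((congrArg V.unitF h).trans (V.unitF_iota w)))

/-- The left unit constraint computes the action of A on F(X) from F(1) ⊗_A F(X). On base vectors it
is the isomorphism H^t ⊗ X ≅ X, because the base maps are natural and monoidal. -/
theorem lact_baseMap (z : targetSubalgebra k H) (x : X.bimod.carrier) :
    (V.functor.obj X).lact (V.iota z) (V.baseMap X x) = V.baseMap X (X.bimod.lact z x) := by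
  refine (V.map_leftUnitor_mulF _ _).symm.trans ?_
  refine (congrArg (fun t => Bimod.lin (V.functor.map (leftUnitor X).hom)
    (V.mulF _ X t (V.baseMap X x))) (V.unitF_iota z)).trans ?_
  exact (congrArg (Bimod.lin (V.functor.map (leftUnitor X).hom))
    (V.mulF_baseMap (X := tensorUnit (CoRep k H)) z x)).trans (V.map_baseMap _ _)

theorem ract_baseMap (z : targetSubalgebra k H) (x : X.bimod.carrier) :
    (V.functor.obj X).ract (V.iota z) (V.baseMap X x) = V.baseMap X (X.bimod.ract z x) := by
  refine (V.map_rightUnitor_mulF _ _).symm.trans ?_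
  refine (congrArg (fun t => Bimod.lin (V.functor.map (rightUnitor X).hom)
    (V.mulF X _ (V.baseMap X x) t)) (V.unitF_iota z)).trans ?_
  exact (congrArg (Bimod.lin (V.functor.map (rightUnitor X).hom))
    (V.mulF_baseMap (Y := tensorUnit (CoRep k H)) x z)).trans (V.map_baseMap _ _)

/-- The case X = 1 of `lact_baseMap`, read through F(1) ≅ A. -/
theorem iota_mul (z w : targetSubalgebra k H) : V.iota (z * w) = V.iota z * V.iota w := by
  refine (congrArg V.counitF (V.lact_baseMap (X := tensorUnit (CoRep k H)) z w).symm).trans ?_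
  exact V.counitF_lact _ _

/-- The algebra `A` as an `A`-`H^t`-bimodule. -/
def targetBimod : Bimod A (targetAlg k H) where
  carrier := A.carrier
  lact := LinearMap.mul k A.carrier
  ract := (LinearMap.mul k A.carrier).flip ∘ₗ V.iota
  one_lact := one_mul
  mul_lact := mul_assoc
  one_ract a := by simp [iota_one]
  mul_ract z w a := by simp [iota_mul, mul_assoc]
  lact_ract a z b := (mul_assoc _ _ _).symm

/-- The map `A ⊗_{H^t} X → F(X)`. -/
def can (X : CoRep k H) : (Bimod.tensor V.targetBimod X.bimod).carrier →ₗ[k]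
    Bimod.Space (V.functor.obj X) :=
  Bimod.lift (M := V.targetBimod) ((V.functor.obj X).lact.compl₂ (V.baseMap X))
    (fun (a : A.carrier) z x => by
      change (V.functor.obj X).lact (a * V.iota z) _ = (V.functor.obj X).lact a _
      rw [Bimod.mul_lact, lact_baseMap])

/-- The map `F(X) → A`, `v ↦ F(ev)(v f)`. -/
noncomputable def pairF (X : CoRep k H) (f : Module.Dual k X.bimod.carrier) :
    Bimod.Space (V.functor.obj X) →ₗ[k] A.carrier :=
  V.counitF ∘ₗ Bimod.lin (V.functor.map (evaluation X)) ∘ₗ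
    (V.mulF X (dual X)).flip (V.baseMap (dual X) f)

theorem pairF_lact (f : Module.Dual k X.bimod.carrier) (a : A.carrier)
    (v : Bimod.Space (V.functor.obj X)) :
    V.pairF X f ((V.functor.obj X).lact a v) = a * V.pairF X f v := by
  change V.counitF (Bimod.lin (V.functor.map (evaluation X)) (V.mulF _ _ _ _)) = _
  rw [V.mulF_lact]
  exact (congrArg V.counitF ((V.functor.map (evaluation X)).map_lact a _)).trans
    (V.counitF_lact _ _)

/-- Monoidality and naturality of the base maps turn F(ev) on base vectors into the evaluation of
comodules. -/
theorem pairF_baseMap (f : Module.Dual k X.bimod.carrier) (x : X.bimod.carrier) :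
    V.pairF X f (V.baseMap X x) = V.iota (pairing X x f) := by
  refine (congrArg (fun t => V.counitF (Bimod.lin (V.functor.map (evaluation X)) t))
    (V.mulF_baseMap (Y := dual X) x f)).trans ?_
  exact congrArg V.counitF (V.map_baseMap (evaluation X) _)

/-- The zigzag identity pushed through F: the base space generates F(X) over A, with coefficients
F(ev)(v f_i). After reassociating, the sum is F applied to a morphism built from the evaluation, at
the product of v with Σ f_i ⊗ x_i = coev(1). The two cancel. -/
theorem sum_pairF (v : Bimod.Space (V.functor.obj X)) :
    ∑ i, (V.functor.obj X).lact (V.pairF X ((Module.finBasis k X.bimod.carrier).coord i) v)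
      (V.baseMap X (Module.finBasis k X.bimod.carrier i)) = v := by
  let b := Module.finBasis k X.bimod.carrier
  let K := Bimod.lin (V.functor.map ((MonoidalCategoryStruct.associator X (dual X) X).inv ≫
    MonoidalCategoryStruct.whiskerRight (evaluation X) X ≫
    (MonoidalCategoryStruct.leftUnitor X).hom))
  have h0 : ∀ (f : (dual X).bimod.carrier) (x : X.bimod.carrier),
      (V.functor.obj X).lact (V.counitF (Bimod.lin (V.functor.map (evaluation X))
        (V.mulF X (dual X) v (V.baseMap (dual X) f)))) (V.baseMap X x)
      = K (V.mulF X _ v (V.mulF (dual X) X (V.baseMap (dual X) f) (V.baseMap X x))) :=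
    fun f x => by
    rw [← V.map_associator_mulF, ← V.map_comp_apply, Iso.hom_inv_id_assoc,
      V.map_comp_apply, V.map_whiskerRight_mulF, ← V.map_leftUnitor_mulF]
    exact congrArg (fun t => Bimod.lin (V.functor.map (MonoidalCategoryStruct.leftUnitor X).hom)
      (V.mulF _ X t (V.baseMap X x))) (V.unitF_counitF _)
  have h1 : ∀ i, (V.functor.obj X).lact (V.pairF X (b.coord i) v) (V.baseMap X (b i))
      = K (V.mulF X _ v (V.baseMap (tensorObj (dual X) X)
        (Bimod.tmul (dual X).bimod X.bimod (b.coord i : Module.Dual k _) (b i)))) := fun i =>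
    (h0 (b.coord i : Module.Dual k _) (b i)).trans
      (congrArg (fun t => K (V.mulF X _ v t)) (V.mulF_baseMap (X := dual X) _ _))
  -- The canonical element is the coevaluation of 1, and base maps are natural, so in F it is
  -- F(coev) at the unit.
  have h2 : V.baseMap (tensorObj (dual X) X) (coevalElem X)
      = Bimod.lin (V.functor.map (coevaluation X)) (V.unitF 1) := by
    refine Eq.trans ?_ (congrArg (Bimod.lin (V.functor.map (coevaluation X))) V.baseMap_one)
    refine Eq.trans ?_ (V.map_baseMap (coevaluation X) _).symm
    exact congrArg (V.baseMap _) (((tensor (dual X) X).bimod.one_lact (coevalElem X)).symm)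
  calc _ = K (V.mulF X _ v (V.baseMap (tensorObj (dual X) X) (coevalElem X))) := by
        simp only [b, h1]
        rw [← map_sum K, ← map_sum (V.mulF X _ v)]
        exact congrArg (fun t => K (V.mulF X _ v t)) (map_sum (V.baseMap _) _ _).symm
    _ = v := by
        refine (congrArg (fun t => K (V.mulF X _ v t)) h2).trans ?_
        rw [← V.map_whiskerLeft_mulF, ← V.map_comp_apply]
        have h3 := zigzag X
        have h4 : MonoidalCategoryStruct.whiskerLeft X (coevaluation X) ≫
            (MonoidalCategoryStruct.associator X (dual X) X).inv ≫
            MonoidalCategoryStruct.whiskerRight (evaluation X) X ≫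
            (MonoidalCategoryStruct.leftUnitor X).hom
            = (MonoidalCategoryStruct.rightUnitor X).hom := by
          rw [← Category.assoc, ← Category.assoc, ← Iso.eq_comp_inv, Category.assoc]
          exact h3
        refine Eq.trans (congrArg (fun g => Bimod.lin (V.functor.map g) _) h4) ?_
        exact (V.map_rightUnitor_mulF 1 v).trans (Bimod.one_ract _ v)

/-- The inverse of `A ⊗_{H^t} X → F(X)`. -/
noncomputable def canInv (X : CoRep k H) : Bimod.Space (V.functor.obj X) →ₗ[k]
    (Bimod.tensor V.targetBimod X.bimod).carrier :=
  ∑ i, (Bimod.tmul V.targetBimod X.bimod).flip (Module.finBasis k X.bimod.carrier i) ∘ₗ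
    V.pairF X ((Module.finBasis k X.bimod.carrier).coord i)

theorem can_canInv (v : Bimod.Space (V.functor.obj X)) : V.can X (V.canInv X v) = v := by
  conv_rhs => rw [← V.sum_pairF v]
  simp only [canInv, LinearMap.sum_apply, map_sum]
  rfl

/-- The coefficients of a x are of the form a ι(z) with z the pairing of x and f_i, so z can cross
the tensor sign, and there the terms sum to x. With `can_canInv` this makes A ⊗_{H^t} X → F(X)
bijective. -/
theorem canInv_lact_baseMap (a : A.carrier) (x : X.bimod.carrier) :
    V.canInv X ((V.functor.obj X).lact a (V.baseMap X x))
      = Bimod.tmul V.targetBimod X.bimod a x := by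
  conv_rhs => rw [← evaluation_coevalElem X x]
  simp only [canInv, LinearMap.sum_apply]
  refine Eq.trans (Finset.sum_congr rfl fun i _ => ?_) (map_sum _ _ _).symm
  refine (congrArg (fun t : A.carrier => Bimod.tmul V.targetBimod X.bimod t
    (Module.finBasis k X.bimod.carrier i)) ((V.pairF_lact _ a _).trans
      (congrArg (a * ·) (V.pairF_baseMap _ x)))).trans ?_
  exact Bimod.ract_tmul (M := V.targetBimod) (N := X.bimod) a _ _

/-- Two linear maps on `F(X)` are equal if they agree on the elements `a x`. -/
theorem hom_ext {P : Type*} [AddCommGroup P] [Module k P]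
    {f g : Bimod.Space (V.functor.obj X) →ₗ[k] P}
    (h : ∀ a x, f ((V.functor.obj X).lact a (V.baseMap X x))
      = g ((V.functor.obj X).lact a (V.baseMap X x))) : f = g :=
  LinearMap.ext fun v => by
    rw [← V.can_canInv v]
    exact LinearMap.congr_fun (f := f ∘ₗ V.can X) (g := g ∘ₗ V.can X)
      (Bimod.tensor_ext fun a x => h a x) _

/-- The left `A`-linear map `F(X) → P` with `a x ↦ a s(x)`, given as a bilinear map. -/
noncomputable def desc {P : Type u} [AddCommGroup P] [Module k P]
    (s : A.carrier →ₗ[k] X.bimod.carrier →ₗ[k] P)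
    (hs : ∀ a z x, s (a * V.iota z) x = s a (X.bimod.lact z x)) :
    Bimod.Space (V.functor.obj X) →ₗ[k] P :=
  Bimod.lift (M := V.targetBimod) s hs ∘ₗ V.canInv X

@[simp] theorem desc_lact_baseMap {P : Type u} [AddCommGroup P] [Module k P]
    (s : A.carrier →ₗ[k] X.bimod.carrier →ₗ[k] P)
    (hs : ∀ a z x, s (a * V.iota z) x = s a (X.bimod.lact z x)) (a : A.carrier)
    (x : X.bimod.carrier) :
    V.desc s hs ((V.functor.obj X).lact a (V.baseMap X x)) = s a x := by
  rw [desc, LinearMap.comp_apply, canInv_lact_baseMap]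
  rfl

end FiberedAction

end BasedAct

/-! ### The module algebra of a based action -/

namespace BasedAct

open Coalgebra WeakHopfAlgebra Functor.LaxMonoidal MonoidalCategoryStruct CoRep

variable {k H : Type u} [Field k] [Ring H] [Algebra k H] [WeakHopfAlgebra k H]
  [FiniteDimensional k H] {A : Alg.{u} k}

namespace CoRep

theorem regular_lact (z : targetSubalgebra k H) (h : H) :
    (regular k H).bimod.lact z h = (z : H) * h :=
  ((regular k H).lact_eq z h).trans (counit_coe_mul z h)

theorem regular_ract (z : targetSubalgebra k H) (h : H) :
    (regular k H).bimod.ract z h = h * (z : H) :=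
  ((regular k H).ract_eq z h).trans (counit_mul_coe z h)

theorem toTarget_regular_lact (z : targetSubalgebra k H) (h : (regular k H).bimod.carrier) :
    toTarget k H ((regular k H).bimod.lact z h) = z * toTarget k H h :=
  (congrArg (toTarget k H) (regular_lact z h)).trans (Subtype.ext (targetMap_coe_mul z h))

/-- The linear map `x ↦ x₋₁ f(x₀)`. -/
def coeffLin (X : CoRep k H) (f : Module.Dual k X.bimod.carrier) : X.bimod.carrier →ₗ[k] H :=
  (TensorProduct.rid k H).toLinearMap ∘ₗ f.lTensor H ∘ₗ X.coact

/-- Coassociativity of X makes every matrix coefficient a comodule map to H. -/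
theorem comul_coeffLin (X : CoRep k H) (f : Module.Dual k X.bimod.carrier) (x) :
    comul (R := k) (coeffLin X f x) = (coeffLin X f).lTensor H (X.coact x) := by
  let G : H ⊗[k] (H ⊗[k] X.bimod.carrier) →ₗ[k] H ⊗[k] H :=
    ((TensorProduct.rid k H).toLinearMap ∘ₗ f.lTensor H).lTensor H
  have h1 : (coeffLin X f).lTensor H (X.coact x) = G (X.coact.lTensor H (X.coact x)) := by
    generalize X.coact x = t
    induction t using TensorProduct.induction_on with
    | zero => simp
    | add s t hs ht => simp only [map_add, hs, ht]
    | tmul a y => rfl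
  rw [h1, coact_coassoc, coeffLin, LinearMap.comp_apply, LinearMap.comp_apply]
  generalize X.coact x = t
  induction t using TensorProduct.induction_on with
  | zero => simp
  | add s t hs ht => simp only [map_add, hs, ht]
  | tmul a y =>
    simp only [LinearMap.lTensor_tmul, LinearEquiv.coe_coe, TensorProduct.rid_tmul, map_smul,
      TensorProduct.lift.tmul, LinearMap.mk₂_apply]
    generalize comul (R := k) a = s
    induction s using TensorProduct.induction_on with
    | zero => simp
    | add s t hs ht => simp only [map_add, TensorProduct.add_tmul, smul_add, hs, ht]
    | tmul a b => simp [G]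

/-- The homomorphism of comodules `X → H`, `x ↦ x₋₁ f(x₀)`. -/
def coeffHom (X : CoRep k H) (f : Module.Dual k X.bimod.carrier) : X ⟶ regular k H where
  toLin := coeffLin X f
  map_coact := comul_coeffLin X f

variable (k H) in
/-- The inclusion of the unit comodule `H^t` into `H`. -/
def unitIncl : tensorUnit (CoRep k H) ⟶ regular k H where
  toLin := (targetSubalgebra k H).val.toLinearMap
  map_coact z := (lTensor_val_unitCoact z).symm

end CoRep

namespace FiberedAction

variable (V : FiberedAction k H A) {X Y : CoRep k H}

/-- The left `A`-linear map `F(X) → A` with `a x ↦ a s(x)`, for `s : X → H^t`. -/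
noncomputable def proj (s : X.bimod.carrier →ₗ[k] targetSubalgebra k H)
    (hs : ∀ z x, s (X.bimod.lact z x) = z * s x) :
    Bimod.Space (V.functor.obj X) →ₗ[k] A.carrier :=
  V.desc ((LinearMap.mul k A.carrier).compl₂ (V.iota ∘ₗ s)) fun a z x => by
    simp [hs, iota_mul, mul_assoc]

theorem proj_lact_baseMap (s : X.bimod.carrier →ₗ[k] targetSubalgebra k H)
    (hs : ∀ z x, s (X.bimod.lact z x) = z * s x) (a : A.carrier) (x : X.bimod.carrier) :
    V.proj s hs ((V.functor.obj X).lact a (V.baseMap X x)) = a * V.iota (s x) :=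
  V.desc_lact_baseMap _ _ a x

/-- The left `A`-linear map `F(H) → A` with `a h ↦ a ε_t(h)`. -/
noncomputable def projTarget : Bimod.Space (V.functor.obj (regular k H)) →ₗ[k] A.carrier :=
  V.proj (X := regular k H) (toTarget k H) toTarget_regular_lact

theorem projTarget_lact_baseMap (a : A.carrier) (h : H) :
    V.projTarget ((V.functor.obj (regular k H)).lact a (V.baseMap (regular k H) h))
      = a * V.iota (toTarget k H h) :=
  V.proj_lact_baseMap (X := regular k H) (toTarget k H) _ a h

theorem proj_lact (s : X.bimod.carrier →ₗ[k] targetSubalgebra k H)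
    (hs : ∀ z x, s (X.bimod.lact z x) = z * s x) (c : A.carrier)
    (v : Bimod.Space (V.functor.obj X)) :
    V.proj s hs ((V.functor.obj X).lact c v) = c * V.proj s hs v :=
  LinearMap.congr_fun (f := V.proj s hs ∘ₗ (V.functor.obj X).lact c)
    (g := LinearMap.mulLeft k c ∘ₗ V.proj s hs) (V.hom_ext fun a h => by
      simp only [LinearMap.comp_apply, LinearMap.mulLeft_apply]
      rw [← Bimod.mul_lact, proj_lact_baseMap, proj_lact_baseMap, mul_assoc]) v

theorem projTarget_lact (c : A.carrier) (v : Bimod.Space (V.functor.obj (regular k H))) :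
    V.projTarget ((V.functor.obj (regular k H)).lact c v) = c * V.projTarget v :=
  V.proj_lact _ _ c v

/-- The action of `H` on `A`. -/
noncomputable def act : H →ₗ[k] A.carrier →ₗ[k] A.carrier :=
  ((V.functor.obj (regular k H)).ract.flip ∘ₗ V.baseMap (regular k H)).compr₂ V.projTarget

theorem act_apply (h : H) (a : A.carrier) : V.act h a
    = V.projTarget ((V.functor.obj (regular k H)).ract a (V.baseMap (regular k H) h)) := rfl

/-- An element of `F(X)` is determined by its images under the maps `X → H`. -/
theorem sum_projTarget (v : Bimod.Space (V.functor.obj X)) :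
    ∑ i, (V.functor.obj X).lact (V.projTarget (Bimod.lin (V.functor.map (coeffHom X
        ((Module.finBasis k X.bimod.carrier).coord i))) v))
      (V.baseMap X (Module.finBasis k X.bimod.carrier i)) = v := by
  let b := Module.finBasis k X.bimod.carrier
  let L : Bimod.Space (V.functor.obj X) →ₗ[k] Bimod.Space (V.functor.obj X) :=
    ∑ i, (V.functor.obj X).lact.flip (V.baseMap X (b i)) ∘ₗ V.projTarget ∘ₗ
      Bimod.lin (V.functor.map (coeffHom X (b.coord i)))
  -- By generation it is enough to treat a x. The coefficients x₋₁ f_i(x₀), projected by ε_t,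
  -- reassemble to ε_t(x₋₁) x₀ = x.
  have hL : L = LinearMap.id := V.hom_ext fun a x => by
    have h1 : ∀ i, V.projTarget (Bimod.lin (V.functor.map (coeffHom X (b.coord i)))
        ((V.functor.obj X).lact a (V.baseMap X x)))
        = a * V.iota (toTarget k H (coeffLin X (b.coord i) x)) := fun i => by
      refine Eq.trans ?_ (V.projTarget_lact_baseMap a _)
      refine congrArg V.projTarget (((V.functor.map (coeffHom X (b.coord i))).map_lact a _).trans
        (congrArg _ (V.map_baseMap _ x)))
    simp only [L, LinearMap.sum_apply, LinearMap.comp_apply, h1, LinearMap.flip_apply,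
      LinearMap.id_apply, Bimod.mul_lact, lact_baseMap]
    rw [← map_sum, ← map_sum]
    congr 2
    conv_rhs => rw [← targetMap_coact X x]
    simp only [coeffLin, LinearMap.comp_apply]
    generalize X.coact x = t
    induction t using TensorProduct.induction_on with
    | zero => simp
    | add s t hs ht => simp only [map_add, LinearMap.add_apply, Finset.sum_add_distrib, hs, ht]
    | tmul a y => simpa using sum_repr_smul_map b y (X.bimod.lact (toTarget k H a))
  refine Eq.trans ?_ (LinearMap.congr_fun hL v)
  simp only [L, LinearMap.sum_apply]
  rfl

/-- `x a = (x₋₁ a) x₀` for `x ∈ X` and `a ∈ A` -/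
theorem ract_baseMap_eq (a : A.carrier) (x : X.bimod.carrier) :
    (V.functor.obj X).ract a (V.baseMap X x) = TensorProduct.lift
      ((V.functor.obj X).lact.compl₁₂ (V.act.flip a) (V.baseMap X)) (X.coact x) := by
  let b := Module.finBasis k X.bimod.carrier
  -- F of a coefficient map is right A-linear, so the coefficient of x_i in x a is x₋₁ f_i(x₀)
  -- acting on a, by definition of the action.
  rw [← V.sum_projTarget ((V.functor.obj X).ract a (V.baseMap X x))]
  have h1 : ∀ i, V.projTarget (Bimod.lin (V.functor.map (coeffHom X (b.coord i)))
      ((V.functor.obj X).ract a (V.baseMap X x))) = V.act (coeffLin X (b.coord i) x) a :=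
    fun i => congrArg V.projTarget (((V.functor.map (coeffHom X (b.coord i))).map_ract a _).trans
      (congrArg _ (V.map_baseMap _ x)))
  simp only [b] at h1
  simp only [h1, coeffLin, LinearMap.comp_apply]
  generalize X.coact x = t
  induction t using TensorProduct.induction_on with
  | zero => simp
  | add s t hs ht => simp only [map_add, LinearMap.add_apply, Finset.sum_add_distrib, hs, ht]
  | tmul h y => simpa using sum_repr_smul_map b y ((V.functor.obj X).lact (V.act h a) ∘ₗ V.baseMap X)

/-- Right multiplication by ι(z) preserves the base of F(H), where it is h ↦ h z; only the
projection by ε_t remains. -/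
theorem act_iota (h : H) (z : targetSubalgebra k H) :
    V.act h (V.iota z) = V.iota (toTarget k H (h * z)) := by
  rw [act_apply]
  refine (congrArg V.projTarget (V.ract_baseMap (X := regular k H) z h)).trans ?_
  refine Eq.trans ?_ ((V.projTarget_lact_baseMap 1 (h * z)).trans (one_mul _))
  exact congrArg V.projTarget ((congrArg (V.baseMap _) (regular_ract z h)).trans
    (Bimod.one_lact _ _).symm)

theorem act_one (h : H) : V.act h 1 = V.iota (toTarget k H h) := by
  have h1 := V.act_iota h 1
  rwa [iota_one, OneMemClass.coe_one, mul_one] at h1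

/-- The inclusion `H → F(H)`. -/
def baseH : H →ₗ[k] Bimod.Space (V.functor.obj (regular k H)) := V.baseMap (regular k H)

theorem ract_baseH (a : A.carrier) (h : H) : (V.functor.obj (regular k H)).ract a (V.baseH h)
    = TensorProduct.lift ((V.functor.obj (regular k H)).lact.compl₁₂ (V.act.flip a) V.baseH)
      (comul (R := k) h) := V.ract_baseMap_eq (X := regular k H) a h

theorem proj_ract_baseMap (s : X.bimod.carrier →ₗ[k] targetSubalgebra k H)
    (hs : ∀ z x, s (X.bimod.lact z x) = z * s x) (a : A.carrier) (x : X.bimod.carrier) :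
    V.proj s hs ((V.functor.obj X).ract a (V.baseMap X x))
      = LinearMap.mul' k A.carrier (TensorProduct.map (V.act.flip a) (V.iota ∘ₗ s)
        (X.coact x)) := by
  rw [ract_baseMap_eq]
  generalize X.coact x = t
  induction t using TensorProduct.induction_on with
  | zero => simp
  | add s t hs ht => simp only [map_add, hs, ht]
  | tmul h y => exact V.proj_lact_baseMap _ _ _ _

/-- `(h₁ a) ε_t(h₂) = h a` -/
theorem act_comul_target (h : H) (a : A.carrier) :
    LinearMap.mul' k A.carrier (TensorProduct.map (V.act.flip a) (V.iota ∘ₗ toTarget k H)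
      (comul (R := k) h)) = V.act h a :=
  (V.proj_ract_baseMap (X := regular k H) (toTarget k H) toTarget_regular_lact a h).symm

/-- `h (a b) = (h₁ a) (h₂ b)` -/
theorem act_mul (h : H) (a b : A.carrier) : V.act h (a * b)
    = LinearMap.mul' k A.carrier (TensorProduct.map (V.act.flip a) (V.act.flip b)
      (comul (R := k) h)) := by
  -- Act on h in F(H) by a, which gives (h₁·a) h₂, and then by b; the projection to A is left
  -- linear.
  refine (congrArg V.projTarget (Bimod.mul_ract _ a b (V.baseH h))).trans ?_
  rw [ract_baseH]
  generalize comul (R := k) h = t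
  induction t using TensorProduct.induction_on with
  | zero => simp
  | add s t hs ht => simp only [map_add, hs, ht]
  | tmul h y =>
    simp only [TensorProduct.lift.tmul, LinearMap.compl₁₂_apply, ← Bimod.lact_ract,
      projTarget_lact, TensorProduct.map_tmul, LinearMap.mul'_apply]
    rfl

/-- The base vector 1 of F(H) comes from the unit object along H^t ⊆ H. In F(1) ≅ A the left and
right actions of a on the unit agree, and this passes to F(H). -/
theorem one_act (a : A.carrier) : V.act 1 a = a := by
  have h1 : V.baseMap (regular k H) (1 : H)
      = Bimod.lin (V.functor.map (unitIncl k H)) (V.unitF 1) := by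
    refine Eq.trans ?_ (congrArg (Bimod.lin (V.functor.map (unitIncl k H))) V.baseMap_one)
    exact (V.map_baseMap (unitIncl k H) (1 : targetSubalgebra k H)).symm
  have h2 : (V.functor.obj (regular k H)).ract a (V.baseMap (regular k H) (1 : H))
      = (V.functor.obj (regular k H)).lact a (V.baseMap (regular k H) (1 : H)) := by
    refine (congrArg _ h1).trans (Eq.trans ?_ (congrArg _ h1).symm)
    refine ((V.functor.map (unitIncl k H)).map_ract a _).symm.trans
      (Eq.trans ?_ ((V.functor.map (unitIncl k H)).map_lact a _))
    refine congrArg _ ((V.unitF_mul' 1 a).symm.trans (Eq.trans ?_ (V.unitF_mul a 1)))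
    rw [one_mul, mul_one]
  rw [act_apply]
  refine (congrArg V.projTarget h2).trans ((V.projTarget_lact_baseMap a 1).trans ?_)
  rw [show toTarget k H 1 = 1 from Subtype.ext targetMap_one, iota_one, mul_one]

/-- `h (a z) = (h₁ a) ε_t(h₂ z)` -/
theorem act_mul_iota (h g : H) (a : A.carrier) :
    LinearMap.mul' k A.carrier (TensorProduct.map (V.act.flip a)
      (V.iota ∘ₗ toTarget k H ∘ₗ LinearMap.mulRight k g) (comul (R := k) h))
      = V.act h (a * V.iota (toTarget k H g)) := by
  rw [act_mul]
  congr 3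
  ext h'
  simp only [LinearMap.comp_apply, LinearMap.mulRight_apply, LinearMap.flip_apply, act_iota]
  exact congrArg V.iota (Subtype.ext (targetMap_mul_targetMap h' g).symm)

variable (k H) in
/-- The map `g ⊗ h ↦ ε_t(g h)` on `H ⊗_{H^t} H`. -/
noncomputable def mulTarget : (tensorObj (regular k H) (regular k H)).bimod.carrier →ₗ[k]
    targetSubalgebra k H :=
  Bimod.lift (M := (regular k H).bimod) (N := (regular k H).bimod)
    ((LinearMap.mul k H).compr₂ (toTarget k H)) fun (g : H) z (h : H) => by
      have h1 : (LinearMap.mul k H ((regular k H).bimod.ract z g) h : H) = g * z * h :=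
        congrArg (fun t => LinearMap.mul k H t h) (regular_ract z g)
      have h2 : (LinearMap.mul k H g ((regular k H).bimod.lact z h) : H) = g * (z * h) :=
        congrArg (LinearMap.mul k H g) (regular_lact z h)
      exact congrArg (toTarget k H) (h1.trans ((mul_assoc _ _ _).trans h2.symm))

theorem mulTarget_lact (z : targetSubalgebra k H)
    (t : (tensorObj (regular k H) (regular k H)).bimod.carrier) :
    mulTarget k H ((tensorObj (regular k H) (regular k H)).bimod.lact z t)
      = z * mulTarget k H t :=
  LinearMap.congr_fun (f := mulTarget k H ∘ₗ (Bimod.tensor (regular k H).bimod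
    (regular k H).bimod).lact z) (g := LinearMap.mulLeft k z ∘ₗ mulTarget k H)
    (Bimod.tensor_ext fun (g : H) (h : H) => Subtype.ext (by
      have h1 : (LinearMap.mul k H ((regular k H).bimod.lact z g) h : H) = z * g * h :=
        congrArg (fun t => LinearMap.mul k H t h) (regular_lact z g)
      refine (congrArg (targetMap k H) (h1.trans (mul_assoc _ _ _))).trans ?_
      exact targetMap_coe_mul z (g * h))) t

/-- `(g h) a = g (h a)` -/
theorem mul_act (g h : H) (a : A.carrier) : V.act (g * h) a = V.act g (V.act h a) := by
  let R := regular k H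
  -- `P` is the left linear map F(H ⊗ H) → A with c (x ⊗ y) ↦ c ε_t(x y). Both sides of the claim
  -- are `P` of (g ⊗ h) a.
  let P : Bimod.Space (V.functor.obj (tensorObj R R)) →ₗ[k] A.carrier :=
    V.proj (mulTarget k H) mulTarget_lact
  have hP : ∀ (c : A.carrier) (x y : H), P ((V.functor.obj (tensorObj R R)).lact c
      (V.mulF R R (V.baseH x) (V.baseH y))) = c * V.iota (toTarget k H (x * y)) := fun c x y =>
    (congrArg (fun t => P ((V.functor.obj (tensorObj R R)).lact c t))
      (V.mulF_baseMap (X := R) (Y := R) x y)).trans (V.proj_lact_baseMap _ _ _ _)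
  -- Treat g ⊗ h as one element of a comodule: its diagonal coaction multiplies to Δ(g) Δ(h) = Δ(g
  -- h).
  have h1 : P ((V.functor.obj (tensorObj R R)).ract a (V.mulF R R (V.baseH g) (V.baseH h)))
      = V.act (g * h) a := by
    have e : ∀ p q : H ⊗[k] H, TensorProduct.map (V.act.flip a) (V.iota ∘ₗ mulTarget k H)
        (codiag R.bimod R.bimod p q)
        = TensorProduct.map (V.act.flip a) (V.iota ∘ₗ toTarget k H) (p * q) := fun p q => by
      induction p using TensorProduct.induction_on with
      | zero => rw [zero_mul, map_zero]; exact map_zero _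
      | add s t hs ht =>
        rw [add_mul, map_add, ← hs, ← ht]
        exact (congrArg _ (LinearMap.map_add₂ (codiag R.bimod R.bimod) s t q)).trans (map_add _ _ _)
      | tmul x y =>
        induction q using TensorProduct.induction_on with
        | zero => rw [mul_zero, map_zero]; exact (congrArg _ (map_zero _)).trans (map_zero _)
        | add s t hs ht =>
          rw [mul_add, map_add, ← hs, ← ht]
          exact (congrArg _ (map_add (codiag R.bimod R.bimod _) s t)).trans (map_add _ _ _)
        | tmul x' y' => rw [Algebra.TensorProduct.tmul_mul_tmul]; rfl
    refine (congrArg (fun t => P ((V.functor.obj (tensorObj R R)).ract a t))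
      (V.mulF_baseMap (X := R) (Y := R) g h)).trans ((V.proj_ract_baseMap _ _ _ _).trans ?_)
    refine (congrArg (LinearMap.mul' k A.carrier) (e (comul g) (comul h))).trans ?_
    rw [← comul_mul, act_comul_target]
  -- Move a past one factor at a time: past h it becomes h₁·a, which then passes g. This leaves
  -- (g₁·(h₁·a)) ε_t(g₂ h₂) = g·((h₁·a) ε_t(h₂)).
  have h2 : P ((V.functor.obj (tensorObj R R)).ract a (V.mulF R R (V.baseH g) (V.baseH h)))
      = V.act g (V.act h a) := by
    rw [← V.mulF_ract, ract_baseH, ← V.act_comul_target h]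
    generalize comul (R := k) h = t
    induction t using TensorProduct.induction_on with
    | zero => simp
    | add s t hs ht => simp only [map_add, hs, ht]
    | tmul x y =>
      simp only [TensorProduct.lift.tmul, LinearMap.compl₁₂_apply, TensorProduct.map_tmul,
        LinearMap.mul'_apply, LinearMap.flip_apply, LinearMap.comp_apply]
      rw [← V.mulF_balanced, ract_baseH, ← act_mul_iota]
      generalize comul (R := k) g = s
      induction s using TensorProduct.induction_on with
      | zero => simp
      | add s t hs ht => simp only [map_add, LinearMap.add_apply, hs, ht]
      | tmul x' y' =>
        simp only [TensorProduct.lift.tmul, LinearMap.compl₁₂_apply, TensorProduct.map_tmul,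
          LinearMap.mul'_apply, LinearMap.flip_apply, LinearMap.comp_apply]
        exact (congrArg P (V.mulF_lact (X := R) (Y := R) _ _ _)).trans (hP _ _ _)
  exact h1.symm.trans h2

end FiberedAction

end BasedAct

/-! ### From based actions to module algebras: objects, morphisms, faithfulness. -/

namespace BasedAct

open Coalgebra WeakHopfAlgebra Functor.LaxMonoidal MonoidalCategoryStruct CoRep

variable {k H : Type u} [Field k] [Ring H] [Algebra k H] [WeakHopfAlgebra k H]
  [FiniteDimensional k H] {A B : Alg.{u} k}

namespace FiberedAction

variable (V : FiberedAction k H A)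

/-- The module structure on `A` defined by a based action over the weak fibre functor. -/
noncomputable abbrev toModule : Module H A.carrier where
  smul h a := V.act h a
  one_smul := V.one_act
  mul_smul := V.mul_act
  smul_zero h := map_zero (V.act h)
  smul_add h := map_add (V.act h)
  add_smul g h a := LinearMap.congr_fun (map_add V.act g h) a
  zero_smul a := LinearMap.congr_fun (map_zero V.act) a

/-- The module algebra defined by a based action over the weak fibre functor. -/
noncomputable def toModAlg : ModAlg k H :=
  letI := V.toModule
  { alg := A
    isScalarTower := ⟨fun c h a => LinearMap.congr_fun (map_smul V.act c h) a⟩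
    smul_mul := V.act_mul
    smul_one h := by
      refine (V.act_one h).trans (Eq.trans ?_ (V.act_one (targetMap k H h)).symm)
      exact congrArg V.iota (Subtype.ext (targetMap_targetMap h).symm) }

theorem act_coe_one (z : targetSubalgebra k H) : V.act (z : H) 1 = V.iota z :=
  (V.act_one z).trans (congrArg V.iota (Subtype.ext (targetMap_coe z)))

/-- Here z·1 = ι(z), and ι is injective because it is the base map of the unit object. -/
theorem faithful_toModAlg : ModAlg.faithful k H V.toModAlg := fun z w h =>
  V.iota_injective ((V.act_coe_one z).symm.trans (Eq.trans h (V.act_coe_one w)))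

end FiberedAction

namespace BasedBimod

variable (M : BasedBimod B A)

/-- The algebra homomorphism `a ↦ 1 a`. -/
def toAlgHom : A.carrier →ₐ[k] B.carrier :=
  AlgHom.ofLinearMap (M.act.flip 1) (M.one_act 1) fun a a' =>
    (M.mul_act a a' 1).trans (M.act_eq a' (M.act a 1))

/-- The map `B ⊗_A N → B`, `b ⊗ v ↦ b P(v)`, for a left linear map `P : N → A`. -/
def push {C : Alg.{u} k} {N : Bimod A C} (P : N.carrier →ₗ[k] A.carrier)
    (hP : ∀ a v, P (N.lact a v) = a * P v) :
    (Bimod.tensor M.bimod N).carrier →ₗ[k] B.carrier :=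
  Bimod.lift (M := M.bimod) (M.act.flip.compl₂ P) fun (b : B.carrier) a v => by
    change M.act (P v) (M.act a b) = M.act (P (N.lact a v)) b
    rw [hP, M.mul_act]

theorem push_tmul {C : Alg.{u} k} {N : Bimod A C} (P : N.carrier →ₗ[k] A.carrier)
    (hP : ∀ a v, P (N.lact a v) = a * P v) (b : B.carrier) (v : N.carrier) :
    M.push P hP (Bimod.tmul M.bimod N b v) = b * M.toAlgHom (P v) := M.act_eq _ _

end BasedBimod

namespace IsBasedHalfBraiding

variable {V : FiberedAction k H A} {W : FiberedAction k H B} {M : BasedBimod B A}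
  {σ : HalfBraiding W.functor V.functor M.bimod} 

/-- Left B-linearity extends the normalisation from base vectors to all b x. As these generate G(X),
a based half-braiding is unique. -/
theorem lact_baseMap (hσ : IsBasedHalfBraiding V W M σ) (X : CoRep k H) (b : B.carrier) (x : X.bimod.carrier) :
    Bimod.lin (σ.iso X).hom (Bimod.pure (W.functor.obj X) M.bimod
        ((W.functor.obj X).lact b (W.baseMap X x)) (1 : B.carrier))
      = Bimod.pure M.bimod (V.functor.obj X) b (V.baseMap X x) := by
  refine ((σ.iso X).hom.map_lact b (Bimod.pure (W.functor.obj X) M.bimod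
    (W.baseMap X x) (1 : B.carrier))).trans ?_
  refine (congrArg _ (hσ X x)).trans ?_
  exact congrArg (fun t : B.carrier => Bimod.pure M.bimod (V.functor.obj X) t (V.baseMap X x))
    (mul_one b)

/-- In G(1) the base vector z is also ι(z) times the base vector 1. The half-braiding sends the two
descriptions to 1 ⊗ z and ι(z) ⊗ 1, and F(1) ≅ A turns these into the two sides. -/
theorem toAlgHom_iota (hσ : IsBasedHalfBraiding V W M σ) (z : targetSubalgebra k H) :
    M.toAlgHom (V.iota z) = W.iota z := by
  let Q := M.push (N := V.functor.obj (tensorUnit (CoRep k H))) V.counitF V.counitF_lact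
  have h1 := congrArg Q (hσ (tensorUnit (CoRep k H)) z)
  have h2 := congrArg Q (hσ.lact_baseMap (tensorUnit (CoRep k H)) (W.iota z)
    (1 : targetSubalgebra k H))
  have h3 : (W.functor.obj (tensorUnit (CoRep k H))).lact (W.iota z)
      (W.baseMap (tensorUnit (CoRep k H)) (1 : targetSubalgebra k H))
      = W.baseMap (tensorUnit (CoRep k H)) z := by
    refine (congrArg _ W.baseMap_one).trans ((W.unitF_mul _ _).symm.trans ?_)
    rw [mul_one, W.unitF_iota]
  have h4 : Q (Bimod.pure M.bimod (V.functor.obj (tensorUnit (CoRep k H))) (W.iota z)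
      (V.baseMap (tensorUnit (CoRep k H)) (1 : targetSubalgebra k H))) = W.iota z := by
    refine (M.push_tmul V.counitF V.counitF_lact _ _).trans ?_
    have := V.iota_one
    refine (congrArg (fun t => W.iota z * M.toAlgHom t) this).trans ?_
    rw [map_one, mul_one]
  have h5 : Q (Bimod.pure M.bimod (V.functor.obj (tensorUnit (CoRep k H))) (1 : B.carrier)
      (V.baseMap (tensorUnit (CoRep k H)) z)) = M.toAlgHom (V.iota z) :=
    (M.push_tmul V.counitF V.counitF_lact _ _).trans (one_mul _)
  refine h5.symm.trans (h1.symm.trans (Eq.trans ?_ (h2.trans h4)))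
  exact congrArg (fun t => Q (Bimod.lin (σ.iso _).hom (Bimod.pure _ M.bimod t (1 : B.carrier))))
    h3.symm

/-- `a ↦ 1 a` is equivariant -/
theorem toAlgHom_act (hσ : IsBasedHalfBraiding V W M σ) (h : H) (a : A.carrier) :
    M.toAlgHom (V.act h a) = W.act h (M.toAlgHom a) := by
  let Q := M.push (N := V.functor.obj (regular k H)) V.projTarget V.projTarget_lact
  -- Through the half-braiding, the projection F(H) → A induces the projection G(H) → B; on b h both
  -- give b ε_t(h).
  have h1 : Q ∘ₗ Bimod.lin (σ.iso (regular k H)).hom ∘ₗ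
      (Bimod.pure (W.functor.obj (regular k H)) M.bimod).flip (1 : B.carrier) = W.projTarget :=
    W.hom_ext fun b h => by
      refine (congrArg Q (hσ.lact_baseMap (regular k H) b h)).trans ?_
      refine (M.push_tmul V.projTarget V.projTarget_lact _ _).trans
        (Eq.trans ?_ (W.projTarget_lact_baseMap b h).symm)
      rw [← hσ.toAlgHom_iota]
      refine congrArg (fun t => b * M.toAlgHom t) ?_
      refine (congrArg V.projTarget (Bimod.one_lact _ _).symm).trans ?_
      exact (V.projTarget_lact_baseMap 1 h).trans (one_mul _)
  -- Write θ(a) = 1 a. Evaluate at h θ(a): as h θ(a) ⊗ 1 = (h ⊗ 1) a, right linearity of the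
  -- half-braiding gives 1 ⊗ h a.
  have h2 := LinearMap.congr_fun h1 ((W.functor.obj (regular k H)).ract (M.toAlgHom a) (W.baseH h))
  refine Eq.trans ?_ h2
  have h3 : Bimod.pure (W.functor.obj (regular k H)) M.bimod
      ((W.functor.obj (regular k H)).ract (M.toAlgHom a) (W.baseH h)) (1 : B.carrier)
      = Bimod.ract _ a (Bimod.pure (W.functor.obj (regular k H)) M.bimod (W.baseH h)
        (1 : B.carrier)) :=
    (Bimod.ract_tmul (M := W.functor.obj (regular k H)) (N := M.bimod) _ _ _).trans
      (congrArg (Bimod.tmul (W.functor.obj (regular k H)) M.bimod (W.baseH h))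
        (mul_one (M.toAlgHom a)))
  have h4 : Bimod.lin (σ.iso (regular k H)).hom (Bimod.pure (W.functor.obj (regular k H)) M.bimod
      ((W.functor.obj (regular k H)).ract (M.toAlgHom a) (W.baseH h)) (1 : B.carrier))
      = Bimod.pure M.bimod (V.functor.obj (regular k H)) (1 : B.carrier)
        ((V.functor.obj (regular k H)).ract a (V.baseH h)) := by
    refine (congrArg _ h3).trans (((σ.iso (regular k H)).hom.map_ract a _).trans ?_)
    exact congrArg _ (hσ (regular k H) h)
  refine Eq.trans ?_ (congrArg Q h4).symm
  exact ((M.push_tmul V.projTarget V.projTarget_lact _ _).trans (one_mul _)).symm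

end IsBasedHalfBraiding

variable (k H) in
/-- The functor from based actions over the weak fibre functor to module algebras. -/
noncomputable def toModAlgFunctor : BasedAlg k H ⥤ (ModAlg.faithful k H).FullSubcategory where
  obj X := ⟨X.action.toModAlg, X.action.faithful_toModAlg⟩
  map {X Y} f := ObjectProperty.homMk
    (show X.action.toModAlg ⟶ Y.action.toModAlg from
      ⟨BasedAlg.Hom.toAlgHom f, fun h a => by
        obtain ⟨σ, hσ⟩ := f.braiding
        exact hσ.toAlgHom_act h a⟩)
  map_id X := ObjectProperty.hom_ext _ (ModAlg.Hom.ext (AlgHom.ext fun a => one_mul (M := X.alg.carrier) a))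
  map_comp f g := rfl

variable (k H) in
/-- `toModAlgFunctor` is compatible with the forgetful functors to algebras. -/
noncomputable def toModAlgFunctorForget :
    toModAlgFunctor k H ⋙ (ModAlg.faithful k H).ι ⋙ ModAlg.forget k H ≅ BasedAlg.forget k H :=
  NatIso.ofComponents (fun X => Iso.refl _) fun f => by
    exact (Category.comp_id _).trans (Category.id_comp _).symm

/-- A based bimodule is determined by the elements 1 a, since b a = b (1 a). -/
instance : (toModAlgFunctor k H).Faithful where
  map_injective {X Y f g} h := BasedAlg.Hom.ext (LinearMap.ext fun a => LinearMap.ext fun b => by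
    have h1 := congrArg (fun m => ModAlg.Hom.toAlgHom m.hom a) h
    exact (f.act_eq a b).trans ((congrArg (b * ·) h1).trans (g.act_eq a b).symm))

end BasedAct

/-! ### Semilinear maps between based actions -/

namespace BasedAct

open Coalgebra WeakHopfAlgebra Functor.LaxMonoidal MonoidalCategoryStruct CoRep

variable {k H : Type u} [Field k] [Ring H] [Algebra k H] [WeakHopfAlgebra k H]
  [FiniteDimensional k H] {A B : Alg.{u} k}

/-! ### Endomorphisms of the weak fibre functor on elements. -/

section fiberMap

variable (α : fiber k H ⟶ fiber k H) {X Y : CoRep k H}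

/-- The components of an endomorphism of the weak fibre functor. -/
def fiberMap (X : CoRep k H) : X.bimod.carrier →ₗ[k] X.bimod.carrier := (α.app X).hom

theorem fiberMap_naturality (f : X ⟶ Y) (x : X.bimod.carrier) :
    fiberMap α Y (Hom.toLin f x) = Hom.toLin f (fiberMap α X x) :=
  LinearMap.congr_fun (congrArg ModuleCat.Hom.hom (α.naturality f)) x

theorem fiberMap_tmul [NatTrans.IsMonoidal α] (x : X.bimod.carrier) (y : Y.bimod.carrier) :
    fiberMap α (tensorObj X Y) (Bimod.tmul X.bimod Y.bimod x y)
      = Bimod.tmul X.bimod Y.bimod (fiberMap α X x) (fiberMap α Y y) :=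
  LinearMap.congr_fun (congrArg ModuleCat.Hom.hom
    (NatTrans.IsMonoidal.tensor (τ := α) X Y)) (x ⊗ₜ[k] y)

theorem fiberMap_one [NatTrans.IsMonoidal α] :
    fiberMap α (tensorUnit (CoRep k H)) (1 : targetSubalgebra k H)
      = (1 : targetSubalgebra k H) := by
  have h := LinearMap.congr_fun (congrArg ModuleCat.Hom.hom
    (NatTrans.IsMonoidal.unit (τ := α))) (1 : k)
  have h1 : (1 : k) • (1 : targetSubalgebra k H) = 1 := one_smul _ _
  refine (congrArg (fiberMap α (tensorUnit (CoRep k H))) h1.symm).trans (Eq.trans h h1)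

/-- Naturality of α at H^t ⊗ X ≅ X, combined with monoidality. -/
theorem fiberMap_lact [NatTrans.IsMonoidal α] (z : targetSubalgebra k H) (x : X.bimod.carrier) :
    fiberMap α X (X.bimod.lact z x)
      = X.bimod.lact (fiberMap α (tensorUnit (CoRep k H)) z) (fiberMap α X x) :=
  (fiberMap_naturality α (leftUnitor X).hom
    (Bimod.tmul (tensorUnit (CoRep k H)).bimod X.bimod z x)).trans
    (congrArg (Hom.toLin (leftUnitor X).hom) (fiberMap_tmul α (X := tensorUnit (CoRep k H)) z x))

/-- The component at `H` of an endomorphism of the weak fibre functor. -/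
def fiberMapH : H →ₗ[k] H := fiberMap α (regular k H)

end fiberMap

namespace FiberedAction

/-- A homomorphism `θ` of algebras which is compatible with based actions up to a monoidal
endomorphism `α` of the weak fibre functor. -/
structure Twisted (V : FiberedAction k H A) (W : FiberedAction k H B)
    (θ : A.carrier →ₐ[k] B.carrier) (α : fiber k H ⟶ fiber k H) : Prop where
  isMonoidal : NatTrans.IsMonoidal α
  map_iota : ∀ z : targetSubalgebra k H,
    θ (V.iota z) = W.iota (fiberMap α (tensorUnit (CoRep k H)) z)
  map_act : ∀ (h : H) (a : A.carrier),
    (W.functor.obj (regular k H)).ract (θ a) (W.baseH (fiberMapH α h))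
      = TensorProduct.lift ((W.functor.obj (regular k H)).lact.compl₁₂
        (θ.toLinearMap ∘ₗ V.act.flip a) (W.baseH ∘ₗ fiberMapH α))
        (comul (R := k) h)

/-- Elements of `F(X)` are equal if they have the same images under all maps `X → H`. -/
theorem eq_of_coeffHom (V : FiberedAction k H A) {X : CoRep k H}
    {v w : Bimod.Space (V.functor.obj X)}
    (h : ∀ f, Bimod.lin (V.functor.map (coeffHom X f)) v
      = Bimod.lin (V.functor.map (coeffHom X f)) w) : v = w := by
  rw [← V.sum_projTarget v, ← V.sum_projTarget w]
  simp only [h]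

namespace Twisted

variable {V : FiberedAction k H A} {W : FiberedAction k H B} {θ : A.carrier →ₐ[k] B.carrier}
  {α : fiber k H ⟶ fiber k H} (T : Twisted V W θ α) {X Y : CoRep k H}

/-- The map `F(X) → G(X)`, `a x ↦ θ(a) α(x)`. -/
noncomputable def map (X : CoRep k H) :
    Bimod.Space (V.functor.obj X) →ₗ[k] Bimod.Space (W.functor.obj X) :=
  V.desc ((W.functor.obj X).lact.compl₁₂ θ.toLinearMap (W.baseMap X ∘ₗ fiberMap α X))
    fun a z x => by
      have := T.isMonoidal
      simp only [LinearMap.compl₁₂_apply, LinearMap.comp_apply, AlgHom.toLinearMap_apply, map_mul,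
        Bimod.mul_lact, T.map_iota]
      exact congrArg ((W.functor.obj X).lact (θ a)) ((W.lact_baseMap _ _).trans
        (congrArg (W.baseMap X) (fiberMap_lact α z x).symm))

theorem map_lact_baseMap (a : A.carrier) (x : X.bimod.carrier) :
    T.map X ((V.functor.obj X).lact a (V.baseMap X x))
      = (W.functor.obj X).lact (θ a) (W.baseMap X (fiberMap α X x)) :=
  V.desc_lact_baseMap _ _ a x

theorem map_baseMap (x : X.bimod.carrier) :
    T.map X (V.baseMap X x) = W.baseMap X (fiberMap α X x) := by
  have h := T.map_lact_baseMap 1 x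
  rwa [map_one θ, Bimod.one_lact, Bimod.one_lact] at h

theorem map_lact (a : A.carrier) (v : Bimod.Space (V.functor.obj X)) :
    T.map X ((V.functor.obj X).lact a v) = (W.functor.obj X).lact (θ a) (T.map X v) :=
  LinearMap.congr_fun (f := T.map X ∘ₗ (V.functor.obj X).lact a)
    (g := (W.functor.obj X).lact (θ a) ∘ₗ T.map X) (V.hom_ext fun c x => by
      simp only [LinearMap.comp_apply, ← Bimod.mul_lact, map_lact_baseMap, map_mul]) v

theorem map_naturality (f : X ⟶ Y) (v : Bimod.Space (V.functor.obj X)) :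
    T.map Y (Bimod.lin (V.functor.map f) v) = Bimod.lin (W.functor.map f) (T.map X v) :=
  LinearMap.congr_fun (f := T.map Y ∘ₗ Bimod.lin (V.functor.map f))
    (g := Bimod.lin (W.functor.map f) ∘ₗ T.map X) (V.hom_ext fun c x => by
      refine (congrArg (T.map Y) (((V.functor.map f).map_lact c _).trans
        (congrArg _ (V.map_baseMap f x)))).trans ?_
      refine (T.map_lact_baseMap c _).trans (Eq.trans ?_
        (congrArg (Bimod.lin (W.functor.map f)) (T.map_lact_baseMap c x)).symm)
      refine Eq.trans ?_ ((W.functor.map f).map_lact _ _).symm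
      exact congrArg ((W.functor.obj Y).lact (θ c)) ((congrArg (W.baseMap Y)
        (fiberMap_naturality α f x)).trans (W.map_baseMap f _).symm)) v

/-- Up to left linearity this is the condition `map_act` of `Twisted`, the only one that involves
right actions. -/
theorem map_ract_regular (a : A.carrier) (v : Bimod.Space (V.functor.obj (regular k H))) :
    T.map (regular k H) ((V.functor.obj (regular k H)).ract a v)
      = (W.functor.obj (regular k H)).ract (θ a) (T.map (regular k H) v) :=
  LinearMap.congr_fun (f := T.map (regular k H) ∘ₗ (V.functor.obj (regular k H)).ract a)
    (g := (W.functor.obj (regular k H)).ract (θ a) ∘ₗ T.map (regular k H))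
    (V.hom_ext fun c (h : H) => by
      change T.map (regular k H) ((V.functor.obj (regular k H)).ract a
        ((V.functor.obj (regular k H)).lact c (V.baseH h)))
        = (W.functor.obj (regular k H)).ract (θ a) (T.map (regular k H)
          ((V.functor.obj (regular k H)).lact c (V.baseH h)))
      rw [T.map_lact, ← Bimod.lact_ract, ← Bimod.lact_ract, T.map_lact]
      refine congrArg _ (Eq.trans ?_ ((T.map_act h a).symm.trans
        (congrArg _ (T.map_baseMap (X := regular k H) h).symm)))
      rw [ract_baseH]
      generalize comul (R := k) h = t
      induction t using TensorProduct.induction_on with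
      | zero => simp
      | add s t hs ht => simp only [map_add, hs, ht]
      | tmul x y => exact T.map_lact_baseMap (X := regular k H) _ y) v

/-- Coefficient maps X → H separate the elements of G(X), and the maps F(X) → G(X) are natural, so
the case X = H implies the rest. This is why `Twisted` constrains only the component of α at H. -/
theorem map_ract (a : A.carrier) (v : Bimod.Space (V.functor.obj X)) :
    T.map X ((V.functor.obj X).ract a v) = (W.functor.obj X).ract (θ a) (T.map X v) :=
  W.eq_of_coeffHom fun f => by
    refine (T.map_naturality _ _).symm.trans ((congrArg (T.map (regular k H))
      ((V.functor.map (coeffHom X f)).map_ract a v)).trans ((T.map_ract_regular a _).trans ?_))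
    refine Eq.trans ?_ ((W.functor.map (coeffHom X f)).map_ract _ _).symm
    exact congrArg _ (T.map_naturality _ _)

/-- On base vectors this is monoidality of α. A second factor a y is reduced to y by moving a into
the first factor, which requires right linearity. -/
theorem map_mulF (v : Bimod.Space (V.functor.obj X)) (w : Bimod.Space (V.functor.obj Y)) :
    T.map (tensorObj X Y) (V.mulF X Y v w) = W.mulF X Y (T.map X v) (T.map Y w) := by
  have := T.isMonoidal
  have h1 : ∀ (y : Y.bimod.carrier) v, T.map (tensorObj X Y) (V.mulF X Y v (V.baseMap Y y))
      = W.mulF X Y (T.map X v) (T.map Y (V.baseMap Y y)) := fun y =>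
    LinearMap.congr_fun (f := T.map (tensorObj X Y) ∘ₗ (V.mulF X Y).flip (V.baseMap Y y))
      (g := (W.mulF X Y).flip (T.map Y (V.baseMap Y y)) ∘ₗ T.map X) (V.hom_ext fun a x => by
        simp only [LinearMap.comp_apply, LinearMap.flip_apply, V.mulF_lact, T.map_lact,
          W.mulF_lact]
        refine congrArg ((W.functor.obj (tensorObj X Y)).lact (θ a)) ?_
        rw [T.map_baseMap, T.map_baseMap, W.mulF_baseMap]
        refine (congrArg (T.map (tensorObj X Y)) (V.mulF_baseMap x y)).trans
          ((T.map_baseMap _).trans ?_)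
        exact congrArg (W.baseMap (tensorObj X Y)) (fiberMap_tmul α x y))
  exact LinearMap.congr_fun (f := T.map (tensorObj X Y) ∘ₗ V.mulF X Y v)
    (g := W.mulF X Y (T.map X v) ∘ₗ T.map Y) (V.hom_ext fun a y => by
      simp only [LinearMap.comp_apply, T.map_lact]
      rw [← V.mulF_balanced, ← W.mulF_balanced, h1, T.map_ract]) w

theorem map_unitF (a : A.carrier) :
    T.map (tensorUnit (CoRep k H)) (V.unitF a) = W.unitF (θ a) := by
  have := T.isMonoidal
  have h1 : V.unitF a = Bimod.lact _ a (V.baseMap (tensorUnit (CoRep k H))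
      (1 : targetSubalgebra k H)) := by
    rw [baseMap_one, ← V.unitF_mul, mul_one]
  have h2 : W.unitF (θ a) = Bimod.lact _ (θ a) (W.baseMap (tensorUnit (CoRep k H))
      (1 : targetSubalgebra k H)) := by
    rw [baseMap_one, ← W.unitF_mul, mul_one]
  rw [h1, h2]
  refine (T.map_lact_baseMap a _).trans ?_
  exact congrArg (fun t => Bimod.lact _ (θ a) (W.baseMap (tensorUnit (CoRep k H)) t))
    (fiberMap_one α)

end Twisted

end FiberedAction

end BasedAct

/-! ### The half-braiding of an equivariant homomorphism, and fullness. -/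

namespace BasedAct

open Coalgebra WeakHopfAlgebra Functor.LaxMonoidal MonoidalCategoryStruct CoRep

variable {k H : Type u} [Field k] [Ring H] [Algebra k H] [WeakHopfAlgebra k H]
  [FiniteDimensional k H] {A B : Alg.{u} k}

/-- The based bimodule of an algebra homomorphism. -/
def BasedBimod.ofAlgHom (θ : A.carrier →ₐ[k] B.carrier) : BasedBimod B A where
  act := (LinearMap.mul k B.carrier).flip ∘ₗ θ.toLinearMap
  one_act b := by simp
  mul_act a a' b := by simp [mul_assoc]
  mul_act_right a b b' := (mul_assoc b b' (θ a)).symm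

namespace FiberedAction

open Bicategory

variable {V : FiberedAction k H A} {W : FiberedAction k H B} {θ : A.carrier →ₐ[k] B.carrier}

/-- An equivariant algebra homomorphism is compatible with the based actions. -/
theorem twisted_id (hθ : ∀ (h : H) (a : A.carrier), θ (V.act h a) = W.act h (θ a)) :
    Twisted V W θ (𝟙 (fiber k H)) where
  isMonoidal := inferInstance
  map_iota z := by
    rw [← act_coe_one, hθ, map_one θ, act_coe_one]
    rfl
  map_act h a := by
    have h1 : θ.toLinearMap ∘ₗ V.act.flip a = W.act.flip (θ a) := LinearMap.ext fun h => hθ h a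
    rw [h1]
    exact W.ract_baseH (θ a) h

namespace Twisted

variable (T : Twisted V W θ (𝟙 (fiber k H))) {X Y : CoRep k H}

/-- The map `M ⊗_A F(X) → G(X) ⊗_B M`, `b ⊗ v ↦ b v ⊗ 1`. -/
noncomputable def braidInvLin (X : CoRep k H) :
    Bimod.Space ((BasedBimod.ofAlgHom θ).bimod ≫ V.functor.obj X) →ₗ[k]
      Bimod.Space (W.functor.obj X ≫ (BasedBimod.ofAlgHom θ).bimod) :=
  Bimod.lift (M := (BasedBimod.ofAlgHom θ).bimod) (N := V.functor.obj X)
    (((W.functor.obj X).lact.compl₂ (T.map X)).compr₂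
      ((Bimod.tmul (W.functor.obj X) (BasedBimod.ofAlgHom θ).bimod).flip (1 : B.carrier)))
    fun (b : B.carrier) a v => by
      change Bimod.tmul _ (BasedBimod.ofAlgHom θ).bimod ((W.functor.obj X).lact (b * θ a) (T.map X v)) (1 : B.carrier)
        = Bimod.tmul _ (BasedBimod.ofAlgHom θ).bimod ((W.functor.obj X).lact b (T.map X _)) (1 : B.carrier)
      rw [T.map_lact, Bimod.mul_lact]

theorem braidInvLin_pure (b : B.carrier) (v : Bimod.Space (V.functor.obj X)) :
    T.braidInvLin X (Bimod.pure (BasedBimod.ofAlgHom θ).bimod (V.functor.obj X) b v)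
      = Bimod.pure (W.functor.obj X) (BasedBimod.ofAlgHom θ).bimod
        ((W.functor.obj X).lact b (T.map X v)) (1 : B.carrier) := rfl

/-- The homomorphism of bimodules `M ⊗_A F(X) → G(X) ⊗_B M`, `b ⊗ v ↦ b v ⊗ 1`. -/
noncomputable def braidInv (X : CoRep k H) :
    (BasedBimod.ofAlgHom θ).bimod ≫ V.functor.obj X ⟶
      W.functor.obj X ≫ (BasedBimod.ofAlgHom θ).bimod where
  toLin := T.braidInvLin X
  map_lact c := LinearMap.congr_fun (f := T.braidInvLin X ∘ₗ Bimod.lact _ c)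
    (g := Bimod.lact _ c ∘ₗ T.braidInvLin X) (Bimod.tensor_ext fun (b : B.carrier) v => by
      exact congrArg (fun t => Bimod.pure (W.functor.obj X) (BasedBimod.ofAlgHom θ).bimod t
        (1 : B.carrier)) (Bimod.mul_lact _ c b _))
  map_ract a := LinearMap.congr_fun (f := T.braidInvLin X ∘ₗ Bimod.ract _ a)
    (g := Bimod.ract _ a ∘ₗ T.braidInvLin X) (Bimod.tensor_ext fun (b : B.carrier) v => by
      refine (congrArg (fun t => Bimod.pure (W.functor.obj X) (BasedBimod.ofAlgHom θ).bimod
        ((W.functor.obj X).lact b t) (1 : B.carrier)) (T.map_ract a v)).trans ?_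
      refine (congrArg (fun t => Bimod.pure (W.functor.obj X) (BasedBimod.ofAlgHom θ).bimod
        t (1 : B.carrier)) (Bimod.lact_ract _ _ _ _)).trans ?_
      refine (Bimod.ract_tmul (M := W.functor.obj X) (N := (BasedBimod.ofAlgHom θ).bimod)
        _ (θ a) (1 : B.carrier)).trans ?_
      exact congrArg (Bimod.tmul (W.functor.obj X) (BasedBimod.ofAlgHom θ).bimod _)
        ((mul_one (θ a)).trans (one_mul (θ a)).symm))

/-- The map `G(X) → M ⊗_A F(X)`, `b x ↦ b ⊗ x`. -/
noncomputable def braidAux (X : CoRep k H) : Bimod.Space (W.functor.obj X) →ₗ[k]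
    Bimod.Space ((BasedBimod.ofAlgHom θ).bimod ≫ V.functor.obj X) :=
  W.desc ((Bimod.pure (BasedBimod.ofAlgHom θ).bimod (V.functor.obj X)).compl₂ (V.baseMap X))
    fun (b : B.carrier) z x => by
      change Bimod.tmul (BasedBimod.ofAlgHom θ).bimod (V.functor.obj X) (b * W.iota z : B.carrier) _
        = Bimod.tmul (BasedBimod.ofAlgHom θ).bimod (V.functor.obj X) (b : B.carrier) _
      have h1 : W.iota z = θ (V.iota z) := (T.map_iota z).symm
      rw [h1, ← V.lact_baseMap]
      exact Bimod.ract_tmul (M := (BasedBimod.ofAlgHom θ).bimod) (N := V.functor.obj X) b _ _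

theorem braidAux_lact_baseMap (b : B.carrier) (x : X.bimod.carrier) :
    T.braidAux X ((W.functor.obj X).lact b (W.baseMap X x))
      = Bimod.pure (BasedBimod.ofAlgHom θ).bimod (V.functor.obj X) b (V.baseMap X x) :=
  W.desc_lact_baseMap _ _ b x

/-- The map `G(X) ⊗_B M → M ⊗_A F(X)`. -/
noncomputable def braidLin (X : CoRep k H) :
    Bimod.Space (W.functor.obj X ≫ (BasedBimod.ofAlgHom θ).bimod) →ₗ[k]
      Bimod.Space ((BasedBimod.ofAlgHom θ).bimod ≫ V.functor.obj X) :=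
  Bimod.lift (M := W.functor.obj X) (N := (BasedBimod.ofAlgHom θ).bimod)
    ((W.functor.obj X).ract.flip.compr₂ (T.braidAux X)) fun v c (b : B.carrier) =>
      congrArg (T.braidAux X) (Bimod.mul_ract _ c b v).symm

/-- The isomorphism `M ⊗_A F(X) ≅ G(X) ⊗_B M`. -/
noncomputable def braidIso (X : CoRep k H) :
    (BasedBimod.ofAlgHom θ).bimod ≫ V.functor.obj X ≅
      W.functor.obj X ≫ (BasedBimod.ofAlgHom θ).bimod :=
  Bimod.isoMk (T.braidInv X)
    (T.braidLin X)
    (LinearMap.congr_fun (f := T.braidLin X ∘ₗ T.braidInvLin X) (g := LinearMap.id)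
      (Bimod.tensor_ext fun (b : B.carrier) v => by
        change T.braidAux X ((W.functor.obj X).ract 1 ((W.functor.obj X).lact b (T.map X v)))
          = Bimod.pure (BasedBimod.ofAlgHom θ).bimod (V.functor.obj X) b v
        rw [Bimod.one_ract]
        refine LinearMap.congr_fun (f := T.braidAux X ∘ₗ (W.functor.obj X).lact b ∘ₗ T.map X)
          (g := Bimod.pure (BasedBimod.ofAlgHom θ).bimod (V.functor.obj X) b)
          (V.hom_ext fun a x => ?_) v
        simp only [LinearMap.comp_apply]
        rw [T.map_lact_baseMap, ← Bimod.mul_lact]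
        refine (T.braidAux_lact_baseMap _ x).trans ?_
        exact Bimod.ract_tmul (M := (BasedBimod.ofAlgHom θ).bimod) (N := V.functor.obj X) b a _))
    (LinearMap.congr_fun (f := T.braidInvLin X ∘ₗ T.braidLin X) (g := LinearMap.id)
      (Bimod.tensor_ext fun v (b : B.carrier) => by
        change T.braidInvLin X (T.braidAux X ((W.functor.obj X).ract b v))
          = Bimod.pure (W.functor.obj X) (BasedBimod.ofAlgHom θ).bimod v b
        have h1 : T.braidInvLin X ∘ₗ T.braidAux X
            = (Bimod.pure (W.functor.obj X) (BasedBimod.ofAlgHom θ).bimod).flip (1 : B.carrier) :=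
          W.hom_ext fun c x => by
            refine (congrArg (T.braidInvLin X) (T.braidAux_lact_baseMap c x)).trans ?_
            refine (T.braidInvLin_pure c _).trans ?_
            exact congrArg (fun t => Bimod.pure (W.functor.obj X) (BasedBimod.ofAlgHom θ).bimod
              ((W.functor.obj X).lact c t) (1 : B.carrier)) (T.map_baseMap x)
        refine (LinearMap.congr_fun h1 _).trans ?_
        refine (Bimod.ract_tmul (M := W.functor.obj X) (N := (BasedBimod.ofAlgHom θ).bimod)
          v b (1 : B.carrier)).trans ?_
        exact congrArg (Bimod.tmul (W.functor.obj X) (BasedBimod.ofAlgHom θ).bimod v)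
          (mul_one b)))

/-- The half-braiding of an equivariant algebra homomorphism. -/
noncomputable def halfBraiding :
    HalfBraiding W.functor V.functor (BasedBimod.ofAlgHom θ).bimod where
  iso X := (T.braidIso X).symm
  naturality {X Y} f := by
    -- The inverse has the simple formula b ⊗ v ↦ b v ⊗ 1 on all elements, with v carried to G(X),
    -- so the axioms are checked for it and transported by cancellation.
    rw [← cancel_epi (T.braidIso X).hom, ← cancel_mono (T.braidIso Y).hom]
    simp only [Iso.symm_hom, Category.assoc, Iso.inv_hom_id, Category.comp_id,
      Iso.hom_inv_id_assoc]
    exact Bimod.hom_ext (Bimod.tensor_ext fun (b : B.carrier) v => by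
      have h1 := ((W.functor.map f).map_lact b (T.map X v)).trans
        (congrArg _ (T.map_naturality f v).symm)
      exact congrArg (fun t => Bimod.pure (W.functor.obj Y) (BasedBimod.ofAlgHom θ).bimod t
        (1 : B.carrier)) h1)
  tensor X Y := by
    -- The tensor axiom for the inverses: both sides send b ⊗ (v ⊗ w) to b (v w) ⊗ 1 because F → G
    -- is multiplicative.
    have h1 : (α_ _ _ _).inv ≫ (T.braidIso X).hom ▷ V.functor.obj Y ≫ (α_ _ _ _).hom ≫
        W.functor.obj X ◁ (T.braidIso Y).hom ≫ (α_ _ _ _).inv ≫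
        structMap W.functor X Y ▷ (BasedBimod.ofAlgHom θ).bimod
        = (BasedBimod.ofAlgHom θ).bimod ◁ structMap V.functor X Y ≫
          (T.braidIso (tensorObj X Y)).hom :=
      Bimod.hom_ext (Bimod.tensor_ext₃' fun (b : B.carrier) v w => by
        change Bimod.pure (W.functor.obj (tensorObj X Y)) (BasedBimod.ofAlgHom θ).bimod
            (W.mulF X Y ((W.functor.obj X).lact b (T.map X v))
              ((W.functor.obj Y).lact 1 (T.map Y w))) (1 : B.carrier)
          = Bimod.pure (W.functor.obj (tensorObj X Y)) (BasedBimod.ofAlgHom θ).bimod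
            ((W.functor.obj (tensorObj X Y)).lact b (T.map _ (V.mulF X Y v w))) (1 : B.carrier)
        rw [Bimod.one_lact, W.mulF_lact, T.map_mulF])
    simp only [Iso.symm_hom]
    rw [← cancel_mono (T.braidIso (tensorObj X Y)).hom]
    simp only [Category.assoc, Iso.inv_hom_id, Category.comp_id]
    rw [← h1]
    simp only [Iso.hom_inv_id_assoc, ← Bicategory.comp_whiskerRight_assoc, Iso.inv_hom_id,
      Bicategory.id_whiskerRight, Category.id_comp, Iso.inv_hom_id_assoc,
      ← Bicategory.whiskerLeft_comp_assoc, Bicategory.whiskerLeft_id]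

theorem isBasedHalfBraiding : IsBasedHalfBraiding V W (BasedBimod.ofAlgHom θ) T.halfBraiding :=
  fun X x => by
    change T.braidAux X ((W.functor.obj X).ract 1 (W.baseMap X x)) = _
    rw [Bimod.one_ract, ← Bimod.one_lact _ (W.baseMap X x)]
    exact T.braidAux_lact_baseMap 1 x

end Twisted

end FiberedAction

/-- An equivariant homomorphism is twisted by the identity of `F_H`, and the half-braiding built
from it is based. -/
instance : (toModAlgFunctor k H).Full where
  map_surjective {X Y} g := by
    let g' : X.action.toModAlg ⟶ Y.action.toModAlg := g.hom
    refine ⟨⟨BasedBimod.ofAlgHom g'.toAlgHom, _,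
      (FiberedAction.twisted_id g'.map_smul).isBasedHalfBraiding⟩, ?_⟩
    exact ObjectProperty.hom_ext _ (ModAlg.Hom.ext (AlgHom.ext fun a => one_mul _))

end BasedAct

/-! ### Equivalence of based actions -/

namespace BasedAct

open Coalgebra WeakHopfAlgebra Functor.LaxMonoidal MonoidalCategoryStruct CoRep

variable {k H : Type u} [Field k] [Ring H] [Algebra k H] [WeakHopfAlgebra k H]
  [FiniteDimensional k H] {A : Alg.{u} k}

theorem fiberMap_hom_inv (α : fiber k H ≅ fiber k H) (X : CoRep k H) (x : X.bimod.carrier) :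
    fiberMap α.inv X (fiberMap α.hom X x) = x :=
  LinearMap.congr_fun (congrArg ModuleCat.Hom.hom (α.hom_inv_id_app X)) x

theorem fiberMap_inv_hom (α : fiber k H ≅ fiber k H) (X : CoRep k H) (x : X.bimod.carrier) :
    fiberMap α.hom X (fiberMap α.inv X x) = x :=
  LinearMap.congr_fun (congrArg ModuleCat.Hom.hom (α.inv_hom_id_app X)) x

namespace FiberedAction

variable {V W : FiberedAction k H A}

namespace Twisted

variable {α : fiber k H ≅ fiber k H} (T : Twisted V W (AlgHom.id k A.carrier) α.hom)
  {X Y : CoRep k H}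

/-- The inverse of `F(X) → G(X)`, `a x ↦ a α(x)`. -/
noncomputable def mapInv (X : CoRep k H) :
    Bimod.Space (W.functor.obj X) →ₗ[k] Bimod.Space (V.functor.obj X) :=
  W.desc ((V.functor.obj X).lact.compl₂ (V.baseMap X ∘ₗ fiberMap α.inv X)) fun a z x => by
    have := T.isMonoidal
    have h1 : W.iota z = V.iota (fiberMap α.inv (tensorUnit (CoRep k H)) z) :=
      (congrArg W.iota (fiberMap_inv_hom α (tensorUnit (CoRep k H)) z).symm).trans
        (T.map_iota _).symm
    simp only [LinearMap.compl₂_apply, LinearMap.comp_apply, Bimod.mul_lact, h1]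
    exact congrArg ((V.functor.obj X).lact a) ((V.lact_baseMap _ _).trans
      (congrArg (V.baseMap X) (fiberMap_lact α.inv z x).symm))

/-- The isomorphism `F(X) ≅ G(X)`. -/
noncomputable def mapIso (X : CoRep k H) : V.functor.obj X ≅ W.functor.obj X :=
  Bimod.isoMk ⟨T.map X, T.map_lact, T.map_ract⟩ (T.mapInv X)
    (LinearMap.congr_fun (f := T.mapInv X ∘ₗ T.map X) (g := LinearMap.id)
      (V.hom_ext fun a x => (congrArg (T.mapInv X) (T.map_lact_baseMap a x)).trans
        ((W.desc_lact_baseMap _ _ _ _).trans (congrArg (fun t => (V.functor.obj X).lact a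
          (V.baseMap X t)) (fiberMap_hom_inv α X x)))))
    (LinearMap.congr_fun (f := T.map X ∘ₗ T.mapInv X) (g := LinearMap.id)
      (W.hom_ext fun a x => (congrArg (T.map X) (W.desc_lact_baseMap _ _ a x)).trans
        ((T.map_lact_baseMap _ _).trans (congrArg (fun t => (W.functor.obj X).lact a
          (W.baseMap X t)) (fiberMap_inv_hom α X x)))))

/-- The isomorphism is a x ↦ a α(x). It maps base spaces onto base spaces because α is invertible.
-/
theorem equivalent (T : Twisted V W (AlgHom.id k A.carrier) α.hom) :
    V.Equivalent W.toBasedAction := by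
  refine ⟨NatIso.ofComponents T.mapIso fun f => Bimod.hom_ext (LinearMap.ext fun v =>
    T.map_naturality f v), ⟨?_, fun X Y => ?_⟩, fun X => ?_⟩
  · exact Bimod.hom_ext (LinearMap.ext fun a => T.map_unitF a)
  · exact Bimod.hom_ext (Bimod.tensor_ext fun v w => T.map_mulF v w)
  · refine Eq.trans (b := (V.base X).map (T.map X)) rfl ?_
    rw [← V.range_baseMap, ← W.range_baseMap, ← LinearMap.range_comp]
    apply le_antisymm
    · rintro _ ⟨x, rfl⟩
      exact ⟨_, (T.map_baseMap x).symm⟩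
    · rintro _ ⟨x, rfl⟩
      exact ⟨fiberMap α.inv X x, (T.map_baseMap _).trans
        (congrArg (W.baseMap X) (fiberMap_inv_hom α X x))⟩

end Twisted

variable (V) in
/-- The map `A ⊗_{H^t} H → F(H)` for the module algebra of a based action. -/
noncomputable def canRegular : Bimod.Space (V.toModAlg.targetBimod ≫ (regular k H).bimod) →ₗ[k]
    Bimod.Space (V.functor.obj (regular k H)) :=
  Bimod.lift (M := V.toModAlg.targetBimod) (N := (regular k H).bimod)
    ((V.functor.obj (regular k H)).lact.compl₂ (V.baseMap (regular k H)))
    fun (a : A.carrier) z h => by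
      change (V.functor.obj (regular k H)).lact (a * V.act (z : H) 1) _
        = (V.functor.obj (regular k H)).lact a _
      rw [act_coe_one, Bimod.mul_lact, lact_baseMap]

variable (V) in
-- The J-twisted equation lives in A ⊗_{H^t} H, the condition of `Twisted` in F(H); injectivity
-- allows passing between them. The inverse is supplied by the universal property `desc` of F(H).
theorem canRegular_injective : Function.Injective V.canRegular := by
  have hs : ∀ (a : A.carrier) (z : targetSubalgebra k H) h,
      Bimod.tmul V.toModAlg.targetBimod (regular k H).bimod (a * V.iota z) h
        = Bimod.tmul V.toModAlg.targetBimod (regular k H).bimod a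
          ((regular k H).bimod.lact z h) := fun a z h => by
    have h1 : V.toModAlg.targetBimod.ract z a = a * V.iota z :=
      congrArg (a * ·) (V.act_coe_one z)
    exact (congrArg (fun t => Bimod.tmul V.toModAlg.targetBimod (regular k H).bimod t h)
      h1.symm).trans (Bimod.ract_tmul (M := V.toModAlg.targetBimod) a z h)
  let g : Bimod.Space (V.functor.obj (regular k H)) →ₗ[k]
      Bimod.Space (V.toModAlg.targetBimod ≫ (regular k H).bimod) :=
    V.desc (Bimod.tmul V.toModAlg.targetBimod (regular k H).bimod) hs
  have hg : g ∘ₗ V.canRegular = LinearMap.id := Bimod.tensor_ext fun a h =>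
    V.desc_lact_baseMap _ hs a h
  exact Function.LeftInverse.injective (g := g) (LinearMap.congr_fun hg)

/-- The injective map A ⊗_{H^t} H → G(H), where G is the functor of W, carries one equation to the
other, since x a = (x₁·a) x₂ in G(H). -/
theorem jTwisted_iff_twisted (α : fiber k H ≅ fiber k H) (h : H) (a : A.carrier) :
    (TensorProduct.lift (W.toModAlg.tmulRegular.compl₁₂ (V.act.flip a)
        (fiberMapH α.hom)) (comul (R := k) h)
      = TensorProduct.lift (W.toModAlg.tmulRegular.compl₁₂ (W.act.flip a) LinearMap.id)
          (comul (R := k) (fiberMapH α.hom h))) ↔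
    (W.functor.obj (regular k H)).ract a (W.baseH (fiberMapH α.hom h))
      = TensorProduct.lift ((W.functor.obj (regular k H)).lact.compl₁₂
        (V.act.flip a) (W.baseH ∘ₗ fiberMapH α.hom)) (comul (R := k) h) := by
  have e : ∀ (f : H →ₗ[k] A.carrier) (g : H →ₗ[k] H) (t : H ⊗[k] H),
      W.canRegular (TensorProduct.lift (W.toModAlg.tmulRegular.compl₁₂ f g) t)
        = TensorProduct.lift ((W.functor.obj (regular k H)).lact.compl₁₂ f (W.baseH ∘ₗ g)) t :=
    fun f g t => by
      induction t using TensorProduct.induction_on with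
      | zero => simp
      | add s t hs ht => simp only [map_add, hs, ht]
      | tmul x y => rfl
  rw [← W.canRegular_injective.eq_iff]
  refine (iff_of_eq (congrArg₂ (· = ·) (e _ _ _) (e _ _ _))).trans ?_
  rw [LinearMap.comp_id, ← ract_baseH, eq_comm]

theorem Twisted.jTwisted {α : fiber k H ≅ fiber k H}
    (T : Twisted V W (AlgHom.id k A.carrier) α.hom) :
    ModAlg.JTwisted V.toModAlg W.toModAlg (AlgEquiv.refl (R := k) (A₁ := A.carrier)) :=
  ⟨α, T.isMonoidal, fun z => by
    refine (V.act_coe_one z).trans ((T.map_iota z).trans ?_)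
    exact (W.act_coe_one _).symm,
    fun h a => (jTwisted_iff_twisted α h a).2 (T.map_act h a)⟩

theorem exists_twisted (h : ModAlg.JTwisted V.toModAlg W.toModAlg
    (AlgEquiv.refl (R := k) (A₁ := A.carrier))) :
    ∃ α : fiber k H ≅ fiber k H, Twisted V W (AlgHom.id k A.carrier) α.hom := by
  obtain ⟨α, h1, h2, h3⟩ := h
  exact ⟨α, h1, fun z => (V.act_coe_one z).symm.trans ((h2 z).trans (W.act_coe_one _)),
    fun h a => (jTwisted_iff_twisted α h a).1 (h3 h a)⟩

/-! ### The automorphism of the weak fibre functor defined by an equivalence. -/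

section equivalence

variable (η : V.functor ≅ W.functor)

theorem map_inv_base (hη : ∀ X, (V.base X).map (Bimod.lin (η.hom.app X)) = W.base X) (X : CoRep k H) (w) (hw : w ∈ W.base X) :
    Bimod.lin (η.inv.app X) w ∈ V.base X := by
  rw [← hη X] at hw
  obtain ⟨v, hv, rfl⟩ := hw
  exact (LinearMap.congr_fun (congrArg Bimod.lin (η.hom_inv_id_app X)) v).symm ▸ hv

variable (hη : ∀ X, (V.base X).map (Bimod.lin (η.hom.app X)) = W.base X)

/-- The isomorphism of lax monoidal functors defined by an equivalence of based actions. -/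
def inducedIso : V.induced ≅ W.induced where
  hom :=
    { app := fun X => ModuleCat.ofHom ((Bimod.lin (η.hom.app X)).restrict fun v hv =>
        hη X ▸ Submodule.mem_map_of_mem hv)
      naturality := fun _ _ f => ModuleCat.hom_ext (LinearMap.ext fun v => Subtype.ext
        (LinearMap.congr_fun (congrArg Bimod.lin (η.hom.naturality f)) v.1)) }
  inv :=
    { app := fun X => ModuleCat.ofHom ((Bimod.lin (η.inv.app X)).restrict (map_inv_base η hη X))
      naturality := fun _ _ f => ModuleCat.hom_ext (LinearMap.ext fun v => Subtype.ext
        (LinearMap.congr_fun (congrArg Bimod.lin (η.inv.naturality f)) v.1)) }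
  hom_inv_id := NatTrans.ext (funext fun X => ModuleCat.hom_ext (LinearMap.ext fun v =>
    Subtype.ext (LinearMap.congr_fun (congrArg Bimod.lin (η.hom_inv_id_app X)) v.1)))
  inv_hom_id := NatTrans.ext (funext fun X => ModuleCat.hom_ext (LinearMap.ext fun v =>
    Subtype.ext (LinearMap.congr_fun (congrArg Bimod.lin (η.inv_hom_id_app X)) v.1)))

theorem inducedIso_isMonoidal [NatTrans.IsMonoidal η.hom] :
    NatTrans.IsMonoidal (inducedIso η hη).hom where
  unit := ModuleCat.hom_ext (LinearMap.ext fun (c : k) => Subtype.ext (by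
    have h1 := LinearMap.congr_fun (congrArg Bimod.lin
      (NatTrans.IsMonoidal.unit (τ := η.hom))) (1 : A.carrier)
    exact (map_smul (Bimod.lin (η.hom.app _)) c _).trans (congrArg (c • ·) h1)))
  tensor X Y := ModuleCat.hom_ext (TensorProduct.ext' fun v w => Subtype.ext
    (LinearMap.congr_fun (congrArg Bimod.lin (NatTrans.IsMonoidal.tensor (τ := η.hom) X Y))
      (Bimod.pure _ _ v.1 w.1)))

/-- The automorphism of the weak fibre functor defined by an equivalence of based actions. -/
def fiberAut : fiber k H ≅ fiber k H :=
  V.identification ≪≫ inducedIso η hη ≪≫ W.identification.symm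

theorem baseMap_fiberAut (X : CoRep k H) (x : X.bimod.carrier) :
    W.baseMap X (fiberMap (fiberAut η hη).hom X x) = Bimod.lin (η.hom.app X) (V.baseMap X x) :=
  congrArg Subtype.val (LinearMap.congr_fun (congrArg ModuleCat.Hom.hom
    (W.identification.inv_hom_id_app X)) _)

/-- Apply η to the corresponding formulas for V: it is a bimodule map, respects units, and is α on
base vectors. -/
theorem twisted_fiberAut [NatTrans.IsMonoidal η.hom] :
    Twisted V W (AlgHom.id k A.carrier) (fiberAut η hη).hom where
  isMonoidal := by
    have := V.isMonoidal
    have := W.isMonoidal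
    have := inducedIso_isMonoidal η hη
    exact inferInstanceAs (NatTrans.IsMonoidal
      (V.identification.hom ≫ (inducedIso η hη).hom ≫ W.identification.inv))
  map_iota z := by
    have h1 := LinearMap.congr_fun (congrArg Bimod.lin
      (NatTrans.IsMonoidal.unit (τ := η.hom))) (V.iota z)
    have h2 := baseMap_fiberAut η hη (tensorUnit (CoRep k H)) z
    rw [← V.unitF_iota] at h2
    exact ((congrArg W.counitF (h2.trans h1)).trans (W.counitF_unitF _)).symm
  map_act h a := by
    have h1 : ∀ h : H, W.baseH (fiberMapH (fiberAut η hη).hom h)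
        = Bimod.lin (η.hom.app (regular k H)) (V.baseH h) :=
      fun h => baseMap_fiberAut η hη (regular k H) h
    refine (congrArg _ (h1 h)).trans (((η.hom.app (regular k H)).map_ract a _).symm.trans ?_)
    refine (congrArg (Bimod.lin (η.hom.app (regular k H))) (V.ract_baseH a h)).trans ?_
    generalize comul (R := k) h = t
    induction t using TensorProduct.induction_on with
    | zero => simp
    | add s t hs ht => simp only [map_add, hs, ht]
    | tmul x y =>
      exact ((η.hom.app (regular k H)).map_lact _ _).trans
        (congrArg ((W.functor.obj (regular k H)).lact (V.act x a)) (h1 y).symm)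

end equivalence

/-- Two based actions on an algebra are equivalent if and only if the module algebras are
`J`-twisted isomorphic along the identity. -/
theorem equivalent_iff_jTwisted (V W : FiberedAction k H A) :
    V.Equivalent W.toBasedAction ↔ ModAlg.JTwisted V.toModAlg W.toModAlg
      (AlgEquiv.refl (R := k) (A₁ := A.carrier)) := by
  constructor
  · rintro ⟨η, h1, h2⟩
    exact (twisted_fiberAut η h2).jTwisted
  · intro h
    obtain ⟨α, T⟩ := exists_twisted h
    exact T.equivalent

end FiberedAction

end BasedAct

/-! ### The based action of a module algebra -/

namespace BasedAct

open Coalgebra WeakHopfAlgebra MonoidalCategoryStruct CoRep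

variable {k H : Type u} [Field k] [Ring H] [Algebra k H] [WeakHopfAlgebra k H]
  [FiniteDimensional k H]

namespace ModAlg

variable (N : ModAlg k H) {X Y Z : CoRep k H}

theorem targetBimod_ract (z : targetSubalgebra k H) (a : N.alg.carrier) :
    N.targetBimod.ract z a = a * ((z : H) • (1 : N.alg.carrier)) := rfl

/-- The map `x ↦ 1 ⊗ x` to `A ⊗_{H^t} X`. -/
def unitTmul (X : CoRep k H) : X.bimod.carrier →ₗ[k]
    (Bimod.tensor N.targetBimod X.bimod).carrier :=
  Bimod.tmul N.targetBimod X.bimod (1 : N.alg.carrier)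

/-- A ⊗_{H^t} X is generated over A by the vectors 1 ⊗ x, so left linear maps need only be compared
on these. -/
theorem tmul_eq_lact (a : N.alg.carrier) (x : X.bimod.carrier) :
    Bimod.tmul N.targetBimod X.bimod a x
      = (Bimod.tensor N.targetBimod X.bimod).lact a (N.unitTmul X x) :=
  congrArg (fun t : N.alg.carrier => Bimod.tmul N.targetBimod X.bimod t x) (mul_one a).symm

theorem tensor_ext {P : Type*} [AddCommGroup P] [Module k P]
    {f g : (Bimod.tensor N.targetBimod X.bimod).carrier →ₗ[k] P}
    (h : ∀ a x, f ((Bimod.tensor N.targetBimod X.bimod).lact a (N.unitTmul X x))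
      = g ((Bimod.tensor N.targetBimod X.bimod).lact a (N.unitTmul X x))) : f = g :=
  Bimod.tensor_ext fun a x => (congrArg f (N.tmul_eq_lact a x)).trans
    ((h a x).trans (congrArg g (N.tmul_eq_lact a x)).symm)

theorem unitTmul_lact (z : targetSubalgebra k H) (x : X.bimod.carrier) :
    N.unitTmul X (X.bimod.lact z x)
      = (Bimod.tensor N.targetBimod X.bimod).lact ((z : H) • (1 : N.alg.carrier))
        (N.unitTmul X x) := by
  refine (Bimod.ract_tmul (M := N.targetBimod) (1 : N.alg.carrier) z x).symm.trans ?_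
  rw [targetBimod_ract, one_mul, tmul_eq_lact]

/-- The map `x ↦ (x₋₁ b) ⊗ x₀`. -/
def twist (X : CoRep k H) : N.alg.carrier →ₗ[k] X.bimod.carrier →ₗ[k]
    (Bimod.tensor N.targetBimod X.bimod).carrier :=
  LinearMap.mk₂ k (fun b x => TensorProduct.lift ((Bimod.tensor N.targetBimod X.bimod).lact.compl₁₂
      (orbit (H := H) b) (N.unitTmul X)) (X.coact x))
    (fun b c x => by
      have h1 : orbit (k := k) (H := H) (b + c) = orbit b + orbit c :=
        LinearMap.ext fun h => smul_add h b c
      generalize X.coact x = t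
      induction t using TensorProduct.induction_on with
      | zero => simp
      | add s t hs ht => simp only [map_add, hs, ht]; abel
      | tmul h y => simp [h1])
    (fun c b x => by
      have h1 : orbit (k := k) (H := H) (c • b) = c • orbit b :=
        LinearMap.ext fun h => (smul_algebra_smul_comm c h b :)
      generalize X.coact x = t
      induction t using TensorProduct.induction_on with
      | zero => simp
      | add s t hs ht => simp only [map_add, hs, ht, smul_add]
      | tmul h y => simp [h1])
    (fun b x y => by simp) (fun b c x => by simp)

theorem twist_apply (b : N.alg.carrier) (x : X.bimod.carrier) : N.twist X b x
    = TensorProduct.lift ((Bimod.tensor N.targetBimod X.bimod).lact.compl₁₂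
      (orbit (H := H) b) (N.unitTmul X)) (X.coact x) := rfl

/-- The coaction of z x is z x₋₁ ⊗ x₀, and (z h)·b = (z·1)(h·b). This makes the right action well
defined over H^t. -/
theorem twist_lact (b : N.alg.carrier) (z : targetSubalgebra k H) (x : X.bimod.carrier) :
    N.twist X b (X.bimod.lact z x)
      = (Bimod.tensor N.targetBimod X.bimod).lact ((z : H) • (1 : N.alg.carrier))
        (N.twist X b x) := by
  rw [twist_apply, twist_apply, coact_lact]
  generalize X.coact x = t
  induction t using TensorProduct.induction_on with
  | zero => simp
  | add s t hs ht => simp only [map_add, hs, ht]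
  | tmul h y =>
    simp only [LinearMap.rTensor_tmul, TensorProduct.lift.tmul, LinearMap.compl₁₂_apply,
      LinearMap.mulLeft_apply, ← Bimod.mul_lact, smul_one_mul]
    simp only [orbit, LinearMap.coe_restrictScalars, LinearMap.toSpanSingleton_apply, mul_smul]

/-- The right action of `A` on `A ⊗_{H^t} X`. -/
def ractLin (X : CoRep k H) : N.alg.carrier →ₗ[k]
    (Bimod.tensor N.targetBimod X.bimod).carrier →ₗ[k]
      (Bimod.tensor N.targetBimod X.bimod).carrier :=
  (Bimod.lift (M := N.targetBimod) (N := X.bimod) (LinearMap.mk₂ k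
    (fun (a : N.alg.carrier) x => (Bimod.tensor N.targetBimod X.bimod).lact a ∘ₗ (N.twist X).flip x)
    (fun a a' x => LinearMap.ext fun b =>
      LinearMap.map_add₂ (Bimod.tensor N.targetBimod X.bimod).lact a a' _)
    (fun c a x => LinearMap.ext fun b =>
      LinearMap.map_smul₂ (Bimod.tensor N.targetBimod X.bimod).lact c a _)
    (fun _ _ _ => by ext; simp) (fun _ _ _ => by ext; simp))
    fun (a : N.alg.carrier) z x => LinearMap.ext fun b => by
      change (Bimod.tensor N.targetBimod X.bimod).lact (a * ((z : H) • (1 : N.alg.carrier)))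
        (N.twist X b x) = (Bimod.tensor N.targetBimod X.bimod).lact a
          (N.twist X b (X.bimod.lact z x))
      rw [twist_lact, Bimod.mul_lact]).flip

theorem ractLin_lact (a b : N.alg.carrier) (t : (Bimod.tensor N.targetBimod X.bimod).carrier) :
    N.ractLin X b ((Bimod.tensor N.targetBimod X.bimod).lact a t)
      = (Bimod.tensor N.targetBimod X.bimod).lact a (N.ractLin X b t) :=
  LinearMap.congr_fun (f := N.ractLin X b ∘ₗ (Bimod.tensor N.targetBimod X.bimod).lact a)
    (g := (Bimod.tensor N.targetBimod X.bimod).lact a ∘ₗ N.ractLin X b)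
    (Bimod.tensor_ext fun c x => Bimod.mul_lact (Bimod.tensor N.targetBimod X.bimod) a c _) t

theorem ractLin_unitTmul (b : N.alg.carrier) (x : X.bimod.carrier) :
    N.ractLin X b (N.unitTmul X x) = N.twist X b x :=
  Bimod.one_lact (Bimod.tensor N.targetBimod X.bimod) (N.twist X b x)

/-- Since x₋₁·1 = ε_t(x₋₁)·1, this factor crosses the tensor sign and gives ε_t(x₋₁) x₀ = x. -/
theorem twist_one (x : X.bimod.carrier) : N.twist X 1 x = N.unitTmul X x := by
  conv_rhs => rw [← targetMap_coact X x]
  rw [twist_apply]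
  generalize X.coact x = t
  induction t using TensorProduct.induction_on with
  | zero => simp
  | add s t hs ht => simp only [map_add, hs, ht]
  | tmul h y =>
    simp only [TensorProduct.lift.tmul, LinearMap.compl₁₂_apply, LinearMap.comp_apply]
    rw [unitTmul_lact]
    exact congrArg (fun t => (Bimod.tensor N.targetBimod X.bimod).lact t (N.unitTmul X y))
      (N.smul_one h)

/-- By coassociativity the two actions use consecutive legs of x₋₁, and (h₁·b)(h₂·c) = h·(b c). -/
theorem ractLin_twist (b c : N.alg.carrier) (x : X.bimod.carrier) :
    N.ractLin X c (N.twist X b x) = N.twist X (b * c) x := by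
  let G : H ⊗[k] (H ⊗[k] X.bimod.carrier) →ₗ[k] (Bimod.tensor N.targetBimod X.bimod).carrier :=
    TensorProduct.lift ((Bimod.tensor N.targetBimod X.bimod).lact.compl₁₂ (orbit (H := H) b)
      (TensorProduct.lift ((Bimod.tensor N.targetBimod X.bimod).lact.compl₁₂
        (orbit (H := H) c) (N.unitTmul X))))
  have h1 : N.ractLin X c (N.twist X b x) = G (X.coact.lTensor H (X.coact x)) := by
    rw [twist_apply]
    generalize X.coact x = t
    induction t using TensorProduct.induction_on with
    | zero => simp
    | add s t hs ht => simp only [map_add, hs, ht]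
    | tmul h y =>
      simp only [TensorProduct.lift.tmul, LinearMap.compl₁₂_apply, ractLin_lact, ractLin_unitTmul]
      rfl
  rw [h1, coact_coassoc, twist_apply]
  congr 2
  refine LinearMap.ext fun h => LinearMap.ext fun y => ?_
  change G (TensorProduct.assoc k H H _ (comul (R := k) h ⊗ₜ y))
    = (Bimod.tensor N.targetBimod X.bimod).lact (h • (b * c)) (N.unitTmul X y)
  rw [N.smul_mul]
  generalize comul (R := k) h = t
  induction t using TensorProduct.induction_on with
  | zero => simp
  | add s t hs ht => simp only [map_add, TensorProduct.add_tmul, LinearMap.add_apply, hs, ht]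
  | tmul h h' => simp [G, Bimod.mul_lact]

/-- The `A`-bimodule `A ⊗_{H^t} X`, with `(a ⊗ x) b = a (x₋₁ b) ⊗ x₀`. -/
def freeBimod (X : CoRep k H) : Bimod N.alg N.alg where
  carrier := (Bimod.tensor N.targetBimod X.bimod).carrier
  lact := (Bimod.tensor N.targetBimod X.bimod).lact
  ract := N.ractLin X
  one_lact := (Bimod.tensor N.targetBimod X.bimod).one_lact
  mul_lact := (Bimod.tensor N.targetBimod X.bimod).mul_lact
  one_ract := LinearMap.congr_fun (g := LinearMap.id) (N.tensor_ext fun a x => by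
    rw [ractLin_lact, ractLin_unitTmul, twist_one]; rfl)
  mul_ract b c := LinearMap.congr_fun (g := N.ractLin X c ∘ₗ N.ractLin X b)
    (N.tensor_ext fun a x => by
      simp only [LinearMap.comp_apply, ractLin_lact, ractLin_unitTmul, ractLin_twist])
  lact_ract a b t := (N.ractLin_lact a b t).symm

/-- The linear map `A ⊗_{H^t} X → A ⊗_{H^t} Y` of a homomorphism of comodules. -/
def freeMapLin (f : X ⟶ Y) : (Bimod.tensor N.targetBimod X.bimod).carrier →ₗ[k]
    (Bimod.tensor N.targetBimod Y.bimod).carrier :=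
  Bimod.tensorMapLin (𝟙 N.targetBimod) (bimodMap f)

theorem freeMapLin_unitTmul (f : X ⟶ Y) (x : X.bimod.carrier) :
    N.freeMapLin f (N.unitTmul X x) = N.unitTmul Y (Hom.toLin f x) := rfl

theorem freeMapLin_lact (f : X ⟶ Y) (a : N.alg.carrier) (t) :
    N.freeMapLin f ((Bimod.tensor N.targetBimod X.bimod).lact a t)
      = (Bimod.tensor N.targetBimod Y.bimod).lact a (N.freeMapLin f t) :=
  (Bimod.tensorMap (𝟙 N.targetBimod) (bimodMap f)).map_lact a t

theorem freeMapLin_twist (f : X ⟶ Y) (b : N.alg.carrier) (x : X.bimod.carrier) :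
    N.freeMapLin f (N.twist X b x) = N.twist Y b (Hom.toLin f x) := by
  rw [twist_apply, twist_apply, f.map_coact]
  generalize X.coact x = t
  induction t using TensorProduct.induction_on with
  | zero => simp
  | add s t hs ht => simp only [map_add, hs, ht]
  | tmul h y => exact N.freeMapLin_lact f (h • b) (N.unitTmul X y)

/-- The homomorphism of `A`-bimodules defined by a homomorphism of comodules. -/
def freeMap (f : X ⟶ Y) : N.freeBimod X ⟶ N.freeBimod Y where
  toLin := N.freeMapLin f
  map_lact := N.freeMapLin_lact f
  map_ract b := LinearMap.congr_fun (f := N.freeMapLin f ∘ₗ N.ractLin X b)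
    (g := N.ractLin Y b ∘ₗ N.freeMapLin f) (N.tensor_ext fun a x => by
      simp only [LinearMap.comp_apply, ractLin_lact, freeMapLin_lact, ractLin_unitTmul,
        freeMapLin_twist, freeMapLin_unitTmul])

/-- The functor `X ↦ A ⊗_{H^t} X`. -/
def freeFunctor : CoRep k H ⥤ (N.alg ⟶ N.alg) where
  obj X := N.freeBimod X
  map f := N.freeMap f
  map_id X := Bimod.hom_ext (Bimod.tensor_ext fun _ _ => rfl)
  map_comp f g := Bimod.hom_ext (Bimod.tensor_ext fun _ _ => rfl)

end ModAlg

end BasedAct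

/-! ### The isomorphism F(X) ⊗_A F(Y) ≅ F(X ⊗ Y) for F(X) = A ⊗_{H^t} X. -/

namespace BasedAct

open Coalgebra WeakHopfAlgebra MonoidalCategoryStruct CoRep

variable {k H : Type u} [Field k] [Ring H] [Algebra k H] [WeakHopfAlgebra k H]
  [FiniteDimensional k H]

namespace ModAlg

variable (N : ModAlg k H) {X Y Z X' Y' : CoRep k H}

/-- The vector space `A ⊗_{H^t} X`. -/
abbrev Free (X : CoRep k H) : Type u := (Bimod.tensor N.targetBimod X.bimod).carrier

/-- The left action of `A` on `A ⊗_{H^t} X`. -/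
abbrev freeLact (X : CoRep k H) : N.alg.carrier →ₗ[k] N.Free X →ₗ[k] N.Free X :=
  (Bimod.tensor N.targetBimod X.bimod).lact

/-- As h·(z·1) = (h z)·1 and the coaction of x z is x₋₁ z ⊗ x₀, the element z is absorbed into x;
then `twist_one` applies. -/
theorem twist_coe (z : targetSubalgebra k H) (x : X.bimod.carrier) :
    N.twist X ((z : H) • (1 : N.alg.carrier)) x = N.unitTmul X (X.bimod.ract z x) := by
  rw [← twist_one, twist_apply, twist_apply, coact_ract]
  generalize X.coact x = t
  induction t using TensorProduct.induction_on with
  | zero => simp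
  | add s t hs ht => simp only [map_add, hs, ht]
  | tmul h y => simp [orbit, mul_smul]

/-- The right action of A extends that of H^t on X, so balancing over A in F(X) ⊗_A F(Y) is
compatible with balancing over H^t in (A ⊗_{H^t} X) ⊗_{H^t} Y. -/
theorem ractLin_coe (z : targetSubalgebra k H) (t : N.Free X) :
    N.ractLin X ((z : H) • (1 : N.alg.carrier)) t
      = (Bimod.tensor N.targetBimod X.bimod).ract z t :=
  LinearMap.congr_fun (N.tensor_ext fun a x => by
    rw [ractLin_lact, ractLin_unitTmul, twist_coe, ← Bimod.lact_ract]
    rfl) t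

/-- The map `(a ⊗ x, y) ↦ a ⊗ (x ⊗ y)`. -/
def join (X Y : CoRep k H) : N.Free X →ₗ[k] Y.bimod.carrier →ₗ[k] N.Free (tensorObj X Y) :=
  (Bimod.tmul (Bimod.tensor N.targetBimod X.bimod) Y.bimod).compr₂
    (Bimod.assocLin N.targetBimod X.bimod Y.bimod)

theorem join_lact (a : N.alg.carrier) (t : N.Free X) (y : Y.bimod.carrier) :
    N.join X Y (N.freeLact X a t) y = N.freeLact (tensorObj X Y) a (N.join X Y t y) :=
  (Bimod.assocHom N.targetBimod X.bimod Y.bimod).map_lact a (Bimod.tmul _ _ t y)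

theorem join_ractLin_coe (t : N.Free X) (z : targetSubalgebra k H) (y : Y.bimod.carrier) :
    N.join X Y (N.ractLin X ((z : H) • (1 : N.alg.carrier)) t) y
      = N.join X Y t (Y.bimod.lact z y) := by
  rw [ractLin_coe]
  exact congrArg (Bimod.assocLin N.targetBimod X.bimod Y.bimod) (Bimod.ract_tmul t z y)

theorem ractLin_mul (b c : N.alg.carrier) (t : N.Free X) :
    N.ractLin X (b * c) t = N.ractLin X c (N.ractLin X b t) := (N.freeBimod X).mul_ract b c t

theorem ractLin_one (t : N.Free X) : N.ractLin X 1 t = t := (N.freeBimod X).one_ract t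

/-- The map `(t, b ⊗ y) ↦ (t b) ⊗ y`. -/
def freeMul (X Y : CoRep k H) : N.Free X →ₗ[k] N.Free Y →ₗ[k] N.Free (tensorObj X Y) :=
  (Bimod.lift (M := N.targetBimod) (N := Y.bimod) (LinearMap.mk₂ k
    (fun (b : N.alg.carrier) y => (N.join X Y).flip y ∘ₗ N.ractLin X b)
    (fun b b' y => LinearMap.ext fun t => (congrArg (fun t => N.join X Y t y)
      (LinearMap.map_add₂ (N.ractLin X) b b' t)).trans (LinearMap.map_add₂ (N.join X Y) _ _ y))
    (fun c b y => LinearMap.ext fun t => (congrArg (fun t => N.join X Y t y)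
      (LinearMap.map_smul₂ (N.ractLin X) c b t)).trans (LinearMap.map_smul₂ (N.join X Y) _ _ y))
    (fun b y y' => LinearMap.ext fun t => map_add (N.join X Y _) y y')
    (fun c b y => LinearMap.ext fun t => map_smul (N.join X Y _) c y))
    fun (b : N.alg.carrier) z y => LinearMap.ext fun t => by
      change N.join X Y (N.ractLin X (b * ((z : H) • (1 : N.alg.carrier))) t) y
        = N.join X Y (N.ractLin X b t) (Y.bimod.lact z y)
      rw [ractLin_mul, join_ractLin_coe]).flip

theorem freeMul_tmul (t : N.Free X) (b : N.alg.carrier) (y : Y.bimod.carrier) :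
    N.freeMul X Y t (Bimod.tmul N.targetBimod Y.bimod b y)
      = N.join X Y (N.ractLin X b t) y := rfl

theorem freeMul_unitTmul (t : N.Free X) (y : Y.bimod.carrier) :
    N.freeMul X Y t (N.unitTmul Y y) = N.join X Y t y := by
  refine (N.freeMul_tmul t 1 y).trans ?_
  rw [ractLin_one]

theorem freeMul_balanced (t : N.Free X) (c : N.alg.carrier) (s : N.Free Y) :
    N.freeMul X Y (N.ractLin X c t) s = N.freeMul X Y t (N.freeLact Y c s) :=
  LinearMap.congr_fun (f := N.freeMul X Y (N.ractLin X c t))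
    (g := N.freeMul X Y t ∘ₗ N.freeLact Y c) (Bimod.tensor_ext fun (b : N.alg.carrier) y => by
      change N.join X Y (N.ractLin X b (N.ractLin X c t)) y = N.join X Y (N.ractLin X (c * b) t) y
      rw [ractLin_mul]) s

theorem freeMul_lact_unitTmul (t : N.Free X) (b : N.alg.carrier) (y : Y.bimod.carrier) :
    N.freeMul X Y t (N.freeLact Y b (N.unitTmul Y y)) = N.join X Y (N.ractLin X b t) y := by
  rw [← freeMul_balanced, freeMul_unitTmul]

theorem freeMul_lact (a : N.alg.carrier) (t : N.Free X) (s : N.Free Y) :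
    N.freeMul X Y (N.freeLact X a t) s = N.freeLact (tensorObj X Y) a (N.freeMul X Y t s) :=
  LinearMap.congr_fun (f := N.freeMul X Y (N.freeLact X a t))
    (g := N.freeLact (tensorObj X Y) a ∘ₗ N.freeMul X Y t) (N.tensor_ext fun b y => by
      simp only [LinearMap.comp_apply, freeMul_lact_unitTmul, ractLin_lact, join_lact]) s

/-- Moving c past y and then past x produces x₋₁·(y₋₁·c) = (x₋₁ y₋₁)·c, the action through the
diagonal coaction of x ⊗ y. -/
theorem freeMul_unitTmul_twist (x : X.bimod.carrier) (c : N.alg.carrier) (y : Y.bimod.carrier) :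
    N.freeMul X Y (N.unitTmul X x) (N.twist Y c y)
      = N.twist (tensorObj X Y) c (Bimod.tmul X.bimod Y.bimod x y) := by
  refine Eq.trans (b := TensorProduct.lift ((N.freeLact (tensorObj X Y)).compl₁₂
    (orbit (H := H) c) (N.unitTmul (tensorObj X Y)))
      (codiag X.bimod Y.bimod (X.coact x) (Y.coact y))) ?_ rfl
  rw [twist_apply]
  generalize Y.coact y = s
  induction s using TensorProduct.induction_on with
  | zero =>
    rw [map_zero, map_zero]
    exact ((congrArg _ (map_zero (codiag X.bimod Y.bimod (X.coact x)))).trans (map_zero _)).symm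
  | add s t hs ht =>
    rw [map_add, map_add, hs, ht]
    exact ((congrArg _ (map_add (codiag X.bimod Y.bimod (X.coact x)) s t)).trans
      (map_add _ _ _)).symm
  | tmul h y =>
    simp only [TensorProduct.lift.tmul, LinearMap.compl₁₂_apply]
    refine (N.freeMul_lact_unitTmul _ _ y).trans ?_
    rw [ractLin_unitTmul, twist_apply]
    generalize X.coact x = s
    induction s using TensorProduct.induction_on with
    | zero =>
      rw [map_zero, LinearMap.map_zero₂]
      exact ((congrArg _ (LinearMap.map_zero₂ (codiag X.bimod Y.bimod) (h ⊗ₜ y))).trans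
        (map_zero _)).symm
    | add s t hs ht =>
      rw [map_add, LinearMap.map_add₂, hs, ht]
      exact ((congrArg _ (LinearMap.map_add₂ (codiag X.bimod Y.bimod) s t (h ⊗ₜ y))).trans
        (map_add _ _ _)).symm
    | tmul g x =>
      refine (N.join_lact (g • h • c) (N.unitTmul X x) y).trans ?_
      exact congrArg (fun t => N.freeLact (tensorObj X Y) t
        (N.unitTmul (tensorObj X Y) (Bimod.tmul X.bimod Y.bimod x y))) (mul_smul g h c).symm

/-- Left linearity in t and moving the coefficient of s into t reduce this to vectors 1 ⊗ x and 1 ⊗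
y, the preceding lemma. -/
theorem freeMul_ract (t : N.Free X) (c : N.alg.carrier) (s : N.Free Y) :
    N.freeMul X Y t (N.ractLin Y c s) = N.ractLin (tensorObj X Y) c (N.freeMul X Y t s) := by
  have h1 : ∀ (t : N.Free X) (y : Y.bimod.carrier), N.freeMul X Y t (N.twist Y c y)
      = N.ractLin (tensorObj X Y) c (N.join X Y t y) := fun t y =>
    LinearMap.congr_fun (f := (N.freeMul X Y).flip (N.twist Y c y))
      (g := N.ractLin (tensorObj X Y) c ∘ₗ (N.join X Y).flip y) (N.tensor_ext fun a x => by
        simp only [LinearMap.flip_apply, LinearMap.comp_apply, freeMul_lact, join_lact,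
          freeMul_unitTmul_twist]
        refine Eq.trans ?_ (N.ractLin_lact _ _ _).symm
        exact congrArg (N.freeLact (tensorObj X Y) a) (N.ractLin_unitTmul c _).symm) t
  exact LinearMap.congr_fun (f := N.freeMul X Y t ∘ₗ N.ractLin Y c)
    (g := N.ractLin (tensorObj X Y) c ∘ₗ N.freeMul X Y t) (N.tensor_ext fun b y => by
      simp only [LinearMap.comp_apply, ractLin_lact, ractLin_unitTmul, freeMul_lact_unitTmul]
      rw [← freeMul_balanced, h1]) s

/-- The linear map `F(X) ⊗_A F(Y) → F(X ⊗ Y)` for `F(X) = A ⊗_{H^t} X`. -/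
def freeMulLin (X Y : CoRep k H) :
    (Bimod.tensor (N.freeBimod X) (N.freeBimod Y)).carrier →ₗ[k] N.Free (tensorObj X Y) :=
  Bimod.lift (M := N.freeBimod X) (N := N.freeBimod Y) (N.freeMul X Y) N.freeMul_balanced

/-- The map `F(X) ⊗_A F(Y) → F(X ⊗ Y)` for `F(X) = A ⊗_{H^t} X`. -/
def freeMulHom (X Y : CoRep k H) : Bimod.tensor (N.freeBimod X) (N.freeBimod Y) ⟶
    N.freeBimod (tensorObj X Y) where
  toLin := N.freeMulLin X Y
  map_lact a := LinearMap.congr_fun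
    (f := N.freeMulLin X Y ∘ₗ (Bimod.tensor (N.freeBimod X) (N.freeBimod Y)).lact a)
    (g := N.freeLact (tensorObj X Y) a ∘ₗ N.freeMulLin X Y)
    (Bimod.tensor_ext fun t s => N.freeMul_lact a t s)
  map_ract a := LinearMap.congr_fun
    (f := N.freeMulLin X Y ∘ₗ (Bimod.tensor (N.freeBimod X) (N.freeBimod Y)).ract a)
    (g := N.ractLin (tensorObj X Y) a ∘ₗ N.freeMulLin X Y)
    (Bimod.tensor_ext fun t s => N.freeMul_ract t a s)

/-- The map `F(X ⊗ Y) → F(X) ⊗_A F(Y)` for `F(X) = A ⊗_{H^t} X`. -/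
def freeSplit (X Y : CoRep k H) : N.Free (tensorObj X Y) →ₗ[k]
    (Bimod.tensor (N.freeBimod X) (N.freeBimod Y)).carrier :=
  Bimod.lift (M := Bimod.tensor N.targetBimod X.bimod) (N := Y.bimod)
    ((Bimod.tmul (N.freeBimod X) (N.freeBimod Y)).compl₂ (N.unitTmul Y)) (fun t z y => by
      change Bimod.tmul (N.freeBimod X) (N.freeBimod Y) _ _ = Bimod.tmul _ _ _ (N.unitTmul Y _)
      rw [unitTmul_lact, ← ractLin_coe]
      exact Bimod.ract_tmul (M := N.freeBimod X) (N := N.freeBimod Y) t _ _) ∘ₗ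
  Bimod.assocInv N.targetBimod X.bimod Y.bimod

theorem freeSplit_join (t : N.Free X) (y : Y.bimod.carrier) : N.freeSplit X Y (N.join X Y t y)
    = Bimod.tmul (N.freeBimod X) (N.freeBimod Y) t (N.unitTmul Y y) := by
  have h1 := LinearMap.congr_fun (congrArg Bimod.Hom.toLin
    (Bimod.assoc N.targetBimod X.bimod Y.bimod).hom_inv_id)
    (Bimod.tmul (Bimod.tensor N.targetBimod X.bimod) Y.bimod t y)
  exact (congrArg _ h1).trans rfl

/-- Over A the coefficient of b ⊗ y moves into t, so F(X) ⊗_A F(Y) is spanned by tensors t ⊗ (1 ⊗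
y). -/
theorem freeSplit_freeMul (t : N.Free X) (s : N.Free Y) : N.freeSplit X Y (N.freeMul X Y t s)
    = Bimod.tmul (N.freeBimod X) (N.freeBimod Y) t s :=
  LinearMap.congr_fun (f := N.freeSplit X Y ∘ₗ N.freeMul X Y t)
    (g := Bimod.tmul (N.freeBimod X) (N.freeBimod Y) t) (N.tensor_ext fun b y => by
      refine (congrArg (N.freeSplit X Y) (N.freeMul_lact_unitTmul t b y)).trans ?_
      rw [freeSplit_join]
      exact Bimod.ract_tmul (M := N.freeBimod X) (N := N.freeBimod Y) t b _) s

theorem freeMulLin_freeSplit_join (t : N.Free X) (y : Y.bimod.carrier) :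
    N.freeMulLin X Y (N.freeSplit X Y (N.join X Y t y)) = N.join X Y t y := by
  rw [freeSplit_join]
  exact N.freeMul_unitTmul t y

/-- The isomorphism `F(X) ⊗_A F(Y) ≅ F(X ⊗ Y)` for `F(X) = A ⊗_{H^t} X`. -/
def freeMulIso (X Y : CoRep k H) : Bimod.tensor (N.freeBimod X) (N.freeBimod Y) ≅
    N.freeBimod (tensorObj X Y) :=
  Bimod.isoMk (N.freeMulHom X Y) (N.freeSplit X Y)
    (LinearMap.congr_fun (f := N.freeSplit X Y ∘ₗ N.freeMulLin X Y) (g := LinearMap.id)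
      (Bimod.tensor_ext (M := N.freeBimod X) (N := N.freeBimod Y) fun t s =>
        N.freeSplit_freeMul t s))
    (LinearMap.congr_fun (f := N.freeMulLin X Y ∘ₗ N.freeSplit X Y) (g := LinearMap.id)
      (Bimod.tensor_ext₃' fun a x y =>
        N.freeMulLin_freeSplit_join (Bimod.tmul N.targetBimod X.bimod a x) y))

end ModAlg

end BasedAct

/-! ### Unit and coherence, the based action of a module algebra, and essential surjectivity. -/

namespace BasedAct

open Coalgebra WeakHopfAlgebra MonoidalCategoryStruct CoRep

variable {k H : Type u} [Field k] [Ring H] [Algebra k H] [WeakHopfAlgebra k H]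
  [FiniteDimensional k H]

namespace ModAlg

variable (N : ModAlg k H) {X Y Z X' Y' : CoRep k H}

/-- The map `A ⊗_{H^t} H^t → A`. -/
def freeCounit : N.Free (tensorUnit (CoRep k H)) →ₗ[k] N.alg.carrier :=
  Bimod.rightUnitLin N.targetBimod

theorem freeCounit_tmul (a : N.alg.carrier) (z : targetSubalgebra k H) :
    N.freeCounit (Bimod.tmul N.targetBimod (tensorUnit (CoRep k H)).bimod a z)
      = a * ((z : H) • (1 : N.alg.carrier)) := rfl

theorem freeCounit_unitTmul (z : targetSubalgebra k H) :
    N.freeCounit (N.unitTmul (tensorUnit (CoRep k H)) z) = (z : H) • (1 : N.alg.carrier) :=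
  one_mul _

theorem freeCounit_lact (a : N.alg.carrier) (t : N.Free (tensorUnit (CoRep k H))) :
    N.freeCounit (N.freeLact _ a t) = a * N.freeCounit t :=
  (Bimod.rightUnit N.targetBimod).hom.map_lact a t

/-- The coaction of H^t is Δ, so this is the module algebra identity z·(b 1) = (z₁·b)(z₂·1). -/
theorem freeCounit_twist (b : N.alg.carrier) (z : targetSubalgebra k H) :
    N.freeCounit (N.twist (tensorUnit (CoRep k H)) b z) = (z : H) • b := by
  have h1 : ∀ t : H ⊗[k] targetSubalgebra k H, N.freeCounit (TensorProduct.lift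
      ((N.freeLact (tensorUnit (CoRep k H))).compl₁₂ (orbit (H := H) b)
        (N.unitTmul (tensorUnit (CoRep k H)))) t)
      = LinearMap.mul' k N.alg.carrier (TensorProduct.map (orbit (H := H) b) (orbit (H := H) 1)
        ((targetSubalgebra k H).val.toLinearMap.lTensor H t)) := fun t => by
    induction t using TensorProduct.induction_on with
    | zero =>
      rw [map_zero, map_zero, map_zero]
      exact (congrArg N.freeCounit (map_zero _)).trans (map_zero _)
    | add s t hs ht =>
      rw [map_add, map_add, map_add, ← hs, ← ht]
      exact (congrArg N.freeCounit (map_add _ s t)).trans (map_add _ _ _)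
    | tmul h w =>
      exact (N.freeCounit_lact _ _).trans (congrArg ((h • b) * ·) (N.freeCounit_unitTmul w))
  refine (h1 (unitCoact k H z)).trans ?_
  rw [lTensor_val_unitCoact, ← N.smul_mul, mul_one]

/-- Left linearity leaves the vectors 1 ⊗ z, for which the claim is z·b = (z·1) b. -/
theorem freeCounit_ractLin (b : N.alg.carrier) (t : N.Free (tensorUnit (CoRep k H))) :
    N.freeCounit (N.ractLin (tensorUnit (CoRep k H)) b t) = N.freeCounit t * b :=
  LinearMap.congr_fun (f := N.freeCounit ∘ₗ N.ractLin (tensorUnit (CoRep k H)) b)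
    (g := LinearMap.mulRight k b ∘ₗ N.freeCounit) (N.tensor_ext fun a z => by
      rw [LinearMap.comp_apply, LinearMap.comp_apply, LinearMap.mulRight_apply, ractLin_lact,
        ractLin_unitTmul]
      refine (N.freeCounit_lact a (N.twist _ b z)).trans
        (Eq.trans ?_ (congrArg (· * b) (N.freeCounit_lact a (N.unitTmul _ z))).symm)
      refine (congrArg (a * ·) (N.freeCounit_twist b z)).trans
        (Eq.trans ?_ (congrArg (fun t => a * t * b) (N.freeCounit_unitTmul z)).symm)
      exact (congrArg (a * ·) (N.smul_one_mul z b).symm).trans (mul_assoc _ _ _).symm) t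

/-- The map `A → A ⊗_{H^t} H^t`. -/
def freeUnit : N.alg.carrier →ₗ[k] N.Free (tensorUnit (CoRep k H)) :=
  (Bimod.tmul N.targetBimod (tensorUnit (CoRep k H)).bimod).flip (1 : targetSubalgebra k H)

theorem freeUnit_freeCounit (t : N.Free (tensorUnit (CoRep k H))) :
    N.freeUnit (N.freeCounit t) = t :=
  LinearMap.congr_fun (f := N.freeUnit ∘ₗ N.freeCounit) (g := LinearMap.id)
    (Bimod.tensor_ext fun a z =>
      (Bimod.ract_tmul (M := N.targetBimod) (N := (tensorUnit (CoRep k H)).bimod) a z _).trans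
        (congrArg (Bimod.tmul N.targetBimod (tensorUnit (CoRep k H)).bimod a)
          (mul_one (M := targetSubalgebra k H) z))) t

theorem freeCounit_freeUnit (a : N.alg.carrier) : N.freeCounit (N.freeUnit a) = a :=
  (N.freeCounit_tmul a 1).trans (by rw [OneMemClass.coe_one, one_smul, mul_one])

/-- The isomorphism `A ⊗_{H^t} H^t ≅ A`. -/
def freeUnitIso : N.freeBimod (tensorUnit (CoRep k H)) ≅ Bimod.regular N.alg :=
  Bimod.isoMk (M := N.freeBimod (tensorUnit (CoRep k H))) (N := Bimod.regular N.alg)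
    { toLin := N.freeCounit
      map_lact := N.freeCounit_lact
      map_ract := N.freeCounit_ractLin }
    N.freeUnit N.freeUnit_freeCounit N.freeCounit_freeUnit

theorem ractLin_tmul_one (a b : N.alg.carrier) :
    N.ractLin (tensorUnit (CoRep k H)) b (Bimod.tmul N.targetBimod
        (tensorUnit (CoRep k H)).bimod a (1 : targetSubalgebra k H))
      = Bimod.tmul N.targetBimod (tensorUnit (CoRep k H)).bimod (a * b : N.alg.carrier)
        (1 : targetSubalgebra k H) :=
  (N.freeUnitIso.inv.map_ract b a).symm

theorem freeMapLin_join (f : X ⟶ X') (g : Y ⟶ Y') (t : N.Free X) (y : Y.bimod.carrier) :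
    N.freeMapLin (CoRep.tensorHom f g) (N.join X Y t y)
      = N.join X' Y' (N.freeMapLin f t) (Hom.toLin g y) :=
  LinearMap.congr_fun (f := N.freeMapLin (CoRep.tensorHom f g) ∘ₗ (N.join X Y).flip y)
    (g := (N.join X' Y').flip (Hom.toLin g y) ∘ₗ N.freeMapLin f)
    (Bimod.tensor_ext fun _ _ => rfl) t

theorem freeMapLin_ractLin (f : X ⟶ Y) (b : N.alg.carrier) (t : N.Free X) :
    N.freeMapLin f (N.ractLin X b t) = N.ractLin Y b (N.freeMapLin f t) :=
  (N.freeMap f).map_ract b t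

theorem freeMul_map (f : X ⟶ X') (g : Y ⟶ Y') (t : N.Free X) (s : N.Free Y) :
    N.freeMul X' Y' (N.freeMapLin f t) (N.freeMapLin g s)
      = N.freeMapLin (CoRep.tensorHom f g) (N.freeMul X Y t s) :=
  LinearMap.congr_fun (f := N.freeMul X' Y' (N.freeMapLin f t) ∘ₗ N.freeMapLin g)
    (g := N.freeMapLin (CoRep.tensorHom f g) ∘ₗ N.freeMul X Y t)
    (Bimod.tensor_ext fun (b : N.alg.carrier) y => by
      refine Eq.trans ?_ (N.freeMapLin_join f g (N.ractLin X b t) y).symm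
      rw [freeMapLin_ractLin]
      rfl) s

theorem join_join (t : N.Free X) (y : Y.bimod.carrier) (z : Z.bimod.carrier) :
    N.freeMapLin (CoRep.assoc X Y Z).hom (N.join (tensorObj X Y) Z (N.join X Y t y) z)
      = N.join X (tensorObj Y Z) t (Bimod.tmul Y.bimod Z.bimod y z) :=
  LinearMap.congr_fun (f := N.freeMapLin (CoRep.assoc X Y Z).hom ∘ₗ
      (N.join (tensorObj X Y) Z).flip z ∘ₗ (N.join X Y).flip y)
    (g := (N.join X (tensorObj Y Z)).flip (Bimod.tmul Y.bimod Z.bimod y z))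
    (Bimod.tensor_ext fun _ _ => rfl) t

/-- The coefficients of r and s are moved to the left, the one of r past s by right linearity of
`freeMul`; what remains is the associator on base vectors. -/
theorem freeMul_assoc (t : N.Free X) (s : N.Free Y) (r : N.Free Z) :
    N.freeMapLin (CoRep.assoc X Y Z).hom
        (N.freeMul (tensorObj X Y) Z (N.freeMul X Y t s) r)
      = N.freeMul X (tensorObj Y Z) t (N.freeMul Y Z s r) := by
  have h1 : ∀ (z : Z.bimod.carrier) (s : N.Free Y), N.freeMapLin (CoRep.assoc X Y Z).hom
      (N.join (tensorObj X Y) Z (N.freeMul X Y t s) z)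
      = N.freeMul X (tensorObj Y Z) t (N.join Y Z s z) := fun z =>
    LinearMap.congr_fun (f := N.freeMapLin (CoRep.assoc X Y Z).hom ∘ₗ
      (N.join (tensorObj X Y) Z).flip z ∘ₗ N.freeMul X Y t)
      (g := N.freeMul X (tensorObj Y Z) t ∘ₗ (N.join Y Z).flip z) (N.tensor_ext fun b y => by
        refine (congrArg (fun t => N.freeMapLin (CoRep.assoc X Y Z).hom
          (N.join (tensorObj X Y) Z t z)) (N.freeMul_lact_unitTmul t b y)).trans
            ((N.join_join _ y z).trans (Eq.trans ?_ (congrArg (N.freeMul X (tensorObj Y Z) t)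
              (N.join_lact b (N.unitTmul Y y) z)).symm))
        exact (N.freeMul_lact_unitTmul (Y := tensorObj Y Z) t b
          (Bimod.tmul Y.bimod Z.bimod y z)).symm)
  exact LinearMap.congr_fun (f := N.freeMapLin (CoRep.assoc X Y Z).hom ∘ₗ
      N.freeMul (tensorObj X Y) Z (N.freeMul X Y t s))
    (g := N.freeMul X (tensorObj Y Z) t ∘ₗ N.freeMul Y Z s) (N.tensor_ext fun c z => by
      refine (congrArg (N.freeMapLin (CoRep.assoc X Y Z).hom)
        (N.freeMul_lact_unitTmul _ c z)).trans (Eq.trans ?_ (congrArg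
          (N.freeMul X (tensorObj Y Z) t) (N.freeMul_lact_unitTmul s c z)).symm)
      exact (congrArg (fun t => N.freeMapLin (CoRep.assoc X Y Z).hom
        (N.join (tensorObj X Y) Z t z)) (N.freeMul_ract t c s).symm).trans (h1 z _)) r

theorem freeMul_leftUnit (a : N.alg.carrier) (t : N.Free X) :
    N.freeMapLin (CoRep.leftUnit X).hom (N.freeMul (tensorUnit (CoRep k H)) X
      (Bimod.tmul N.targetBimod (tensorUnit (CoRep k H)).bimod a (1 : targetSubalgebra k H)) t)
      = N.freeLact X a t :=
  LinearMap.congr_fun (f := N.freeMapLin (CoRep.leftUnit X).hom ∘ₗ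
      N.freeMul (tensorUnit (CoRep k H)) X (Bimod.tmul N.targetBimod
        (tensorUnit (CoRep k H)).bimod a (1 : targetSubalgebra k H)))
    (g := N.freeLact X a) (Bimod.tensor_ext fun (b : N.alg.carrier) x => by
      refine (congrArg (fun t => N.freeMapLin (CoRep.leftUnit X).hom
        (N.join (tensorUnit (CoRep k H)) X t x)) (N.ractLin_tmul_one a b)).trans ?_
      exact congrArg (Bimod.tmul N.targetBimod X.bimod (a * b : N.alg.carrier))
        (X.bimod.one_lact x)) t

theorem freeMul_rightUnit (a : N.alg.carrier) (t : N.Free X) :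
    N.freeMapLin (CoRep.rightUnit X).hom (N.freeMul X (tensorUnit (CoRep k H)) t
      (Bimod.tmul N.targetBimod (tensorUnit (CoRep k H)).bimod a (1 : targetSubalgebra k H)))
      = N.ractLin X a t :=
  LinearMap.congr_fun (f := N.freeMapLin (CoRep.rightUnit X).hom ∘ₗ
      (N.join X (tensorUnit (CoRep k H))).flip (1 : targetSubalgebra k H))
    (g := LinearMap.id) (Bimod.tensor_ext fun (b : N.alg.carrier) x =>
      congrArg (Bimod.tmul N.targetBimod X.bimod b) (X.bimod.one_ract x)) (N.ractLin X a t)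

/-- The monoidal structure of `X ↦ A ⊗_{H^t} X`. -/
instance : N.freeFunctor.Monoidal :=
  Functor.CoreMonoidal.toMonoidal
    { εIso := N.freeUnitIso.symm
      μIso := N.freeMulIso
      μIso_hom_natural_left := fun f Y => Bimod.hom_ext (Bimod.tensor_ext fun t s =>
        (congrArg (N.freeMul _ Y (N.freeMapLin f t)) (LinearMap.congr_fun
          (congrArg Bimod.lin (N.freeFunctor.map_id Y)) s).symm).trans (N.freeMul_map f (𝟙 Y) t s))
      μIso_hom_natural_right := fun X f => Bimod.hom_ext (Bimod.tensor_ext fun t s =>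
        (congrArg (fun t => N.freeMul X _ t (N.freeMapLin f s)) (LinearMap.congr_fun
          (congrArg Bimod.lin (N.freeFunctor.map_id X)) t).symm).trans (N.freeMul_map (𝟙 X) f t s))
      associativity := fun X Y Z => Bimod.hom_ext (Bimod.tensor_ext₃ fun t s r =>
        N.freeMul_assoc t s r)
      left_unitality := fun X => Bimod.hom_ext (Bimod.tensor_ext fun a t =>
        (N.freeMul_leftUnit a t).symm)
      right_unitality := fun X => Bimod.hom_ext (Bimod.tensor_ext fun t a =>
        (N.freeMul_rightUnit a t).symm) }

/-- The based action of a module algebra, with base spaces `1 ⊗ X ⊆ A ⊗_{H^t} X`. -/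
def freeAction : BasedAction k H N.alg where
  functor := N.freeFunctor
  base X := LinearMap.range (N.unitTmul X)
  finiteDimensional X := inferInstanceAs
    (FiniteDimensional k (LinearMap.range (N.unitTmul X)))
  map_mem := by
    rintro X Y f _ ⟨x, rfl⟩
    exact ⟨Hom.toLin f x, rfl⟩
  one_mem := ⟨(1 : targetSubalgebra k H), rfl⟩
  mul_mem := by
    rintro X Y _ ⟨x, rfl⟩ _ ⟨y, rfl⟩
    exact ⟨Bimod.tmul X.bimod Y.bimod x y, (N.freeMul_unitTmul (N.unitTmul X x) y).symm⟩

/-- A right H^t-linear retraction of H^t → A, tensored with X, gives a left inverse of x ↦ 1 ⊗ x. A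
merely linear retraction exists by hypothesis, and H^t is separable, so it can be averaged. -/
theorem unitTmul_injective (hN : faithful k H N) (X : CoRep k H) :
    Function.Injective (N.unitTmul X) := by
  let f : targetSubalgebra k H →ₗ[k] N.alg.carrier :=
    orbit (H := H) 1 ∘ₗ (targetSubalgebra k H).val.toLinearMap
  obtain ⟨r, hr⟩ := LinearMap.exists_leftInverse_of_injective f (LinearMap.ker_eq_bot.2 hN)
  have hr' : ∀ z : targetSubalgebra k H, r ((z : H) • (1 : N.alg.carrier)) = z := LinearMap.congr_fun hr
  let K : N.alg.carrier → targetSubalgebra k H ⊗[k] targetSubalgebra k H →ₗ[k]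
      targetSubalgebra k H := fun a => LinearMap.mul' k (targetSubalgebra k H) ∘ₗ
    (r ∘ₗ LinearMap.mulLeft k a ∘ₗ f).rTensor (targetSubalgebra k H)
  -- The averaged retraction a ↦ r(a e₁) e₂, where e is the separability idempotent.
  let r' : N.alg.carrier →ₗ[k] targetSubalgebra k H :=
    { toFun := fun a => K a (separability k H)
      map_add' := fun a b => by
        generalize separability k H = t
        induction t using TensorProduct.induction_on with
        | zero => simp
        | add s t hs ht => simp only [map_add, hs, ht]; abel
        | tmul z w => simp [K, add_mul]
      map_smul' := fun c a => by
        generalize separability k H = t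
        induction t using TensorProduct.induction_on with
        | zero => simp
        | add s t hs ht => simp only [map_add, hs, ht, smul_add]
        | tmul z w => simp [K] }
  have h1 : r' 1 = 1 := by
    refine Eq.trans ?_ mul_separability
    change K 1 (separability k H) = _
    congr 1
    exact TensorProduct.ext' fun z w => by
      simp only [K, LinearMap.comp_apply, LinearMap.rTensor_tmul, LinearMap.mulLeft_apply, one_mul,
        LinearMap.mul'_apply]
      exact congrArg (· * w) (hr' z)
  -- Right linearity of the average is z e₁ ⊗ e₂ = e₁ ⊗ e₂ z; the normalisation r'(1) = 1 was e₁ e₂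
  -- = 1.
  have h2 : ∀ a (z : targetSubalgebra k H), r' (a * ((z : H) • (1 : N.alg.carrier)))
      = r' a * z := fun a z => by
    have e1 : ∀ t, K (a * ((z : H) • (1 : N.alg.carrier))) t
        = K a (TensorProduct.map (LinearMap.mulLeft k z) LinearMap.id t) := fun t => by
      induction t using TensorProduct.induction_on with
      | zero => simp
      | add s t hs ht => simp only [map_add, hs, ht]
      | tmul x y =>
        simp only [K, LinearMap.comp_apply, LinearMap.rTensor_tmul, LinearMap.mulLeft_apply,
          LinearMap.mul'_apply, TensorProduct.map_tmul, LinearMap.id_apply]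
        congr 2
        rw [mul_assoc, smul_one_mul]
        exact congrArg (a * ·) (mul_smul (z : H) (x : H) (1 : N.alg.carrier)).symm
    have e2 : ∀ t, K a (TensorProduct.map LinearMap.id (LinearMap.mulRight k z) t)
        = K a t * z := fun t => by
      induction t using TensorProduct.induction_on with
      | zero => simp
      | add s t hs ht => simp only [map_add, hs, ht, add_mul]
      | tmul x y => simp [K, mul_assoc]
    exact (e1 _).trans ((congrArg (K a) (map_mulLeft_separability z)).trans (e2 _))
  let g : N.Free X →ₗ[k] X.bimod.carrier := Bimod.lift (M := N.targetBimod) (N := X.bimod)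
    (X.bimod.lact ∘ₗ r') fun (a : N.alg.carrier) z x => by
      change X.bimod.lact (r' (a * ((z : H) • (1 : N.alg.carrier)))) x
        = X.bimod.lact (r' a) (X.bimod.lact z x)
      rw [h2]
      exact X.bimod.mul_lact (r' a) z x
  exact Function.LeftInverse.injective (g := g) fun x =>
    (congrArg (fun z => X.bimod.lact z x) h1).trans (X.bimod.one_lact x)

/-- The based action over the weak fibre functor of a module algebra. -/
noncomputable def freeFiberedAction (hN : faithful k H N) : FiberedAction k H N.alg where
  toBasedAction := N.freeAction
  identification := NatIso.ofComponents
    (fun X => (LinearEquiv.ofInjective (N.unitTmul X) (N.unitTmul_injective hN X)).toModuleIso)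
    fun f => ModuleCat.hom_ext (LinearMap.ext fun x => Subtype.ext rfl)
  isMonoidal :=
    { unit := ModuleCat.hom_ext (LinearMap.ext fun (c : k) => Subtype.ext
        (map_smul (N.unitTmul (tensorUnit (CoRep k H))) c (1 : targetSubalgebra k H)))
      tensor := fun X Y => ModuleCat.hom_ext (TensorProduct.ext' fun x y => Subtype.ext
        (N.freeMul_unitTmul (N.unitTmul X x) y).symm) }

theorem freeFiberedAction_iota (hN : faithful k H N) (z : targetSubalgebra k H) :
    (N.freeFiberedAction hN).iota z = (z : H) • (1 : N.alg.carrier) := N.freeCounit_unitTmul z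

theorem freeFiberedAction_projTarget (hN : faithful k H N) (a : N.alg.carrier) (h : H) :
    (N.freeFiberedAction hN).projTarget (N.freeLact (regular k H) a (N.unitTmul (regular k H) h))
      = a * (h • (1 : N.alg.carrier)) := by
  refine ((N.freeFiberedAction hN).projTarget_lact_baseMap a h).trans ?_
  rw [freeFiberedAction_iota, N.smul_one h]
  rfl

theorem freeFiberedAction_act_eq (hN : faithful k H N) (h : H) (a : N.alg.carrier) :
    (N.freeFiberedAction hN).act h a = (N.freeFiberedAction hN).projTarget
      (N.ractLin (regular k H) a (N.unitTmul (regular k H) h)) :=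
  (N.freeFiberedAction hN).act_apply h a

/-- Meant for `projTarget`, of which only the property `hP` matters: (1 ⊗ h) a is (h₁·a) ⊗ h₂, and
`P` sends it to (h₁·a)(h₂·1) = h·(a 1). -/
theorem map_ractLin_unitTmul (P : N.Free (regular k H) →ₗ[k] N.alg.carrier)
    (hP : ∀ (a : N.alg.carrier) (h : H), P (N.freeLact (regular k H) a
      (N.unitTmul (regular k H) h)) = a * (h • (1 : N.alg.carrier)))
    (a : N.alg.carrier) (h : H) :
    P (N.ractLin (regular k H) a (N.unitTmul (regular k H) h)) = h • a := by
  have h3 : ∀ t : H ⊗[k] H, P (TensorProduct.lift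
      ((N.freeLact (regular k H)).compl₁₂ (orbit (H := H) a) (N.unitTmul (regular k H))) t)
      = LinearMap.mul' k N.alg.carrier (TensorProduct.map (orbit (H := H) a)
        (orbit (H := H) 1) t) := fun t => by
    induction t using TensorProduct.induction_on with
    | zero =>
      rw [map_zero, map_zero]
      exact (congrArg P (map_zero _)).trans (map_zero _)
    | add s t hs ht =>
      rw [map_add, map_add, ← hs, ← ht]
      exact (congrArg P (map_add _ s t)).trans (map_add _ _ _)
    | tmul x y => exact hP (x • a) y
  refine (congrArg P (N.ractLin_unitTmul (X := regular k H) a h)).trans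
    ((h3 (comul h)).trans ?_)
  rw [← N.smul_mul, mul_one]

theorem freeFiberedAction_act (hN : faithful k H N) (h : H) (a : N.alg.carrier) :
    (N.freeFiberedAction hN).act h a = h • a :=
  (N.freeFiberedAction_act_eq hN h a).trans
    (N.map_ractLin_unitTmul _ (N.freeFiberedAction_projTarget hN) a h)

end ModAlg

/-- The module structure recovered from the based action of A is the original one, so the identity
of A is an isomorphism of module algebras. -/
instance : (toModAlgFunctor k H).EssSurj where
  mem_essImage N := by
    let V := N.obj.freeFiberedAction N.property
    let f : V.toModAlg ⟶ N.obj := ⟨AlgHom.id k _, N.obj.freeFiberedAction_act N.property⟩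
    let g : N.obj ⟶ V.toModAlg :=
      ⟨AlgHom.id k _, fun h a => (N.obj.freeFiberedAction_act N.property h a).symm⟩
    exact ⟨⟨N.obj.alg, V⟩, ⟨ObjectProperty.isoMk _ ⟨f, g, rfl, rfl⟩⟩⟩

instance : (toModAlgFunctor k H).IsEquivalence where

/-- If the unit object of the category of `H`-modules is simple, then `H^t → A` is injective for
every nonzero module algebra `A`. -/
theorem ModAlg.faithful_iff_nontrivial (h : UnitSimple k H) (M : ModAlg k H) :
    ModAlg.faithful k H M ↔ Nontrivial M.alg.carrier := by
  obtain ⟨h1, h2⟩ := h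
  constructor
  · intro hM
    exact hM.nontrivial
  · intro hM
    -- The annihilator of 1 in H^t. It is stable under the action on H^t since ε_t(h z)·1 = (h z)·1,
    -- and it is proper since 1·1 = 1 ≠ 0.
    let I : Submodule k H := LinearMap.ker (orbit (k := k) (H := H) (1 : M.alg.carrier)) ⊓
      Subalgebra.toSubmodule (targetSubalgebra k H)
    have hI : I = ⊥ := by
      refine (h2 I inf_le_right fun h z hz => ⟨?_, ?_⟩).resolve_right fun hI => ?_
      · have h3 : z • (1 : M.alg.carrier) = 0 := hz.1
        change targetMap k H (h * z) • (1 : M.alg.carrier) = 0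
        rw [← M.smul_one, mul_smul, h3, smul_zero]
      · exact (toTarget k H (h * z)).2
      · have h3 : (1 : H) ∈ I := hI ▸ (one_mem (targetSubalgebra k H))
        have h4 : (1 : H) • (1 : M.alg.carrier) = 0 := h3.1
        rw [one_smul] at h4
        exact one_ne_zero h4
    intro z w hzw
    have h3 : ((z - w : targetSubalgebra k H) : H) ∈ I := by
      refine ⟨?_, (z - w).2⟩
      change ((z : H) - w) • (1 : M.alg.carrier) = 0
      rw [sub_smul]
      exact sub_eq_zero.2 hzw
    rw [hI] at h3
    exact sub_eq_zero.1 (Subtype.ext h3)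

end BasedAct

/-! ### The main theorem. -/

theorem mainTheorem4 (k H : Type u) [Field k] [Ring H] [Algebra k H]
    [BasedAct.WeakHopfAlgebra k H] [FiniteDimensional k H] [IsSemisimpleRing H] :
    (∃ (E : BasedAct.BasedAlg k H ≌ (BasedAct.ModAlg.faithful k H).FullSubcategory)
        (ψ : E.functor ⋙ (BasedAct.ModAlg.faithful k H).ι ⋙ BasedAct.ModAlg.forget k H
          ≅ BasedAct.BasedAlg.forget k H),
      ∀ (A : BasedAct.Alg.{u} k) (V W : BasedAct.FiberedAction k H A),
        V.Equivalent W.toBasedAction ↔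
          BasedAct.ModAlg.JTwisted (E.functor.obj ⟨A, V⟩).obj (E.functor.obj ⟨A, W⟩).obj
            (ψ.app ⟨A, V⟩ ≪≫ (ψ.app ⟨A, W⟩).symm).toAlgEquiv) ∧
    (BasedAct.UnitSimple k H →
      ∀ M : BasedAct.ModAlg k H,
        BasedAct.ModAlg.faithful k H M ↔ Nontrivial M.alg.carrier) :=
  ⟨⟨(BasedAct.toModAlgFunctor k H).asEquivalence, BasedAct.toModAlgFunctorForget k H,
    -- The components of `toModAlgFunctorForget` are identities, so the comparison isomorphism of
    -- algebras is the identity of A and the criterion along the identity applies as it stands.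
    fun _ V W => V.equivalent_iff_jTwisted W⟩,
    fun h M => M.faithful_iff_nontrivial h⟩
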